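/- **Setting.** Let $H$ be a complex Hilbert space, $\omega>0$, and let $\mathcal H=L^2([0,\omega],H)$ with $\langle x,y\rangle=\frac1\omega\int_0^\omega\langle x(s),y(s)\rangle_H\,ds$. Let $\mathcal V:[0,\omega]\to B(H)$ be such that $s\mapsto\mathcal V(s)x$ is in $L^2([0,\omega],H)$ for every $x\in H$, and let $\widehat{\mathcal V}(n)\in B(H)$, $\widehat{\mathcal V}(n)x=\frac1\omega\int_0^\omega\mathcal V(s)x\,e^{-i2\pi ns/\omega}ds$, be its Fourier coefficients. Assume $$\sum_{n\in\mathbb Z}\|\widehat{\mathcal V}(n)\|^2<\infty,\qquad \sum_{j,\ell\in\mathbb Z}\Big\|\sum_{n\ne\ell}\frac{\widehat{\mathcal V}(j+n)\widehat{\mathcal V}(\ell+n)}{\ell-n}\Big\|^2<\infty .$$ Let $L_0=\frac{d}{ds}$ with domain $D(L_0)=\{y\in W_2^1([0,\omega],H): y(0)=y(\omega)\}$, let $(Vy)(s)=\mathcal V(s)y(\omega-s)$ (for those $y\in\mathcal H$ for which this is in $\mathcal H$; this includes $D(L_0)$), and let $L=L_0-V$ with $D(L)=D(L_0)$. Let $\lambda_\ell=i2\pi\ell/\omega$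 and let $\mathcal P=\{P_\ell\}_{\ell\in\mathbb Z}$ be the resolution of the identity formed by the spectral projections of $L_0$, $(P_\ell x)(s)=\widehat x(\ell)e^{\lambda_\ell s}$ with $\widehat x(\ell)=\frac1\omega\int_0^\omega x(\tau)e^{-\lambda_\ell\tau}d\tau$, so that $L_0=\bigoplus_\ell\lambda_\ell I_\ell$, where $I_\ell$ is the identity of $\mathcal H_\ell=\mathrm{Im}\,P_\ell$. For $k\in\mathbb Z_+$ put $P_{(k)}=\sum_{|\ell|\le k}P_\ell$ and $\mathcal H_{(k)}=\mathrm{Im}\,P_{(k)}$. Let $\mathfrak S_2(\mathcal H,\mathcal P)$ be the set of $X\in B(\mathcal H)$ with $\sum_{j,\ell}\|P_jXP_\ell\|^2<\infty$ (operator norms). A closed operator $A$ is the *orthogonal direct sum* $\bigoplus_iA_i$ of bounded operators $A_i\in B(\mathcal E_i)$ with respect to an orthogonal decomposition $\mathcal H=\bigoplus_i\mathcal E_i$ with orthogonal projections $Q_i$ if $D(A)=\{x:\sum_i\|A_iQ_ix\|^2<\infty\}$, each $\mathcal E_i$ is contained in $D(A)$ and is invariant under $A$ with $A|_{\mathcal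 E_i}=A_i$, and $Ax=\sum_iA_iQ_ix$ unconditionally for $x\in D(A)$. For an invertible $U\in B(\mathcal H)$, a closed operator $A$ is the *$U$-orthogonal direct sum* of the operators $UA_iU^{-1}\in B(U\mathcal E_i)$, with respect to $\mathcal H=\bigoplus_iU\mathcal E_i$, if $U^{-1}AU$ (with domain $U^{-1}D(A)$) is the orthogonal direct sum $\bigoplus_iA_i$. **Theorem.** There are $k\in\mathbb Z_+$, a continuously invertible $U\in B(\mathcal H)$ of the form $U=I+W$ with $W\in\mathfrak S_2(\mathcal H,\mathcal P)$, and $V_0\in\mathfrak S_2(\mathcal H,\mathcal P)$ such that $L$ is similar to $L_0-V_0$ through $U$, $$LU=U(L_0-V_0),\qquad UD(L_0)=D(L),$$ and the subspaces $\mathcal H_{(k)}$ and $\mathcal H_\ell$, $|\ell|>k$, are invariant for $V_0$. Moreover, with $V_{0(k)}$ and $V_{0,\ell}$ denoting the restrictions of $V_0$ to these subspaces, $V_0=V_{0(k)}\oplus\bigoplus_{|\ell|>k}V_{0,\ell}$ and $L$ is the $U$-orthogonal direct sum $$L=U\Big(L_0-\Big(V_{0(k)}\oplus\bigoplus_{|\ell|>k}V_{0,\ell}\Big)\Big)U^{-1}$$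 with respect to $\mathcal H=U\mathcal H_{(k)}\oplus\bigoplus_{|\ell|>k}U\mathcal H_\ell$; that is, its parts are $U\big((L_0)_{(k)}-V_{0(k)}\big)U^{-1}$ on $U\mathcal H_{(k)}$, where $(L_0)_{(k)}=L_0|_{\mathcal H_{(k)}}$, and $U(\lambda_\ell I_\ell-V_{0,\ell})U^{-1}$ on $U\mathcal H_\ell$, $|\ell|>k$. -/

import Mathlib

set_option linter.unusedSectionVars false

open MeasureTheory

/-! ### The Hilbert space `L²([0, ω], H)` -/

/-- The normalised Lebesgue measure `ds / ω` on `[0, ω]`. -/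
noncomputable def intervalMeasure (ω : ℝ) : Measure ℝ :=
  ENNReal.ofReal ω⁻¹ • volume.restrict (Set.Icc 0 ω)

/-- `L²([0, ω], H)`; because of the normalisation of the measure its inner product is
`⟪x, y⟫ = ω⁻¹ ∫₀^ω ⟪x s, y s⟫ ds`. -/
abbrev L2 (ω : ℝ) (H : Type*) [NormedAddCommGroup H] : Type _ :=
  Lp H 2 (intervalMeasure ω)

instance intervalMeasure_isFinite (ω : ℝ) : IsFiniteMeasure (intervalMeasure ω) := by
  unfold intervalMeasure
  exact Measure.smul_finite _ ENNReal.ofReal_ne_top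

/-- A property that holds almost everywhere on `[0, ω]` in the usual sense holds almost everywhere
for the normalised measure, and conversely if `ω > 0`. -/
theorem ae_intervalMeasure_iff {ω : ℝ} (hω : 0 < ω) {p : ℝ → Prop} :
    (∀ᵐ s ∂(intervalMeasure ω), p s) ↔ ∀ᵐ s ∂(volume.restrict (Set.Icc 0 ω)), p s := by
  unfold intervalMeasure
  refine Measure.ae_ennreal_smul_measure_iff ?_
  simpa using hω

theorem intervalMeasure_eq_zero {ω : ℝ} (hω : ω ≤ 0) : intervalMeasure ω = 0 := by
  unfold intervalMeasure
  rw [ENNReal.ofReal_of_nonpos (inv_nonpos.2 hω), zero_smul]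

/-- The reflection `s ↦ ω - s` preserves the measure. -/
theorem measurePreserving_reflect (ω : ℝ) :
    MeasurePreserving (fun s : ℝ => ω - s) (intervalMeasure ω) (intervalMeasure ω) := by
  have h := (Measure.measurePreserving_sub_left volume ω).restrict_preimage
    (measurableSet_Icc (a := (0 : ℝ)) (b := ω))
  have h2 : (fun s : ℝ => ω - s) ⁻¹' Set.Icc 0 ω = Set.Icc 0 ω := by
    ext s; simp only [Set.mem_preimage, Set.mem_Icc]; constructor <;> intro h <;>
      constructor <;> linarith [h.1, h.2]
  rw [h2] at h
  refine ⟨h.measurable, ?_⟩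
  unfold intervalMeasure
  rw [Measure.map_smul, h.map_eq]

section

variable {H : Type*} [NormedAddCommGroup H] [InnerProductSpace ℂ H] [CompleteSpace H]

/-! ### Fourier coefficients and the projections `P_ℓ` -/

/-- The number `λ_ℓ = i 2πℓ/ω`. -/
noncomputable def freq (ω : ℝ) (ℓ : ℤ) : ℂ := Complex.I * (2 * Real.pi * ℓ / ω)

theorem norm_exp_freq_mul (ω : ℝ) (ℓ : ℤ) (s : ℝ) : ‖Complex.exp (freq ω ℓ * s)‖ = 1 := by
  have : freq ω ℓ * s = ((2 * Real.pi * ℓ / ω * s : ℝ) : ℂ) * Complex.I := by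
    unfold freq; push_cast; ring
  rw [this, Complex.norm_exp_ofReal_mul_I]

theorem norm_exp_neg_freq_mul (ω : ℝ) (ℓ : ℤ) (s : ℝ) :
    ‖Complex.exp (-(freq ω ℓ * s))‖ = 1 := by
  rw [Complex.exp_neg, norm_inv, norm_exp_freq_mul, inv_one]

/-- The Fourier coefficient `x̂(ℓ) = ω⁻¹ ∫_{[0, ω]} x(τ) e^{-i 2πℓτ/ω} dτ` of a function. -/
noncomputable def fourierInt (ω : ℝ) (ℓ : ℤ) (f : ℝ → H) : H :=
  (ω⁻¹ : ℝ) • ∫ τ in Set.Icc 0 ω, Complex.exp (-(freq ω ℓ * τ)) • f τ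

theorem fourierInt_eq (ω : ℝ) (ℓ : ℤ) (f : ℝ → H) :
    fourierInt ω ℓ f = ∫ τ, Complex.exp (-(freq ω ℓ * τ)) • f τ ∂(intervalMeasure ω) := by
  unfold fourierInt intervalMeasure
  rw [integral_smul_measure]
  rcases le_or_gt 0 ω with h | h
  · rw [ENNReal.toReal_ofReal (inv_nonneg.2 h)]
  · simp [Set.Icc_eq_empty (not_le.2 h)]

theorem integrable_exp_smul (ω : ℝ) (ℓ : ℤ) {f : ℝ → H} (hf : MemLp f 2 (intervalMeasure ω)) :
    Integrable (fun τ : ℝ => Complex.exp (-(freq ω ℓ * τ)) • f τ) (intervalMeasure ω) := by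
  have hfi : Integrable f (intervalMeasure ω) := hf.integrable (by norm_num)
  refine hfi.bdd_smul (C := 1) ?_ ?_
  · exact (by fun_prop : Continuous fun τ : ℝ =>
      Complex.exp (-(freq ω ℓ * τ))).aestronglyMeasurable
  · exact Filter.Eventually.of_forall fun s => (norm_exp_neg_freq_mul ω ℓ s).le

/-- The `ℓ`-th Fourier coefficient as a bounded operator `L²([0, ω], H) → H`. -/
noncomputable def coeffCLM (ω : ℝ) (H : Type*) [NormedAddCommGroup H] [InnerProductSpace ℂ H]
    [CompleteSpace H] (ℓ : ℤ) : L2 ω H →L[ℂ] H :=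
  LinearMap.mkContinuous
    { toFun := fun x => fourierInt ω ℓ x
      map_add' := fun x y => by
        simp only [fourierInt_eq]
        rw [← integral_add (integrable_exp_smul ω ℓ (Lp.memLp x))
          (integrable_exp_smul ω ℓ (Lp.memLp y))]
        refine integral_congr_ae ?_
        filter_upwards [Lp.coeFn_add x y] with s hs
        rw [hs, Pi.add_apply, smul_add]
      map_smul' := fun c x => by
        simp only [fourierInt_eq, RingHom.id_apply]
        rw [← integral_smul]
        refine integral_congr_ae ?_
        filter_upwards [Lp.coeFn_smul c x] with s hs
        rw [hs, Pi.smul_apply, smul_comm] }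
    ((intervalMeasure ω Set.univ ^ (1 / (1 : ENNReal).toReal - 1 / (2 : ENNReal).toReal)).toReal)
    (fun x => by
      change ‖fourierInt ω ℓ x‖ ≤ _
      rw [fourierInt_eq]
      refine (norm_integral_le_integral_norm _).trans ?_
      simp only [norm_smul, norm_exp_neg_freq_mul, one_mul]
      have hx := Lp.memLp x
      rw [integral_norm_eq_lintegral_enorm hx.1, ← eLpNorm_one_eq_lintegral_enorm, Lp.norm_def,
        mul_comm, ← ENNReal.toReal_mul]
      refine ENNReal.toReal_mono ?_
        (eLpNorm_le_eLpNorm_mul_rpow_measure_univ (by norm_num) hx.1)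
      refine ENNReal.mul_ne_top hx.2.ne (ENNReal.rpow_ne_top_of_nonneg ?_ (measure_ne_top _ _))
      norm_num)

theorem coeffCLM_apply (ω : ℝ) (ℓ : ℤ) (x : L2 ω H) : coeffCLM ω H ℓ x = fourierInt ω ℓ x := rfl

/-- For a family of operators `𝒱(s)` such that `s ↦ 𝒱(s) x` is in `L²` for every `x`, the map
`x ↦ 𝒱(·) x` is a bounded operator `H → L²([0, ω], H)` (closed graph theorem). -/
noncomputable def toL2CLM (ω : ℝ) (𝒱 : ℝ → H →L[ℂ] H)
    (h𝒱 : ∀ x : H, MemLp (fun s => 𝒱 s x) 2 (intervalMeasure ω)) : H →L[ℂ] L2 ω H :=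
  let T : H →ₗ[ℂ] L2 ω H :=
    { toFun := fun x => (h𝒱 x).toLp _
      map_add' := fun x y => by
        rw [← MemLp.toLp_add]
        exact MemLp.toLp_congr _ _ (Filter.Eventually.of_forall fun s => map_add (𝒱 s) x y)
      map_smul' := fun c x => by
        rw [RingHom.id_apply, ← MemLp.toLp_const_smul]
        exact MemLp.toLp_congr _ _ (Filter.Eventually.of_forall fun s => map_smul (𝒱 s) c x) }
  { toLinearMap := T
    cont := T.continuous_of_seq_closed_graph fun u x g hu hg => by
      obtain ⟨ns, hns, hlim⟩ := (tendstoInMeasure_of_tendsto_Lp hg).exists_seq_tendsto_ae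
      apply Lp.ext
      have hall : ∀ᵐ s ∂(intervalMeasure ω), ∀ n, (T (u n) : ℝ → H) s = 𝒱 s (u n) :=
        ae_all_iff.2 fun n => (h𝒱 (u n)).coeFn_toLp
      filter_upwards [hlim, hall, (h𝒱 x).coeFn_toLp] with s h1 h2 h3
      refine Eq.trans (tendsto_nhds_unique h1 ?_) h3.symm
      simp only [Function.comp_apply, h2]
      exact ((𝒱 s).continuous.tendsto x).comp (hu.comp hns.tendsto_atTop) }

theorem toL2CLM_coeFn (ω : ℝ) (𝒱 : ℝ → H →L[ℂ] H)
    (h𝒱 : ∀ x : H, MemLp (fun s => 𝒱 s x) 2 (intervalMeasure ω)) (x : H) :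
    toL2CLM ω 𝒱 h𝒱 x =ᵐ[intervalMeasure ω] fun s => 𝒱 s x :=
  (h𝒱 x).coeFn_toLp

/-- The Fourier coefficient `𝒱̂(n) ∈ B(H)` of an operator-valued function,
`𝒱̂(n) x = ω⁻¹ ∫_{[0, ω]} 𝒱(s) x e^{-i 2πns/ω} ds`. -/
noncomputable def potentialCoeff (ω : ℝ) (𝒱 : ℝ → H →L[ℂ] H)
    (h𝒱 : ∀ x : H, MemLp (fun s => 𝒱 s x) 2 (intervalMeasure ω)) (n : ℤ) : H →L[ℂ] H :=
  (coeffCLM ω H n).comp (toL2CLM ω 𝒱 h𝒱)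

theorem potentialCoeff_apply (ω : ℝ) (𝒱 : ℝ → H →L[ℂ] H)
    (h𝒱 : ∀ x : H, MemLp (fun s => 𝒱 s x) 2 (intervalMeasure ω)) (n : ℤ) (x : H) :
    potentialCoeff ω 𝒱 h𝒱 n x = fourierInt ω n (fun s => 𝒱 s x) := by
  change fourierInt ω n (toL2CLM ω 𝒱 h𝒱 x) = _
  rw [fourierInt_eq, fourierInt_eq]
  refine integral_congr_ae ?_
  filter_upwards [toL2CLM_coeFn ω 𝒱 h𝒱 x] with s hs
  rw [hs]

theorem memLp_exp_smul (ω : ℝ) (ℓ : ℤ) (x : H) :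
    MemLp (fun s : ℝ => (Complex.exp (freq ω ℓ * s) • (1 : H →L[ℂ] H)) x) 2
      (intervalMeasure ω) := by
  refine MemLp.of_bound (Continuous.aestronglyMeasurable ?_) ‖x‖
    (Filter.Eventually.of_forall fun s => ?_)
  · simp only [smul_apply, one_apply_eq_self]
    fun_prop
  · simp [norm_smul, norm_exp_freq_mul]

/-- The projection `(P_ℓ x)(s) = x̂(ℓ) e^{i 2πℓs/ω}` in `L²([0, ω], H)`. -/
noncomputable def fourierProj (ω : ℝ) (H : Type*) [NormedAddCommGroup H]
    [InnerProductSpace ℂ H] [CompleteSpace H] (ℓ : ℤ) : L2 ω H →L[ℂ] L2 ω H :=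
  (toL2CLM ω (fun s : ℝ => Complex.exp (freq ω ℓ * s) • (1 : H →L[ℂ] H))
    (memLp_exp_smul ω ℓ)).comp (coeffCLM ω H ℓ)

theorem fourierProj_coeFn (ω : ℝ) (ℓ : ℤ) (x : L2 ω H) :
    fourierProj ω H ℓ x =ᵐ[intervalMeasure ω]
      fun s : ℝ => Complex.exp (freq ω ℓ * s) • fourierInt ω ℓ x :=
  toL2CLM_coeFn ω _ (memLp_exp_smul ω ℓ) (coeffCLM ω H ℓ x)

/-! ### The differential operators -/

/-- `IsPeriodicDeriv ω y g`: the class `y` has an absolutely continuous representative `f` on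
`[0, ω]` with derivative `g ∈ L²` (so `y ∈ W₂¹` and `y' = g`) and `f 0 = f ω`. -/
def IsPeriodicDeriv (ω : ℝ) (y g : L2 ω H) : Prop :=
  ∃ f : ℝ → H, y =ᵐ[intervalMeasure ω] f ∧
    (∀ s ∈ Set.Icc 0 ω, f s = f 0 + ∫ τ in (0 : ℝ)..s, g τ) ∧ f 0 = f ω

theorem L2.integrableOn {ω : ℝ} (hω : 0 < ω) (g : L2 ω H) :
    IntegrableOn g (Set.Icc 0 ω) volume := by
  have h : Integrable g (intervalMeasure ω) := (Lp.memLp g).integrable (by norm_num)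
  unfold intervalMeasure at h
  exact (integrable_smul_measure (by simpa using hω) ENNReal.ofReal_ne_top).1 h

theorem L2.intervalIntegrable {ω : ℝ} (hω : 0 < ω) (g : L2 ω H) {s : ℝ}
    (hs : s ∈ Set.Icc 0 ω) : IntervalIntegrable g volume 0 s := by
  rw [intervalIntegrable_iff_integrableOn_Icc_of_le hs.1]
  exact (L2.integrableOn hω g).mono_set (Set.Icc_subset_Icc_right hs.2)

theorem L2.subsingleton {ω : ℝ} (hω : ω ≤ 0) (x y : L2 ω H) : x = y := by
  apply Lp.ext
  have : (ae (intervalMeasure ω)) = ⊥ := by rw [intervalMeasure_eq_zero hω, ae_zero]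
  rw [this]
  exact Filter.eventually_bot

theorem IsPeriodicDeriv.unique {ω : ℝ} {y g₁ g₂ : L2 ω H} (h₁ : IsPeriodicDeriv ω y g₁)
    (h₂ : IsPeriodicDeriv ω y g₂) : g₁ = g₂ := by
  rcases le_or_gt ω 0 with hω | hω
  · exact L2.subsingleton hω _ _
  obtain ⟨f₁, hy₁, hf₁, -⟩ := h₁
  obtain ⟨f₂, hy₂, hf₂, -⟩ := h₂
  have hcont : ∀ (f : ℝ → H) (g : L2 ω H),
      (∀ s ∈ Set.Icc 0 ω, f s = f 0 + ∫ τ in (0 : ℝ)..s, g τ) →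
      ContinuousOn f (Set.Icc 0 ω) := by
    intro f g hf
    refine ContinuousOn.congr (continuousOn_const.add ?_) hf
    have := intervalIntegral.continuousOn_primitive_interval (μ := volume) (f := g)
      (a := 0) (b := ω) (by rw [Set.uIcc_of_le hω.le]; exact L2.integrableOn hω g)
    rwa [Set.uIcc_of_le hω.le] at this
  have heq : Set.EqOn f₁ f₂ (Set.Icc 0 ω) :=
    Measure.eqOn_Icc_of_ae_eq volume hω.ne
      ((ae_intervalMeasure_iff hω).1 (hy₁.symm.trans hy₂)) (hcont f₁ g₁ hf₁) (hcont f₂ g₂ hf₂)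
  have hint : ∀ s ∈ Set.Icc 0 ω,
      ∫ τ in (0 : ℝ)..s, g₁ τ = ∫ τ in (0 : ℝ)..s, g₂ τ := by
    intro s hs
    have h0 : f₁ 0 = f₂ 0 := heq ⟨le_rfl, hω.le⟩
    have := heq hs
    rw [hf₁ s hs, hf₂ s hs, h0] at this
    exact add_left_cancel this
  apply Lp.ext
  refine (ae_intervalMeasure_iff hω).2 ?_
  rw [ae_restrict_iff' measurableSet_Icc]
  have hw : ω ∈ Set.Icc 0 ω := ⟨hω.le, le_rfl⟩
  have hne0 : ∀ᵐ s : ℝ, s ≠ 0 := by simp [ae_iff, measure_singleton]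
  have hneω : ∀ᵐ s : ℝ, s ≠ ω := by simp [ae_iff, measure_singleton]
  filter_upwards [(L2.intervalIntegrable hω g₁ hw).ae_hasDerivAt_integral,
    (L2.intervalIntegrable hω g₂ hw).ae_hasDerivAt_integral, hne0, hneω] with s d₁ d₂ hs0 hsω hs
  rw [Set.uIcc_of_le hω.le] at d₁ d₂
  have e₁ := d₁ hs 0 ⟨le_rfl, hω.le⟩
  have e₂ := d₂ hs 0 ⟨le_rfl, hω.le⟩
  refine e₁.unique (e₂.congr_of_eventuallyEq ?_)
  filter_upwards [Icc_mem_nhds (lt_of_le_of_ne hs.1 (Ne.symm hs0))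
    (lt_of_le_of_ne hs.2 hsω)] with t ht
  exact hint t ht

theorem IsPeriodicDeriv.add {ω : ℝ} {y₁ y₂ g₁ g₂ : L2 ω H} (h₁ : IsPeriodicDeriv ω y₁ g₁)
    (h₂ : IsPeriodicDeriv ω y₂ g₂) : IsPeriodicDeriv ω (y₁ + y₂) (g₁ + g₂) := by
  obtain ⟨f₁, hy₁, hf₁, hp₁⟩ := h₁
  obtain ⟨f₂, hy₂, hf₂, hp₂⟩ := h₂
  refine ⟨f₁ + f₂, ?_, ?_, by simp [hp₁, hp₂]⟩
  · exact (Lp.coeFn_add y₁ y₂).trans (hy₁.add hy₂)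
  · intro s hs
    rcases le_or_gt ω 0 with hω | hω
    · obtain rfl : s = 0 := le_antisymm (hs.2.trans hω) hs.1
      simp
    · have hae := (ae_intervalMeasure_iff hω).1 (Lp.coeFn_add g₁ g₂)
      rw [ae_restrict_iff' measurableSet_Icc] at hae
      have : ∫ τ in (0 : ℝ)..s, (g₁ + g₂ : L2 ω H) τ = ∫ τ in (0 : ℝ)..s, (g₁ τ + g₂ τ) := by
        refine intervalIntegral.integral_congr_ae ?_
        filter_upwards [hae] with t ht htm
        rw [Set.uIoc_of_le hs.1] at htm
        exact ht ⟨htm.1.le, htm.2.trans hs.2⟩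
      rw [this, intervalIntegral.integral_add (L2.intervalIntegrable hω g₁ hs)
        (L2.intervalIntegrable hω g₂ hs), Pi.add_apply, Pi.add_apply, hf₁ s hs, hf₂ s hs]
      abel

theorem IsPeriodicDeriv.smul {ω : ℝ} (c : ℂ) {y g : L2 ω H} (h : IsPeriodicDeriv ω y g) :
    IsPeriodicDeriv ω (c • y) (c • g) := by
  obtain ⟨f, hy, hf, hp⟩ := h
  refine ⟨c • f, ?_, ?_, by simp [hp]⟩
  · exact (Lp.coeFn_smul c y).trans (hy.const_smul c)
  · intro s hs
    rcases le_or_gt ω 0 with hω | hω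
    · obtain rfl : s = 0 := le_antisymm (hs.2.trans hω) hs.1
      simp
    · have hae := (ae_intervalMeasure_iff hω).1 (Lp.coeFn_smul c g)
      rw [ae_restrict_iff' measurableSet_Icc] at hae
      have : ∫ τ in (0 : ℝ)..s, (c • g : L2 ω H) τ = ∫ τ in (0 : ℝ)..s, c • g τ := by
        refine intervalIntegral.integral_congr_ae ?_
        filter_upwards [hae] with t ht htm
        rw [Set.uIoc_of_le hs.1] at htm
        exact ht ⟨htm.1.le, htm.2.trans hs.2⟩
      rw [this, intervalIntegral.integral_smul, Pi.smul_apply, Pi.smul_apply, hf s hs, smul_add]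

theorem IsPeriodicDeriv.zero (ω : ℝ) : IsPeriodicDeriv ω (0 : L2 ω H) 0 := by
  refine ⟨0, Lp.coeFn_zero _ _ _, fun s hs => ?_, rfl⟩
  rcases le_or_gt ω 0 with hω | hω
  · obtain rfl : s = 0 := le_antisymm (hs.2.trans hω) hs.1
    simp
  · have hae := (ae_intervalMeasure_iff hω).1 (Lp.coeFn_zero H 2 (intervalMeasure ω))
    rw [ae_restrict_iff' measurableSet_Icc] at hae
    have : ∫ τ in (0 : ℝ)..s, (0 : L2 ω H) τ = ∫ τ in (0 : ℝ)..s, (0 : H) := by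
      refine intervalIntegral.integral_congr_ae ?_
      filter_upwards [hae] with t ht htm
      rw [Set.uIoc_of_le hs.1] at htm
      exact ht ⟨htm.1.le, htm.2.trans hs.2⟩
    rw [this]
    simp

/-- The operator `L₀ = d/ds` in `L²([0, ω], H)` with domain `{y ∈ W₂¹ : y(0) = y(ω)}`. -/
noncomputable def opL0 (ω : ℝ) (H : Type*) [NormedAddCommGroup H] [InnerProductSpace ℂ H]
    [CompleteSpace H] : L2 ω H →ₗ.[ℂ] L2 ω H where
  domain :=
    { carrier := {y | ∃ g, IsPeriodicDeriv ω y g}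
      add_mem' := fun ⟨_, h₁⟩ ⟨_, h₂⟩ => ⟨_, h₁.add h₂⟩
      zero_mem' := ⟨0, IsPeriodicDeriv.zero ω⟩
      smul_mem' := fun c _ ⟨_, h⟩ => ⟨_, h.smul c⟩ }
  toFun :=
    { toFun := fun y => y.2.choose
      map_add' := fun y₁ y₂ =>
        (y₁ + y₂).2.choose_spec.unique (y₁.2.choose_spec.add y₂.2.choose_spec)
      map_smul' := fun c y => (c • y).2.choose_spec.unique (y.2.choose_spec.smul c) }

theorem opL0_apply_eq_iff {ω : ℝ} (y : (opL0 ω H).domain) (g : L2 ω H) :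
    opL0 ω H y = g ↔ IsPeriodicDeriv ω y g :=
  ⟨fun h => h ▸ y.2.choose_spec, fun h => IsPeriodicDeriv.unique y.2.choose_spec h⟩

/-- The operator `(V y)(s) = 𝒱(s) y(ω - s)` in `L²([0, ω], H)`, on its maximal domain, consisting
of the `y` for which the right-hand side is in `L²`. -/
noncomputable def opV (ω : ℝ) (𝒱 : ℝ → H →L[ℂ] H) : L2 ω H →ₗ.[ℂ] L2 ω H where
  domain :=
    { carrier := {y | MemLp (fun s => 𝒱 s (y (ω - s))) 2 (intervalMeasure ω)}
      add_mem' := fun {x y} hx hy => by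
        refine (MemLp.add hx hy).ae_eq ?_
        filter_upwards [(measurePreserving_reflect ω).quasiMeasurePreserving.ae
          (Lp.coeFn_add x y)] with s hs
        rw [hs, Pi.add_apply, Pi.add_apply, map_add]
      zero_mem' := by
        refine (MemLp.zero' (p := 2) (μ := intervalMeasure ω) (ε := H)).ae_eq ?_
        filter_upwards [(measurePreserving_reflect ω).quasiMeasurePreserving.ae
          (Lp.coeFn_zero H 2 (intervalMeasure ω))] with s hs
        rw [hs, Pi.zero_apply, map_zero]
      smul_mem' := fun c y hy => by
        refine (MemLp.const_smul hy c).ae_eq ?_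
        filter_upwards [(measurePreserving_reflect ω).quasiMeasurePreserving.ae
          (Lp.coeFn_smul c y)] with s hs
        rw [hs, Pi.smul_apply, Pi.smul_apply, map_smul] }
  toFun :=
    { toFun := fun y => MemLp.toLp (fun s => 𝒱 s ((y : L2 ω H) (ω - s))) y.2
      map_add' := fun x y => by
        rw [← MemLp.toLp_add]
        refine MemLp.toLp_congr _ _ ?_
        filter_upwards [(measurePreserving_reflect ω).quasiMeasurePreserving.ae
          (Lp.coeFn_add (x : L2 ω H) (y : L2 ω H))] with s hs
        rw [Submodule.coe_add, hs, Pi.add_apply, Pi.add_apply, map_add]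
      map_smul' := fun c y => by
        rw [RingHom.id_apply, ← MemLp.toLp_const_smul]
        refine MemLp.toLp_congr _ _ ?_
        filter_upwards [(measurePreserving_reflect ω).quasiMeasurePreserving.ae
          (Lp.coeFn_smul c (y : L2 ω H))] with s hs
        rw [Submodule.coe_smul, hs, Pi.smul_apply, Pi.smul_apply, map_smul] }

/-- The operator `L = L₀ - V`, `(L y)(s) = y'(s) - 𝒱(s) y(ω - s)`. As for any difference of
unbounded operators its domain is `D(L₀) ∩ D(V)`. -/
noncomputable def opL (ω : ℝ) (𝒱 : ℝ → H →L[ℂ] H) : L2 ω H →ₗ.[ℂ] L2 ω H :=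
  opL0 ω H - opV ω 𝒱

end

/-! ### Resolutions of the identity, similarity, direct sums -/

section

variable {E : Type*} [NormedAddCommGroup E] [InnerProductSpace ℂ E] [CompleteSpace E]

open scoped Classical in
/-- A (disjunctive) resolution of the identity: mutually orthogonal self-adjoint idempotents
with `x = ∑ P_i x` unconditionally, and hence an orthogonal decomposition `E = ⨁ Im P_i`. -/
structure IsResolutionOfIdentity {ι : Type*} (P : ι → E →L[ℂ] E) : Prop where
  selfAdjoint : ∀ i, IsSelfAdjoint (P i)
  mul : ∀ i j, P i * P j = if i = j then P i else 0
  hasSum : ∀ x, HasSum (fun i => P i x) x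
  hasSum_norm_sq : ∀ x, HasSum (fun i => ‖P i x‖ ^ 2) (‖x‖ ^ 2)
  eq_zero : ∀ x, (∀ i, P i x = 0) → x = 0

/-- The Hilbert--Schmidt class `𝔖₂(E, P)`: `∑_{j, ℓ} ‖P_j X P_ℓ‖² < ∞` (operator norms). -/
def IsHilbertSchmidtWrt {ι : Type*} (P : ι → E →L[ℂ] E) (X : E →L[ℂ] E) : Prop :=
  Summable fun p : ι × ι => ‖P p.1 * X * P p.2‖ ^ 2

/-- `U` is a similarity transform of `A₁` into `A₂`: `U D(A₂) = D(A₁)` and `A₁ U x = U A₂ x` for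
all `x ∈ D(A₂)`; that is, `A₁ U = U A₂` with equality of domains. -/
structure IsSimilarityTransform (A₁ A₂ : E →ₗ.[ℂ] E) (U : E ≃L[ℂ] E) : Prop where
  map_domain : A₂.domain.map (U : E →ₗ[ℂ] E) = A₁.domain
  intertwine : ∀ (x : A₂.domain) (hx : U x ∈ A₁.domain), A₁ ⟨U x, hx⟩ = U (A₂ x)

/-- `A = ⨁ A_i` is the orthogonal direct sum of the bounded operators `A_i` on `Im P_i`. -/
structure IsOrthogonalDirectSum {ι : Type*} (P : ι → E →L[ℂ] E) (A : E →ₗ.[ℂ] E)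
    (B : ∀ i, (P i).range →L[ℂ] (P i).range) : Prop where
  resolution : IsResolutionOfIdentity P
  closed : A.IsClosed
  mem_domain : ∀ x, x ∈ A.domain ↔ Summable fun i => ‖B i ((P i).rangeRestrict x)‖ ^ 2
  range_le : ∀ i, (P i).range ≤ A.domain
  /-- `Im P_i` is invariant under `A` and `A_i` is the restriction of `A` to it -/
  part : ∀ (i) (x : (P i).range) (hx : (x : E) ∈ A.domain), A ⟨x, hx⟩ = B i x
  hasSum : ∀ x : A.domain, HasSum (fun i => (B i ((P i).rangeRestrict x) : E)) (A x)

/-- The operator `U⁻¹ A U`, with domain `U⁻¹ D(A)`. -/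
noncomputable def conjPMap (U : E ≃L[ℂ] E) (A : E →ₗ.[ℂ] E) : E →ₗ.[ℂ] E where
  domain := A.domain.comap (U : E →ₗ[ℂ] E)
  toFun :=
    { toFun := fun x => U.symm (A ⟨U x, x.2⟩)
      map_add' := fun x y => by
        rw [← map_add, ← LinearPMap.map_add]
        congr 2
        exact Subtype.ext (map_add U (x : E) (y : E))
      map_smul' := fun c x => by
        rw [RingHom.id_apply, ← map_smul, ← LinearPMap.map_smul]
        congr 2
        exact Subtype.ext (map_smul U c (x : E)) }

/-- The operator `U B U⁻¹` on the subspace `U S`, for a bounded operator `B` on a subspace `S`. -/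
noncomputable def transportPart (U : E ≃L[ℂ] E) {S : Submodule ℂ E} (B : S →L[ℂ] S) :
    S.map (U : E →ₗ[ℂ] E) →L[ℂ] S.map (U : E →ₗ[ℂ] E) :=
  ((U.submoduleMap S : S →L[ℂ] S.map (U : E →ₗ[ℂ] E)).comp B).comp
    ((U.submoduleMap S).symm : S.map (U : E →ₗ[ℂ] E) →L[ℂ] S)

/-- `A` is the `U`-orthogonal direct sum of the bounded operators `Ã_i` on `U (Im P_i)`, with
respect to the `U`-orthogonal decomposition `E = ⨁ U (Im P_i)`: `U⁻¹ A U = ⨁ A_i` is an orthogonal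
direct sum and `Ã_i = U A_i U⁻¹`. -/
def IsUOrthogonalDirectSum {ι : Type*} (U : E ≃L[ℂ] E) (P : ι → E →L[ℂ] E) (A : E →ₗ.[ℂ] E)
    (At : ∀ i, (P i).range.map (U : E →ₗ[ℂ] E) →L[ℂ] (P i).range.map (U : E →ₗ[ℂ] E)) : Prop :=
  A.IsClosed ∧ ∃ B : ∀ i, (P i).range →L[ℂ] (P i).range,
    IsOrthogonalDirectSum P (conjPMap U A) B ∧ ∀ i, At i = transportPart U (B i)

/-- The coarser family `{P_(k)} ∪ {P_ℓ : |ℓ| > k}`, where `P_(k) = ∑_{|ℓ| ≤ k} P_ℓ` has the index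
`none`. -/
noncomputable def coarsen (P : ℤ → E →L[ℂ] E) (k : ℕ) :
    Option {ℓ : ℤ // (k : ℤ) < |ℓ|} → E →L[ℂ] E
  | none => ∑ ℓ ∈ Finset.Icc (-(k : ℤ)) k, P ℓ
  | some ℓ => P ℓ

/-- A bounded operator as a partially defined operator with full domain. -/
def boundedPMap (X : E →L[ℂ] E) : E →ₗ.[ℂ] E := (X : E →ₗ[ℂ] E).toPMap ⊤

end

/-! ### Square-summable families -/

/-! In Fourier coefficients `L₀` is the diagonal matrix of the `λ_ℓ`. Since `s ↦ ω - s` turns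
`e^{λ_ℓ s}` into `e^{-λ_ℓ s}`, the perturbation `V` is the Hankel block matrix `v(j + ℓ)` with `v =
𝒱̂` (`opV_of_mem_domain_opL0`). Its rows and columns are square summable, but it is Hilbert--Schmidt
only if `v = 0`. The method of similar operators is therefore applied twice.

First transform (`exists_hankel_transform`). The matrix `v(j + ℓ) / (λ_j - λ_ℓ)` is
Hilbert--Schmidt, because `j + ℓ` and `j - ℓ` serve as independent variables. Cutting out a large
central square leaves `G` with `‖G‖ < 1` and `L₀ G - G L₀ = V - D`, where `D` consists of the
diagonal `v(2ℓ)` and a finite square, and so is Hilbert--Schmidt. The second hypothesis says that `V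
G` is Hilbert--Schmidt, up to a finite correction. Hence `Q = (I + G)⁻¹ (D + V G)` is
Hilbert--Schmidt and `(L₀ - V)(I + G) = (I + G)(L₀ - Q)`.

Second transform (`exists_block_diagonalization`). Let `J` be the block-diagonal part for the
central block `|ℓ| ≤ k` and the singletons outside it, and let `Γ` invert the commutator with `L₀`
off these blocks. A solution of `W = Γ(Q + Q W - W N)`, `N = J(Q + Q W)`, gives `(L₀ - Q)(I + W) =
(I + W)(L₀ - N)`. The norm of `Γ` alone need not decay in `k`, but the maps `Y ↦ Γ(Q Y)` and `Y ↦
Γ(Y J Q)` tend to zero for the fixed Hilbert--Schmidt `Q`, so the equation is a contraction on a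
small ball.

These matrix identities become similarities of unbounded operators only if `I + G` and `I + W` map
`D(L₀)` onto itself. By `exists_conj_norm_lt_one`, for large real `μ` the conjugate `(L₀ - μ) W (L₀
- μ)⁻¹` is again a strict contraction `S`, so that `(L₀ - μ)(I + W) = (I + S)(L₀ - μ)` with both
factors `I + W` and `I + S` invertible (`memℓp_freq_smul_add_blockOp_iff`).

Finally `U = (I + G)(I + W)` and `V₀` is the operator of `N`. It commutes with the coarser
projections, so `isOrthogonalDirectSum_of_reduces` gives all the direct sums; the domain condition
there comes from closedness. -/

theorem summable_mul_of_summable_sq {ι : Type*} {f g : ι → ℝ} (hf : Summable fun i => f i ^ 2)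
    (hg : Summable fun i => g i ^ 2) : Summable fun i => f i * g i := by
  refine Summable.of_norm_bounded (hf.add hg) fun i => ?_
  rw [Real.norm_eq_abs, abs_le]
  constructor <;> nlinarith [sq_nonneg (f i - g i), sq_nonneg (f i + g i), sq_nonneg (f i),
    sq_nonneg (g i)]

theorem tsum_mul_sq_le {ι : Type*} {f g : ι → ℝ} (hf : Summable fun i => f i ^ 2)
    (hg : Summable fun i => g i ^ 2) :
    (∑' i, f i * g i) ^ 2 ≤ (∑' i, f i ^ 2) * ∑' i, g i ^ 2 := by
  have h := summable_mul_of_summable_sq hf hg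
  exact le_of_tendsto_of_tendsto' (Filter.Tendsto.pow h.hasSum 2)
    (Filter.Tendsto.mul hf.hasSum hg.hasSum) fun s => Finset.sum_mul_sq_le_sq_mul_sq s f g

theorem summable_norm_of_le_mul {ι M : Type*} [NormedAddCommGroup M] {t : ι → M} {f g : ι → ℝ}
    (hf : Summable fun i => f i ^ 2) (hg : Summable fun i => g i ^ 2)
    (h : ∀ i, ‖t i‖ ≤ f i * g i) : Summable fun i => ‖t i‖ :=
  (summable_mul_of_summable_sq hf hg).of_nonneg_of_le (fun _ => norm_nonneg _) h

theorem norm_tsum_sq_le {ι M : Type*} [NormedAddCommGroup M] {t : ι → M} {f g : ι → ℝ}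
    (hf : Summable fun i => f i ^ 2) (hg : Summable fun i => g i ^ 2)
    (h : ∀ i, ‖t i‖ ≤ f i * g i) : ‖∑' i, t i‖ ^ 2 ≤ (∑' i, f i ^ 2) * ∑' i, g i ^ 2 := by
  have h1 := summable_norm_of_le_mul hf hg h
  refine le_trans ?_ (tsum_mul_sq_le hf hg)
  gcongr
  exact (norm_tsum_le_tsum_norm h1).trans (h1.tsum_le_tsum h (summable_mul_of_summable_sq hf hg))

theorem memℓp_two_iff {ι : Type*} {E : ι → Type*} [∀ i, NormedAddCommGroup (E i)]
    {f : ∀ i, E i} : Memℓp f 2 ↔ Summable fun i => ‖f i‖ ^ 2 := by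
  rw [memℓp_gen_iff (by norm_num)]
  simp

theorem lp.summable_norm_sq {ι : Type*} {E : ι → Type*} [∀ i, NormedAddCommGroup (E i)]
    (f : lp E 2) : Summable fun i => ‖f i‖ ^ 2 :=
  memℓp_two_iff.1 (lp.memℓp f)

theorem lp.norm_sq_eq_tsum {ι : Type*} {E : ι → Type*} [∀ i, NormedAddCommGroup (E i)]
    (f : lp E 2) : ‖f‖ ^ 2 = ∑' i, ‖f i‖ ^ 2 := by
  have := lp.norm_rpow_eq_tsum (p := 2) (by norm_num) f
  simpa using this

theorem lp.norm_le_of_tsum_norm_sq_le {ι : Type*} {E : ι → Type*} [∀ i, NormedAddCommGroup (E i)]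
    {f : lp E 2} {C : ℝ} (hC : 0 ≤ C) (h : ∑' i, ‖f i‖ ^ 2 ≤ C ^ 2) : ‖f‖ ≤ C := by
  rw [← lp.norm_sq_eq_tsum] at h
  exact le_of_sq_le_sq h hC

theorem lp.norm_le_mul_of_forall_le {ι : Type*} {E F : ι → Type*}
    [∀ i, NormedAddCommGroup (E i)] [∀ i, NormedAddCommGroup (F i)] {f : lp E 2} {g : lp F 2}
    {C : ℝ} (hC : 0 ≤ C) (h : ∀ i, ‖f i‖ ≤ C * ‖g i‖) : ‖f‖ ≤ C * ‖g‖ := by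
  refine lp.norm_le_of_tsum_norm_sq_le (by positivity) ?_
  rw [mul_pow, lp.norm_sq_eq_tsum, ← tsum_mul_left]
  refine (lp.summable_norm_sq f).tsum_le_tsum (fun i => ?_)
    ((lp.summable_norm_sq g).mul_left _)
  rw [← mul_pow]
  exact pow_le_pow_left₀ (norm_nonneg _) (h i) 2

/-! ### Hilbert--Schmidt block matrices -/

/-- Square-summable block matrices indexed by `ℤ × ℤ` with entries in a normed ring. -/
abbrev BlockHS (A : Type*) [NormedAddCommGroup A] : Type _ := lp (fun _ : ℤ × ℤ => A) 2

section

variable {A : Type*} [NormedRing A] [NormedAlgebra ℂ A] [CompleteSpace A]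

theorem BlockHS.summable_row (X : BlockHS A) (j : ℤ) : Summable fun n => ‖X (j, n)‖ ^ 2 :=
  (lp.summable_norm_sq X).comp_injective (i := fun n => (j, n)) fun _ _ h => (Prod.mk.inj h).2

theorem BlockHS.summable_col (X : BlockHS A) (l : ℤ) : Summable fun n => ‖X (n, l)‖ ^ 2 :=
  (lp.summable_norm_sq X).comp_injective (i := fun n => (n, l)) fun _ _ h => (Prod.mk.inj h).1

theorem BlockHS.tsum_col_le (X : BlockHS A) (l : ℤ) : ∑' n, ‖X (n, l)‖ ^ 2 ≤ ‖X‖ ^ 2 := by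
  rw [lp.norm_sq_eq_tsum]
  exact tsum_comp_le_tsum_of_inj (lp.summable_norm_sq X) (fun _ => sq_nonneg _)
    (i := fun n => (n, l)) fun _ _ h => (Prod.mk.inj h).1

/-- A row times a column of square-summable entries. -/
theorem summable_row_mul {f g : ℤ → A} (hf : Summable fun n => ‖f n‖ ^ 2)
    (hg : Summable fun n => ‖g n‖ ^ 2) : Summable fun n => f n * g n :=
  Summable.of_norm (summable_norm_of_le_mul hf hg fun n => norm_mul_le (f n) (g n))

theorem BlockHS.summable_mul (X Y : BlockHS A) (j l : ℤ) :
    Summable fun n => X (j, n) * Y (n, l) :=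
  summable_row_mul (X.summable_row j) (Y.summable_col l)

theorem BlockHS.norm_tsum_mul_sq_le (X Y : BlockHS A) (p : ℤ × ℤ) :
    ‖∑' n, X (p.1, n) * Y (n, p.2)‖ ^ 2 ≤
      (∑' n, ‖X (p.1, n)‖ ^ 2) * ∑' n, ‖Y (n, p.2)‖ ^ 2 :=
  norm_tsum_sq_le (X.summable_row p.1) (Y.summable_col p.2)
    fun n => norm_mul_le (X (p.1, n)) (Y (n, p.2))

theorem BlockHS.summable_row_sums (X : BlockHS A) :
    Summable fun j => ∑' n, ‖X (j, n)‖ ^ 2 :=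
  (lp.summable_norm_sq X).prod

theorem BlockHS.tsum_row_sums (X : BlockHS A) : ∑' j, ∑' n, ‖X (j, n)‖ ^ 2 = ‖X‖ ^ 2 := by
  rw [lp.norm_sq_eq_tsum, (lp.summable_norm_sq X).tsum_prod]

theorem BlockHS.summable_col_sums (X : BlockHS A) :
    Summable fun l => ∑' n, ‖X (n, l)‖ ^ 2 :=
  ((Equiv.prodComm ℤ ℤ).summable_iff.2 (lp.summable_norm_sq X)).prod

theorem BlockHS.tsum_col_sums (X : BlockHS A) : ∑' l, ∑' n, ‖X (n, l)‖ ^ 2 = ‖X‖ ^ 2 := by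
  have h := (Equiv.prodComm ℤ ℤ).summable_iff.2 (lp.summable_norm_sq X)
  rw [lp.norm_sq_eq_tsum, ← (Equiv.prodComm ℤ ℤ).tsum_eq fun p => ‖X p‖ ^ 2]
  exact (h.tsum_prod).symm

theorem BlockHS.summable_mul_sums (X Y : BlockHS A) :
    Summable fun p : ℤ × ℤ => (∑' n, ‖X (p.1, n)‖ ^ 2) * ∑' n, ‖Y (n, p.2)‖ ^ 2 :=
  X.summable_row_sums.mul_of_nonneg Y.summable_col_sums
    (fun _ => tsum_nonneg fun _ => sq_nonneg _) (fun _ => tsum_nonneg fun _ => sq_nonneg _)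

theorem BlockHS.memℓp_mul (X Y : BlockHS A) :
    Memℓp (fun p : ℤ × ℤ => ∑' n, X (p.1, n) * Y (n, p.2)) 2 :=
  memℓp_two_iff.2 <| (X.summable_mul_sums Y).of_nonneg_of_le (fun _ => sq_nonneg _)
    (X.norm_tsum_mul_sq_le Y)

theorem BlockHS.norm_mul_le (X Y : BlockHS A) :
    ‖(⟨_, X.memℓp_mul Y⟩ : BlockHS A)‖ ≤ ‖X‖ * ‖Y‖ := by
  refine lp.norm_le_of_tsum_norm_sq_le (mul_nonneg (norm_nonneg X) (norm_nonneg Y)) ?_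
  refine (Summable.tsum_le_tsum (X.norm_tsum_mul_sq_le Y) (memℓp_two_iff.1 (X.memℓp_mul Y))
    (X.summable_mul_sums Y)).trans_eq ?_
  rw [mul_pow, ← X.tsum_row_sums, ← Y.tsum_col_sums]
  exact (X.summable_row_sums.tsum_mul_tsum Y.summable_col_sums (X.summable_mul_sums Y)).symm

/-- The product of Hilbert--Schmidt block matrices, as a bilinear map. -/
noncomputable def blockMulₗ : BlockHS A →ₗ[ℂ] BlockHS A →ₗ[ℂ] BlockHS A :=
  LinearMap.mk₂ ℂ (fun X Y => ⟨_, X.memℓp_mul Y⟩)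
    (fun X X' Y => by
      ext p
      simp only [lp.coeFn_add, Pi.add_apply, add_mul]
      exact (X.summable_mul Y p.1 p.2).tsum_add (X'.summable_mul Y p.1 p.2))
    (fun c X Y => by
      ext p
      simp only [lp.coeFn_smul, Pi.smul_apply, smul_mul_assoc]
      exact (X.summable_mul Y p.1 p.2).tsum_const_smul c)
    (fun X Y Y' => by
      ext p
      simp only [lp.coeFn_add, Pi.add_apply, mul_add]
      exact (X.summable_mul Y p.1 p.2).tsum_add (X.summable_mul Y' p.1 p.2))
    (fun c X Y => by
      ext p
      simp only [lp.coeFn_smul, Pi.smul_apply, mul_smul_comm]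
      exact (X.summable_mul Y p.1 p.2).tsum_const_smul c)

/-- The product of Hilbert--Schmidt block matrices. -/
noncomputable def blockMul : BlockHS A →L[ℂ] BlockHS A →L[ℂ] BlockHS A :=
  LinearMap.mkContinuous₂ blockMulₗ 1 fun X Y => by
    rw [one_mul]
    exact X.norm_mul_le Y

theorem blockMul_apply (X Y : BlockHS A) (j l : ℤ) :
    blockMul X Y (j, l) = ∑' n, X (j, n) * Y (n, l) := rfl

theorem norm_blockMul_le (X Y : BlockHS A) : ‖blockMul X Y‖ ≤ ‖X‖ * ‖Y‖ := X.norm_mul_le Y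

/-- Entrywise multiplication by a bounded scalar matrix. -/
noncomputable def multiplier (d : ℤ × ℤ → ℂ) (C : ℝ) (hd : ∀ p, ‖d p‖ ≤ C) :
    BlockHS A →L[ℂ] BlockHS A :=
  LinearMap.mkContinuous
    { toFun := fun X => ⟨fun p => d p • X p, memℓp_two_iff.2 <| by
        refine ((lp.summable_norm_sq X).mul_left (C ^ 2)).of_nonneg_of_le
          (fun _ => sq_nonneg _) fun p => ?_
        rw [← mul_pow, norm_smul]
        gcongr
        exact hd p⟩
      map_add' := fun X Y => by ext p; exact smul_add _ _ _
      map_smul' := fun c X => by ext p; exact smul_comm _ _ _ }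
    C fun X => by
      refine lp.norm_le_mul_of_forall_le ((norm_nonneg _).trans (hd 0)) fun p => ?_
      refine (norm_smul _ _).trans_le ?_
      gcongr
      exact hd p

theorem multiplier_apply (d : ℤ × ℤ → ℂ) (C : ℝ) (hd : ∀ p, ‖d p‖ ≤ C) (X : BlockHS A)
    (p : ℤ × ℤ) : multiplier d C hd X p = d p • X p := rfl

theorem norm_multiplier_le (d : ℤ × ℤ → ℂ) (C : ℝ) (hd : ∀ p, ‖d p‖ ≤ C) (X : BlockHS A) :
    ‖multiplier d C hd X‖ ≤ C * ‖X‖ :=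
  ContinuousLinearMap.le_of_opNorm_le _
    (LinearMap.mkContinuous_norm_le _ ((norm_nonneg _).trans (hd 0)) _) X

end

/-! ### Block matrices acting on `ℓ²(ℤ, H)` -/

section

variable {H : Type*} [NormedAddCommGroup H] [InnerProductSpace ℂ H] [CompleteSpace H]

/-- A square-summable row of operators applied to a square-summable column of vectors. -/
theorem summable_row_apply {f : ℤ → H →L[ℂ] H} {x : ℤ → H} (hf : Summable fun n => ‖f n‖ ^ 2)
    (hx : Summable fun n => ‖x n‖ ^ 2) : Summable fun n => f n (x n) :=
  Summable.of_norm (summable_norm_of_le_mul hf hx fun n => (f n).le_opNorm (x n))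

theorem BlockHS.summable_apply (X : BlockHS (H →L[ℂ] H)) (x : lp (fun _ : ℤ => H) 2) (j : ℤ) :
    Summable fun n => X (j, n) (x n) :=
  summable_row_apply (X.summable_row j) (lp.summable_norm_sq x)

theorem BlockHS.norm_tsum_apply_sq_le (X : BlockHS (H →L[ℂ] H)) (x : lp (fun _ : ℤ => H) 2)
    (j : ℤ) : ‖∑' n, X (j, n) (x n)‖ ^ 2 ≤ (∑' n, ‖X (j, n)‖ ^ 2) * ‖x‖ ^ 2 := by
  rw [lp.norm_sq_eq_tsum x]
  exact norm_tsum_sq_le (X.summable_row j) (lp.summable_norm_sq x)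
    fun n => (X (j, n)).le_opNorm (x n)

theorem BlockHS.memℓp_apply (X : BlockHS (H →L[ℂ] H)) (x : lp (fun _ : ℤ => H) 2) :
    Memℓp (fun j => ∑' n, X (j, n) (x n)) 2 :=
  memℓp_two_iff.2 <| (X.summable_row_sums.mul_right _).of_nonneg_of_le (fun _ => sq_nonneg _)
    (X.norm_tsum_apply_sq_le x)

theorem BlockHS.norm_apply_le (X : BlockHS (H →L[ℂ] H)) (x : lp (fun _ : ℤ => H) 2) :
    ‖(⟨_, X.memℓp_apply x⟩ : lp (fun _ : ℤ => H) 2)‖ ≤ ‖X‖ * ‖x‖ := by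
  refine lp.norm_le_of_tsum_norm_sq_le (mul_nonneg (norm_nonneg X) (norm_nonneg x)) ?_
  refine (Summable.tsum_le_tsum (X.norm_tsum_apply_sq_le x) (memℓp_two_iff.1 (X.memℓp_apply x))
    (X.summable_row_sums.mul_right _)).trans_eq ?_
  rw [mul_pow, tsum_mul_right, X.tsum_row_sums]

/-- The action of Hilbert--Schmidt block matrices on `ℓ²(ℤ, H)`, as a bilinear map. -/
noncomputable def blockOpₗ :
    BlockHS (H →L[ℂ] H) →ₗ[ℂ] lp (fun _ : ℤ => H) 2 →ₗ[ℂ] lp (fun _ : ℤ => H) 2 :=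
  LinearMap.mk₂ ℂ (fun X x => ⟨_, X.memℓp_apply x⟩)
    (fun X X' x => by
      ext j
      exact (X.summable_apply x j).tsum_add (X'.summable_apply x j))
    (fun c X x => by
      ext j
      exact (X.summable_apply x j).tsum_const_smul c)
    (fun X x x' => by
      ext j
      simp only [lp.coeFn_add, Pi.add_apply, map_add]
      exact (X.summable_apply x j).tsum_add (X.summable_apply x' j))
    (fun c X x => by
      ext j
      simp only [lp.coeFn_smul, Pi.smul_apply, map_smul]
      exact (X.summable_apply x j).tsum_const_smul c)

/-- The bounded operator on `ℓ²(ℤ, H)` of a Hilbert--Schmidt block matrix. -/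
noncomputable def blockOp :
    BlockHS (H →L[ℂ] H) →L[ℂ] lp (fun _ : ℤ => H) 2 →L[ℂ] lp (fun _ : ℤ => H) 2 :=
  LinearMap.mkContinuous₂ blockOpₗ 1 fun X x => by
    rw [one_mul]
    exact X.norm_apply_le x

theorem blockOp_apply (X : BlockHS (H →L[ℂ] H)) (x : lp (fun _ : ℤ => H) 2) (j : ℤ) :
    blockOp X x j = ∑' n, X (j, n) (x n) := rfl

theorem norm_blockOp_le (X : BlockHS (H →L[ℂ] H)) : ‖blockOp X‖ ≤ ‖X‖ :=
  ContinuousLinearMap.opNorm_le_bound _ (norm_nonneg X) X.norm_apply_le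

/-- Associativity of row times matrix times column. -/
theorem tsum_row_blockOp {f : ℤ → H →L[ℂ] H} (hf : Summable fun n => ‖f n‖ ^ 2)
    (Y : BlockHS (H →L[ℂ] H)) (x : lp (fun _ : ℤ => H) 2) :
    ∑' n, f n (blockOp Y x n) = ∑' l, (∑' n, f n * Y (n, l)) (x l) := by
  -- Cauchy--Schwarz over `ℤ × ℤ`, pairing `Y` with `f ⊗ x`, makes the double series absolutely
  -- summable. Only one square-summable row `f` is needed, so the exchange of sums also covers the
  -- Hankel matrix, which is not Hilbert--Schmidt.
  have hfx : Summable fun p : ℤ × ℤ => (‖f p.1‖ * ‖x p.2‖) ^ 2 := by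
    simp only [mul_pow]
    exact hf.mul_of_nonneg (lp.summable_norm_sq x) (fun n => sq_nonneg ‖f n‖)
      fun n => sq_nonneg ‖x n‖
  have hs : Summable fun p : ℤ × ℤ => f p.1 (Y p (x p.2)) := by
    refine Summable.of_norm (summable_norm_of_le_mul (f := fun p => ‖Y p‖)
      (g := fun p => ‖f p.1‖ * ‖x p.2‖) (lp.summable_norm_sq Y) hfx fun p => ?_)
    refine (ContinuousLinearMap.le_opNorm _ _).trans ?_
    calc ‖f p.1‖ * ‖Y p (x p.2)‖ ≤ ‖f p.1‖ * (‖Y p‖ * ‖x p.2‖) := by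
          gcongr; exact ContinuousLinearMap.le_opNorm _ _
      _ = ‖Y p‖ * (‖f p.1‖ * ‖x p.2‖) := by ring
  have h1 : ∀ n, f n (blockOp Y x n) = ∑' l, f n (Y (n, l) (x l)) := fun n => by
    rw [blockOp_apply, (f n).map_tsum (Y.summable_apply x n)]
  have h2 : ∀ l, (∑' n, f n * Y (n, l)) (x l) = ∑' n, f n (Y (n, l) (x l)) := fun l =>
    (ContinuousLinearMap.apply ℂ H (x l)).map_tsum (summable_row_mul hf (Y.summable_col l))
  simp only [h1, h2]
  exact (Summable.tsum_comm (f := fun n l => f n (Y (n, l) (x l))) hs).symm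

theorem blockOp_blockMul (X Y : BlockHS (H →L[ℂ] H)) :
    blockOp (blockMul X Y) = blockOp X * blockOp Y := by
  ext x j
  exact (tsum_row_blockOp (X.summable_row j) Y x).symm

end

/-! ### The eigenvalues `λ_ℓ` -/

theorem norm_freq_sub {ω : ℝ} (hω : 0 < ω) (j l : ℤ) :
    ‖freq ω j - freq ω l‖ = 2 * Real.pi / ω * |((j - l : ℤ) : ℝ)| := by
  have : freq ω j - freq ω l = Complex.I * ((2 * Real.pi / ω * ((j - l : ℤ) : ℝ) : ℝ) : ℂ) := by
    unfold freq; push_cast; ring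
  rw [this, norm_mul, Complex.norm_I, one_mul, Complex.norm_real, Real.norm_eq_abs, abs_mul,
    abs_of_pos (by positivity)]

theorem freq_sub_ne_zero {ω : ℝ} (hω : 0 < ω) {j l : ℤ} (h : j ≠ l) :
    freq ω j - freq ω l ≠ 0 := by
  rw [← norm_pos_iff, norm_freq_sub hω]
  have : (0 : ℝ) < |((j - l : ℤ) : ℝ)| := by
    rw [abs_pos, Int.cast_ne_zero]; exact sub_ne_zero.2 h
  positivity

theorem norm_freq_sub_inv_le {ω : ℝ} (hω : 0 < ω) {j l : ℤ} {m : ℝ} (hm : 0 < m)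
    (h : m ≤ |((j - l : ℤ) : ℝ)|) :
    ‖(freq ω j - freq ω l)⁻¹‖ ≤ ω / (2 * Real.pi) / m := by
  rw [norm_inv, norm_freq_sub hω, mul_inv, inv_div, div_eq_mul_inv _ m]
  gcongr

theorem norm_freq_sub_inv_le_of_ne {ω : ℝ} (hω : 0 < ω) {j l : ℤ} (h : j ≠ l) :
    ‖(freq ω j - freq ω l)⁻¹‖ ≤ ω / (2 * Real.pi) := by
  have := norm_freq_sub_inv_le hω (j := j) (l := l) one_pos (by
    exact_mod_cast Int.one_le_abs (sub_ne_zero.2 h))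
  simpa using this

theorem norm_freq_sub_real_sq (ω : ℝ) (l : ℤ) (μ : ℝ) :
    ‖freq ω l - μ‖ ^ 2 = (2 * Real.pi * l / ω) ^ 2 + μ ^ 2 := by
  have : freq ω l - μ = ((-μ : ℝ) : ℂ) + ((2 * Real.pi * l / ω : ℝ) : ℂ) * Complex.I := by
    unfold freq; push_cast; ring
  rw [this, ← Complex.normSq_eq_norm_sq, Complex.normSq_add_mul_I]
  ring

theorem freq_sub_real_ne_zero (ω : ℝ) (l : ℤ) {μ : ℝ} (hμ : 0 < μ) : freq ω l - μ ≠ 0 := by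
  intro h
  have := norm_freq_sub_real_sq ω l μ
  rw [h, norm_zero] at this
  nlinarith [sq_nonneg (2 * Real.pi * l / ω), pow_pos hμ 2]

theorem norm_freq_sub_real_inv_le (ω : ℝ) (l : ℤ) {μ : ℝ} (hμ : 0 < μ) :
    ‖(freq ω l - μ)⁻¹‖ ≤ μ⁻¹ := by
  rw [norm_inv]
  refine inv_anti₀ hμ (abs_le_of_sq_le_sq' ?_ (norm_nonneg _)).2
  rw [norm_freq_sub_real_sq]
  nlinarith [sq_nonneg (2 * Real.pi * l / ω)]

theorem summable_inv_int_sq : Summable fun l : ℤ => (((l : ℝ)) ^ 2)⁻¹ := by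
  simpa using Real.summable_one_div_int_pow.2 (one_lt_two)

/-- A majorant independent of `μ`, for dominated convergence as `μ → ∞`. At `l = 0` the first
summand is `0` since `0⁻¹ = 0`, and the indicator takes over; this is where `μ ≥ 1` is used. -/
theorem norm_freq_sub_real_inv_sq_le {ω : ℝ} (hω : 0 < ω) (l : ℤ) {μ : ℝ} (hμ : 1 ≤ μ) :
    ‖(freq ω l - μ)⁻¹‖ ^ 2 ≤
      (ω / (2 * Real.pi)) ^ 2 * ((l : ℝ) ^ 2)⁻¹ + (if l = 0 then 1 else 0) := by
  rw [norm_inv, inv_pow, norm_freq_sub_real_sq]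
  split_ifs with h
  · subst h
    simp only [Int.cast_zero]
    norm_num
    exact inv_le_one_of_one_le₀ (one_le_pow₀ hμ)
  · have hl : (0 : ℝ) < (l : ℝ) ^ 2 := by positivity
    have e : (ω / (2 * Real.pi)) ^ 2 * ((l : ℝ) ^ 2)⁻¹ = ((2 * Real.pi * l / ω) ^ 2)⁻¹ := by
      field_simp
    rw [add_zero, e]
    refine inv_anti₀ (by positivity) ?_
    nlinarith [sq_nonneg μ]

theorem summable_freq_majorant (ω : ℝ) : Summable fun l : ℤ =>
    (ω / (2 * Real.pi)) ^ 2 * ((l : ℝ) ^ 2)⁻¹ + (if l = 0 then 1 else 0) :=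
  (summable_inv_int_sq.mul_left _).add (summable_of_ne_finset_zero (s := {0}) fun l hl => by
    simp_all)

theorem tendsto_tsum_norm_freq_sub_real_inv_sq {ω : ℝ} (hω : 0 < ω) :
    Filter.Tendsto (fun μ : ℝ => ∑' l : ℤ, ‖(freq ω l - μ)⁻¹‖ ^ 2) Filter.atTop (nhds 0) := by
  have h := tendsto_tsum_of_dominated_convergence (𝓕 := Filter.atTop)
    (f := fun (μ : ℝ) (l : ℤ) => ‖(freq ω l - μ)⁻¹‖ ^ 2) (g := fun _ => 0)
    (summable_freq_majorant ω) (fun l => ?_) ?_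
  · simpa using h
  · refine squeeze_zero' (Filter.Eventually.of_forall fun _ => sq_nonneg _)
      (g := fun μ : ℝ => μ⁻¹ ^ 2) ?_ ?_
    · filter_upwards [Filter.eventually_gt_atTop 0] with μ hμ
      exact pow_le_pow_left₀ (norm_nonneg _) (norm_freq_sub_real_inv_le ω l hμ) 2
    · simpa using (tendsto_inv_atTop_zero (𝕜 := ℝ)).pow 2
  · filter_upwards [Filter.eventually_ge_atTop 1] with μ hμ l
    rw [Real.norm_of_nonneg (sq_nonneg _)]
    exact norm_freq_sub_real_inv_sq_le hω l hμ

theorem summable_norm_freq_sub_real_inv_sq {ω : ℝ} (hω : 0 < ω) {μ : ℝ} (hμ : 1 ≤ μ) :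
    Summable fun l : ℤ => ‖(freq ω l - μ)⁻¹‖ ^ 2 :=
  (summable_freq_majorant ω).of_nonneg_of_le (fun _ => sq_nonneg _)
    fun l => norm_freq_sub_real_inv_sq_le hω l hμ

/-! ### Invertible transforms that preserve the domain of the diagonal operator -/

section

variable {H : Type*} [NormedAddCommGroup H] [InnerProductSpace ℂ H] [CompleteSpace H]

/-- Neumann series. It is applied on `ℓ²(ℤ, H)`, on `L²([0, ω], H)` and on the space of
Hilbert--Schmidt matrices itself. -/
theorem exists_equiv_one_add {E : Type*} [NormedAddCommGroup E] [NormedSpace ℂ E]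
    [CompleteSpace E] (T : E →L[ℂ] E) (hT : ‖T‖ < 1) :
    ∃ e : E ≃L[ℂ] E, (e : E →L[ℂ] E) = 1 + T :=
  ⟨ContinuousLinearEquiv.ofUnit (Units.oneSub (-T) (by rwa [norm_neg])), by
    ext x
    change (1 - -T) x = _
    rw [sub_neg_eq_add]⟩

theorem summable_of_summable_cols {f : ℤ × ℤ → ℝ} (h0 : ∀ p, 0 ≤ f p) {g : ℤ → ℝ}
    (hc : ∀ l, Summable fun j => f (j, l)) (hg : Summable g) (hfg : ∀ l, ∑' j, f (j, l) ≤ g l) :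
    Summable f ∧ ∑' p, f p ≤ ∑' l, g l := by
  have h1 : Summable fun l => ∑' j, f (j, l) :=
    hg.of_nonneg_of_le (fun l => tsum_nonneg fun j => h0 _) hfg
  have h2 : Summable fun p : ℤ × ℤ => f (p.2, p.1) :=
    (summable_prod_of_nonneg fun _ => h0 _).2 ⟨hc, h1⟩
  have h3 : Summable f := (Equiv.prodComm ℤ ℤ).summable_iff.1 h2
  refine ⟨h3, ?_⟩
  rw [← (Equiv.prodComm ℤ ℤ).tsum_eq f]
  exact (h2.tsum_prod).trans_le (h1.tsum_le_tsum hfg hg)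

/-- If the commutator of the diagonal operator with `W` has uniformly square-summable columns and
`‖W‖ < 1`, then the conjugates of `W` by shifted diagonal operators are eventually contractions. -/
theorem exists_conj_norm_lt_one {ω : ℝ} (hω : 0 < ω) (W : BlockHS (H →L[ℂ] H)) (hW : ‖W‖ < 1)
    {K : ℝ} (hc : ∀ l, Summable fun j => ‖(freq ω j - freq ω l) • W (j, l)‖ ^ 2)
    (hK : ∀ l, ∑' j, ‖(freq ω j - freq ω l) • W (j, l)‖ ^ 2 ≤ K) :
    ∃ μ : ℝ, 0 < μ ∧ ∃ S : BlockHS (H →L[ℂ] H), ‖S‖ < 1 ∧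
      ∀ j l, (freq ω l - μ) • S (j, l) = (freq ω j - μ) • W (j, l) := by
  obtain ⟨δ, hδ, hWδ⟩ : ∃ δ : ℝ, 0 < δ ∧ ‖W‖ + δ < 1 := ⟨(1 - ‖W‖) / 2, by linarith, by linarith⟩
  -- The quantity on the left bounds the squared Hilbert--Schmidt norm of `[L₀, W] (L₀ - μ)⁻¹`:
  -- column `l` of the commutator has squared norm at most `K` and is multiplied by `(λ_l - μ)⁻¹`.
  have hlim : Filter.Tendsto (fun μ : ℝ => K * ∑' l : ℤ, ‖(freq ω l - μ)⁻¹‖ ^ 2) Filter.atTop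
      (nhds 0) := by
    simpa using (tendsto_tsum_norm_freq_sub_real_inv_sq hω).const_mul K
  obtain ⟨μ, hμδ, hμ⟩ := ((hlim.eventually (gt_mem_nhds (pow_pos hδ 2))).and
    (Filter.eventually_ge_atTop 1)).exists
  have hμ0 : 0 < μ := one_pos.trans_le hμ
  have hsm : ∀ l j : ℤ, ‖(freq ω l - μ)⁻¹ • (freq ω j - freq ω l) • W (j, l)‖ ^ 2 =
      ‖(freq ω l - μ)⁻¹‖ ^ 2 * ‖(freq ω j - freq ω l) • W (j, l)‖ ^ 2 := fun l j => by
    rw [norm_smul, mul_pow]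
  obtain ⟨h1, h2⟩ := summable_of_summable_cols
    (f := fun p => ‖(freq ω p.2 - μ)⁻¹ • (freq ω p.1 - freq ω p.2) • W p‖ ^ 2)
    (g := fun l => K * ‖(freq ω l - μ)⁻¹‖ ^ 2) (fun _ => sq_nonneg _)
    (fun l => by
      refine ((hc l).mul_left (‖(freq ω l - μ)⁻¹‖ ^ 2)).congr fun j => ?_
      exact (hsm l j).symm)
    ((summable_norm_freq_sub_real_inv_sq hω hμ).mul_left K)
    (fun l => by
      refine (tsum_congr (hsm l)).trans_le (tsum_mul_left.trans_le ?_)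
      rw [mul_comm]
      exact mul_le_mul_of_nonneg_right (hK l) (sq_nonneg _))
  -- Since `(λ_j - μ) / (λ_l - μ) = 1 + (λ_j - λ_l) / (λ_l - μ)`, the conjugate of `W` is `W + C`
  -- with `C` small.
  let C : BlockHS (H →L[ℂ] H) :=
    ⟨fun p => (freq ω p.2 - μ)⁻¹ • (freq ω p.1 - freq ω p.2) • W p, memℓp_two_iff.2 h1⟩
  have hC : ‖C‖ ≤ δ := by
    refine lp.norm_le_of_tsum_norm_sq_le hδ.le (h2.trans ?_)
    rw [tsum_mul_left]
    exact hμδ.le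
  refine ⟨μ, hμ0, W + C, ?_, fun j l => ?_⟩
  · exact (norm_add_le _ _).trans_lt (by linarith)
  · have : (W + C) (j, l) = W (j, l) + (freq ω l - μ)⁻¹ • (freq ω j - freq ω l) • W (j, l) := rfl
    rw [this, smul_add, smul_inv_smul₀ (freq_sub_real_ne_zero ω l hμ0), ← add_smul]
    congr 1
    ring

theorem memℓp_freq_smul_iff {ω μ : ℝ} (x : lp (fun _ : ℤ => H) 2) :
    Memℓp (fun l => freq ω l • x l) 2 ↔ Memℓp (fun l => (freq ω l - μ) • x l) 2 := by
  have hx : Memℓp (fun l => (μ : ℂ) • x l) 2 := (lp.memℓp x).const_smul (μ : ℂ)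
  constructor
  · intro h
    have := h.sub hx
    refine (congrArg (fun f => Memℓp f 2) ?_).mp this
    ext l
    exact (sub_smul _ _ _).symm
  · intro h
    have := h.add hx
    refine (congrArg (fun f => Memℓp f 2) ?_).mp this
    ext l
    change (freq ω l - μ) • x l + (μ : ℂ) • x l = _
    rw [← add_smul, sub_add_cancel]

/-- `I + W` preserves the domain of the diagonal operator in both directions. -/
theorem memℓp_freq_smul_add_blockOp_iff {ω : ℝ} (hω : 0 < ω) (W : BlockHS (H →L[ℂ] H))
    (hW : ‖W‖ < 1) {K : ℝ} (hc : ∀ l, Summable fun j => ‖(freq ω j - freq ω l) • W (j, l)‖ ^ 2)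
    (hK : ∀ l, ∑' j, ‖(freq ω j - freq ω l) • W (j, l)‖ ^ 2 ≤ K) (x : lp (fun _ : ℤ => H) 2) :
    Memℓp (fun l => freq ω l • (x + blockOp W x) l) 2 ↔ Memℓp (fun l => freq ω l • x l) 2 := by
  obtain ⟨μ, hμ, S, hS, hSW⟩ := exists_conj_norm_lt_one hω W hW hc hK
  -- The identity `(L₀ - μ)(I + W) x = (I + S)(L₀ - μ) x`, coordinate by coordinate.
  have key : ∀ x y : lp (fun _ : ℤ => H) 2, (∀ l, y l = (freq ω l - μ) • x l) →
      ∀ j, (freq ω j - μ) • (x + blockOp W x) j = (y + blockOp S y) j := by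
    intro x y hxy j
    rw [lp.coeFn_add, lp.coeFn_add, Pi.add_apply, Pi.add_apply, smul_add, hxy, blockOp_apply,
      blockOp_apply, ← (W.summable_apply x j).tsum_const_smul]
    congr 2
    ext l
    rw [hxy, map_smul, ← smul_apply, ← smul_apply, hSW]
  rw [memℓp_freq_smul_iff (μ := μ), memℓp_freq_smul_iff (μ := μ)]
  constructor
  · intro h
    obtain ⟨e, he⟩ := exists_equiv_one_add (blockOp S) ((norm_blockOp_le S).trans_lt hS)
    obtain ⟨eW, heW⟩ := exists_equiv_one_add (blockOp W) ((norm_blockOp_le W).trans_lt hW)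
    have he' : ∀ y, e y = y + blockOp S y := fun y => congrArg (· y) he
    have heW' : ∀ y, eW y = y + blockOp W y := fun y => congrArg (· y) heW
    -- With `y = (I + S)⁻¹ (L₀ - μ)(I + W) x`, the vector `(L₀ - μ)⁻¹ y` lies in the domain. By
    -- `key` it has the same image under `I + W` as `x`, so injectivity of `I + W` identifies the
    -- two.
    obtain ⟨y, hy⟩ := e.surjective (⟨_, h⟩ : lp (fun _ : ℤ => H) 2)
    have hx' : Memℓp (fun l => (freq ω l - μ)⁻¹ • y l) 2 := by
      refine memℓp_two_iff.2 (((lp.summable_norm_sq y).mul_left (μ⁻¹ ^ 2)).of_nonneg_of_le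
        (fun _ => sq_nonneg _) fun l => ?_)
      rw [norm_smul, mul_pow]
      gcongr
      exact norm_freq_sub_real_inv_le ω l hμ
    have hyx : ∀ l, y l = (freq ω l - μ) • (⟨_, hx'⟩ : lp (fun _ : ℤ => H) 2) l := fun l =>
      (smul_inv_smul₀ (freq_sub_real_ne_zero ω l hμ) (y l)).symm
    have hxx : (⟨_, hx'⟩ : lp (fun _ : ℤ => H) 2) = x := by
      apply eW.injective
      rw [heW', heW']
      ext j
      have h1 := key _ y hyx j
      rw [← he', hy] at h1
      exact smul_right_injective H (freq_sub_real_ne_zero ω j hμ) h1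
    have := lp.memℓp y
    rw [hxx] at hyx
    exact (congrArg (fun f => Memℓp f 2) (funext hyx)).mp this
  · intro h
    have := lp.memℓp ((⟨_, h⟩ : lp (fun _ : ℤ => H) 2) + blockOp S ⟨_, h⟩)
    refine (congrArg (fun f => Memℓp f 2) (funext fun j => ?_)).mp this
    exact (key x ⟨_, h⟩ (fun _ => rfl) j).symm

end

/-! ### Block-diagonal parts and the solution operator of the commutator equation -/

/-- The indices `j` and `l` belong to the same block of `H_(k) ⊕ ⨁_{|ℓ| > k} H_ℓ`. -/
def SameBlock (k : ℕ) (j l : ℤ) : Prop := j = l ∨ |j| ≤ k ∧ |l| ≤ k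

theorem SameBlock.trans {k : ℕ} {i j l : ℤ} (h₁ : SameBlock k i j) (h₂ : SameBlock k j l) :
    SameBlock k i l := by
  unfold SameBlock at *
  grind

theorem SameBlock.symm {k : ℕ} {j l : ℤ} (h : SameBlock k j l) : SameBlock k l j := by
  unfold SameBlock at *
  grind

section

variable {A : Type*} [NormedRing A] [NormedAlgebra ℂ A] [CompleteSpace A]

open scoped Classical in
/-- The block-diagonal part of a block matrix. -/
noncomputable def diagPart (k : ℕ) : BlockHS A →L[ℂ] BlockHS A :=
  multiplier (fun p => if SameBlock k p.1 p.2 then 1 else 0) 1 fun p => by split_ifs <;> simp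

open scoped Classical in
/-- The solution with vanishing block-diagonal part of
`(λ_j - λ_l) Y_{jl} = X_{jl} - (diagPart X)_{jl}`. -/
noncomputable def offDiagSolve {ω : ℝ} (hω : 0 < ω) (k : ℕ) : BlockHS A →L[ℂ] BlockHS A :=
  multiplier (fun p => if SameBlock k p.1 p.2 then 0 else (freq ω p.1 - freq ω p.2)⁻¹)
    (ω / (2 * Real.pi)) fun p => by
      split_ifs with h
      · rw [norm_zero]; positivity
      · exact norm_freq_sub_inv_le_of_ne hω fun h' => h (Or.inl h')

theorem diagPart_of_sameBlock {k : ℕ} {j l : ℤ} (h : SameBlock k j l) (X : BlockHS A) :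
    diagPart k X (j, l) = X (j, l) := by
  unfold diagPart
  rw [multiplier_apply]
  simp [h]

theorem diagPart_of_not_sameBlock {k : ℕ} {j l : ℤ} (h : ¬ SameBlock k j l) (X : BlockHS A) :
    diagPart k X (j, l) = 0 := by
  unfold diagPart
  rw [multiplier_apply]
  simp [h]

theorem norm_diagPart_le (k : ℕ) (X : BlockHS A) : ‖diagPart k X‖ ≤ ‖X‖ :=
  (norm_multiplier_le _ _ _ _).trans_eq (one_mul _)

theorem offDiagSolve_of_sameBlock {ω : ℝ} (hω : 0 < ω) {k : ℕ} {j l : ℤ} (h : SameBlock k j l)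
    (X : BlockHS A) : offDiagSolve hω k X (j, l) = 0 := by
  unfold offDiagSolve
  rw [multiplier_apply]
  simp [h]

theorem freq_sub_smul_offDiagSolve {ω : ℝ} (hω : 0 < ω) (k : ℕ) (X : BlockHS A) (j l : ℤ) :
    (freq ω j - freq ω l) • offDiagSolve hω k X (j, l) = X (j, l) - diagPart k X (j, l) := by
  by_cases h : SameBlock k j l
  · rw [offDiagSolve_of_sameBlock hω h, diagPart_of_sameBlock h, smul_zero, sub_self]
  · rw [diagPart_of_not_sameBlock h, sub_zero]
    unfold offDiagSolve
    rw [multiplier_apply]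
    simp only [h, if_false]
    exact smul_inv_smul₀ (freq_sub_ne_zero hω fun h' => h (Or.inl h')) _

theorem norm_offDiagSolve_le {ω : ℝ} (hω : 0 < ω) (k : ℕ) (X : BlockHS A) :
    ‖offDiagSolve hω k X‖ ≤ ω / (2 * Real.pi) * ‖X‖ :=
  norm_multiplier_le _ _ _ _

/-! ### Finite approximation, and smallness of the commutator solution for a large central block. -/

theorem exists_finite_approx (X : BlockHS A) {ε : ℝ} (hε : 0 < ε) :
    ∃ (Y : BlockHS A) (m : ℕ), ‖X - Y‖ ≤ ε ∧
      ∀ j l, Y (j, l) ≠ 0 → |j| ≤ m ∧ |l| ≤ m := by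
  have h := lp.hasSum_single (p := 2) (by norm_num) X
  obtain ⟨s, hs⟩ := (Filter.Tendsto.eventually h (Metric.ball_mem_nhds X hε)).exists
  refine ⟨∑ i ∈ s, lp.single 2 i (X i), s.sup fun p => max p.1.natAbs p.2.natAbs, ?_,
    fun j l hjl => ?_⟩
  · rw [← dist_eq_norm, dist_comm]
    exact (Metric.mem_ball.1 hs).le
  · have hmem : (j, l) ∈ s := by
      by_contra hn
      refine hjl ?_
      rw [lp.coeFn_sum, Finset.sum_apply]
      refine Finset.sum_eq_zero fun p hp => lp.single_apply_ne _ _ _ ?_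
      rintro rfl
      exact hn hp
    have hle : max j.natAbs l.natAbs ≤ s.sup fun p => max p.1.natAbs p.2.natAbs :=
      Finset.le_sup (f := fun p : ℤ × ℤ => max p.1.natAbs p.2.natAbs) hmem
    rw [Int.abs_eq_natAbs, Int.abs_eq_natAbs]
    omega

/-- Every nonzero entry of `Y` lies in the central block, so off the blocks `X` agrees with `X - Y`.
-/
theorem norm_sub_diagPart_le {X Y : BlockHS A} {m k : ℕ}
    (hY : ∀ j l, Y (j, l) ≠ 0 → |j| ≤ m ∧ |l| ≤ m) (hk : m ≤ k) :
    ‖X - diagPart k X‖ ≤ ‖X - Y‖ := by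
  have := lp.norm_le_mul_of_forall_le (f := X - diagPart k X) (g := X - Y) zero_le_one ?_
  · rwa [one_mul] at this
  · rintro ⟨j, l⟩
    rw [one_mul, lp.coeFn_sub, lp.coeFn_sub, Pi.sub_apply, Pi.sub_apply]
    by_cases h : SameBlock k j l
    · rw [diagPart_of_sameBlock h, sub_self, norm_zero]
      exact norm_nonneg _
    · have : Y (j, l) = 0 := by
        by_contra hn
        obtain ⟨h1, h2⟩ := hY j l hn
        exact h (Or.inr ⟨by omega, by omega⟩)
      rw [diagPart_of_not_sameBlock h, this]

theorem exists_norm_sub_diagPart_le (X : BlockHS A) {ε : ℝ} (hε : 0 < ε) :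
    ∃ m : ℕ, ∀ k, m ≤ k → ‖X - diagPart k X‖ ≤ ε := by
  obtain ⟨Y, m, hXY, hY⟩ := exists_finite_approx X hε
  exact ⟨m, fun k hk => (norm_sub_diagPart_le hY hk).trans hXY⟩

/-- If one index is at most `m` in modulus and the pair lies off the blocks, then the other index
exceeds `k`. The divisor `λ_j - λ_l` is then at least `(2π/ω)(k - m)` in modulus. Having only one
index controlled is what products with a finite matrix provide. -/
theorem norm_offDiagSolve_le_of_support {ω : ℝ} (hω : 0 < ω) {X : BlockHS A} {m k : ℕ}
    (hX : ∀ j l, X (j, l) ≠ 0 → |j| ≤ m ∨ |l| ≤ m) (hk : m < k) :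
    ‖offDiagSolve hω k X‖ ≤ ω / (2 * Real.pi) / (k - m : ℝ) * ‖X‖ := by
  have hkm : (0 : ℝ) < k - m := by
    have : (m : ℝ) < k := by exact_mod_cast hk
    linarith
  refine lp.norm_le_mul_of_forall_le (by positivity) ?_
  rintro ⟨j, l⟩
  by_cases h : SameBlock k j l
  · rw [offDiagSolve_of_sameBlock hω h, norm_zero]
    positivity
  by_cases h0 : X (j, l) = 0
  · unfold offDiagSolve
    rw [multiplier_apply, h0, smul_zero]
    simp
  · have hfar : (k : ℤ) - m ≤ |j - l| := by
      have h1 : ¬ (|j| ≤ k ∧ |l| ≤ k) := fun h' => h (Or.inr h')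
      have h2 := hX j l h0
      have h3 := abs_sub_abs_le_abs_sub j l
      have h4 := abs_sub_abs_le_abs_sub l j
      rw [abs_sub_comm l j] at h4
      omega
    have hfar' : (k - m : ℝ) ≤ |((j - l : ℤ) : ℝ)| := by exact_mod_cast hfar
    unfold offDiagSolve
    rw [multiplier_apply, norm_smul]
    simp only [h, if_false]
    gcongr
    exact norm_freq_sub_inv_le hω hkm hfar'

theorem blockMul_ne_zero_row {X Y : BlockHS A} {m : ℕ}
    (hX : ∀ j l, X (j, l) ≠ 0 → |j| ≤ m ∧ |l| ≤ m) (j l : ℤ) (h : blockMul X Y (j, l) ≠ 0) :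
    |j| ≤ m := by
  by_contra hj
  refine h ?_
  rw [blockMul_apply]
  refine (tsum_congr fun n => ?_).trans tsum_zero
  have : X (j, n) = 0 := by
    by_contra hn
    exact hj (hX j n hn).1
  rw [this, zero_mul]

theorem blockMul_ne_zero_col {X Y : BlockHS A} {m : ℕ}
    (hY : ∀ j l, Y (j, l) ≠ 0 → |j| ≤ m ∧ |l| ≤ m) (j l : ℤ) (h : blockMul X Y (j, l) ≠ 0) :
    |l| ≤ m := by
  by_contra hj
  refine h ?_
  rw [blockMul_apply]
  refine (tsum_congr fun n => ?_).trans tsum_zero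
  have : Y (n, l) = 0 := by
    by_contra hn
    exact hj (hY n l hn).2
  rw [this, mul_zero]

theorem diagPart_ne_zero {X : BlockHS A} {m k : ℕ}
    (hX : ∀ j l, X (j, l) ≠ 0 → |j| ≤ m ∧ |l| ≤ m) (j l : ℤ) (h : diagPart k X (j, l) ≠ 0) :
    |j| ≤ m ∧ |l| ≤ m := by
  refine hX j l fun h0 => h ?_
  by_cases hb : SameBlock k j l
  · rw [diagPart_of_sameBlock hb, h0]
  · rw [diagPart_of_not_sameBlock hb]

/-- For a fixed Hilbert--Schmidt matrix `Q`, the operators `Y ↦ offDiagSolve k (Q Y)` and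
`Y ↦ offDiagSolve k (Y (diagPart k Q))` tend to zero in norm as `k → ∞`. -/
theorem exists_norm_offDiagSolve_blockMul_le {ω : ℝ} (hω : 0 < ω) (Q : BlockHS A) {ε : ℝ}
    (hε : 0 < ε) : ∃ k : ℕ, ‖offDiagSolve hω k Q‖ ≤ ε ∧
      (∀ Y, ‖offDiagSolve hω k (blockMul Q Y)‖ ≤ ε * ‖Y‖) ∧
      ∀ Y, ‖offDiagSolve hω k (blockMul Y (diagPart k Q))‖ ≤ ε * ‖Y‖ := by
  set g := ω / (2 * Real.pi) with hg
  have hg0 : 0 < g := by positivity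
  -- `Q` is split into a small remainder, for which the crude bound `g` on the solution operator
  -- suffices, and a finite part `Q₁`. The latter gains the factor `1 / n` when the block has size
  -- `m + n`; each contributes `ε / 2`.
  obtain ⟨Q₁, m, hQ, hQ₁⟩ := exists_finite_approx Q (ε := ε / (2 * g)) (by positivity)
  obtain ⟨n, hn⟩ := exists_nat_gt (2 * g * ‖Q₁‖ / ε)
  have hn0 : (0 : ℝ) < n := lt_of_le_of_lt (by positivity) hn
  have hn0' : 0 < n := by exact_mod_cast hn0
  have hgQ : g * ‖Q - Q₁‖ ≤ ε / 2 := by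
    calc g * ‖Q - Q₁‖ ≤ g * (ε / (2 * g)) := by gcongr
      _ = ε / 2 := by field_simp
  have hgn : g / n * ‖Q₁‖ ≤ ε / 2 := by
    rw [div_lt_iff₀ hε] at hn
    rw [div_mul_eq_mul_div, div_le_iff₀ hn0]
    linarith
  have hfar : ∀ X : BlockHS A, (∀ j l, X (j, l) ≠ 0 → |j| ≤ m ∨ |l| ≤ m) →
      ‖offDiagSolve hω (m + n) X‖ ≤ g / n * ‖X‖ := fun X hX => by
    have := norm_offDiagSolve_le_of_support hω hX (k := m + n) (by omega)
    simpa using this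
  refine ⟨m + n, ?_, fun Y => ?_, fun Y => ?_⟩
  · have e : Q = (Q - Q₁) + Q₁ := by abel
    have h1 := norm_offDiagSolve_le hω (m + n) (Q - Q₁)
    have h2 := hfar Q₁ fun j l h => Or.inl (hQ₁ j l h).1
    rw [e, map_add]
    refine (norm_add_le _ _).trans ?_
    rw [← hg] at h1
    linarith
  · have e : blockMul Q Y = blockMul (Q - Q₁) Y + blockMul Q₁ Y := by
      rw [map_sub]; simp
    have h1 := norm_offDiagSolve_le hω (m + n) (blockMul (Q - Q₁) Y)
    have h2 := hfar (blockMul Q₁ Y) fun j l h => Or.inl (blockMul_ne_zero_row hQ₁ j l h)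
    have h3 := norm_blockMul_le (Q - Q₁) Y
    have h4 := norm_blockMul_le Q₁ Y
    rw [e, map_add]
    refine (norm_add_le _ _).trans ?_
    calc _ ≤ g * (‖Q - Q₁‖ * ‖Y‖) + g / n * (‖Q₁‖ * ‖Y‖) := by
          refine add_le_add (h1.trans ?_) (h2.trans ?_) <;> gcongr
      _ = (g * ‖Q - Q₁‖ + g / n * ‖Q₁‖) * ‖Y‖ := by ring
      _ ≤ (ε / 2 + ε / 2) * ‖Y‖ := by gcongr
      _ = ε * ‖Y‖ := by ring
  · set D : BlockHS A →L[ℂ] BlockHS A := diagPart (m + n) with hD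
    have e : blockMul Y (D Q) = blockMul Y (D (Q - Q₁)) + blockMul Y (D Q₁) := by
      rw [← map_add, ← map_add, sub_add_cancel]
    have h1 := norm_offDiagSolve_le hω (m + n) (blockMul Y (D (Q - Q₁)))
    have h2 := hfar (blockMul Y (D Q₁)) fun j l h =>
      Or.inr (blockMul_ne_zero_col (diagPart_ne_zero hQ₁) j l h)
    have h3 := norm_blockMul_le Y (D (Q - Q₁))
    have h4 := norm_blockMul_le Y (D Q₁)
    have h5 : ‖D (Q - Q₁)‖ ≤ ‖Q - Q₁‖ := norm_diagPart_le _ _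
    have h6 : ‖D Q₁‖ ≤ ‖Q₁‖ := norm_diagPart_le _ _
    rw [e, map_add]
    refine (norm_add_le _ _).trans ?_
    calc _ ≤ g * (‖Y‖ * ‖Q - Q₁‖) + g / n * (‖Y‖ * ‖Q₁‖) := by
          refine add_le_add (h1.trans ?_) (h2.trans ?_)
          · rw [← hg]; gcongr; exact h3.trans (by gcongr)
          · gcongr; exact h4.trans (by gcongr)
      _ = (g * ‖Q - Q₁‖ + g / n * ‖Q₁‖) * ‖Y‖ := by ring
      _ ≤ (ε / 2 + ε / 2) * ‖Y‖ := by gcongr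
      _ = ε * ‖Y‖ := by ring

/-! ### Block diagonalization by a fixed-point argument. -/

theorem exists_fixedPoint_of_contraction_on_ball {E : Type*} [NormedAddCommGroup E]
    [CompleteSpace E] (Φ : E → E) {r : ℝ} (hr : 0 ≤ r) (hmap : ∀ x, ‖x‖ ≤ r → ‖Φ x‖ ≤ r)
    (hlip : ∀ x y, ‖x‖ ≤ r → ‖y‖ ≤ r → ‖Φ x - Φ y‖ ≤ 1 / 2 * ‖x - y‖) :
    ∃ x, ‖x‖ ≤ r ∧ Φ x = x := by
  have hm : Set.MapsTo Φ (Metric.closedBall 0 r) (Metric.closedBall 0 r) := fun x hx => by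
    rw [mem_closedBall_zero_iff] at *
    exact hmap x hx
  have hc : ContractingWith (1 / 2) (hm.restrict Φ _ _) := by
    refine ⟨by norm_num, LipschitzWith.of_dist_le_mul fun x y => ?_⟩
    rw [Subtype.dist_eq, Subtype.dist_eq, dist_eq_norm, dist_eq_norm]
    have := hlip x y (mem_closedBall_zero_iff.1 x.2) (mem_closedBall_zero_iff.1 y.2)
    simpa using this
  obtain ⟨x, hx, hfix, -⟩ := hc.exists_fixedPoint' Metric.isClosed_closedBall.isComplete hm
    (Metric.mem_closedBall_self hr) (edist_ne_top _ _)
  exact ⟨x, mem_closedBall_zero_iff.1 hx, hfix⟩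

/-- The nonlinear equation of the method of similar operators for a Hilbert--Schmidt
perturbation `Q`: there are `W` and a block-diagonal `N` with
`L₀ W - W L₀ = Q + Q W - N - W N`. -/
theorem exists_block_diagonalization {ω : ℝ} (hω : 0 < ω) (Q : BlockHS A) :
    ∃ (k : ℕ) (W N : BlockHS A), ‖W‖ < 1 ∧ (∀ j l, ¬ SameBlock k j l → N (j, l) = 0) ∧
      ∀ j l, (freq ω j - freq ω l) • W (j, l) =
        Q (j, l) + blockMul Q W (j, l) - N (j, l) - blockMul W N (j, l) := by
  set g := ω / (2 * Real.pi) with hg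
  have hg0 : 0 < g := by positivity
  set β := g * ‖Q‖ with hβ
  have hβ0 : 0 ≤ β := by positivity
  -- The radius is fixed before `k`: it tames the quadratic term through `β r ≤ 1 / 8`, where `β`
  -- does not depend on `k`. Then `k` is taken so large that the constant and linear terms have size
  -- `r / 4`.
  obtain ⟨r, hr0, hr2, hrβ⟩ : ∃ r : ℝ, 0 < r ∧ r ≤ 1 / 2 ∧ β * r ≤ 1 / 8 := by
    refine ⟨min (1 / 2) (1 / (8 * (β + 1))), by positivity, min_le_left _ _, ?_⟩
    calc β * min (1 / 2) (1 / (8 * (β + 1))) ≤ β * (1 / (8 * (β + 1))) := by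
          gcongr; exact min_le_right _ _
      _ ≤ 1 / 8 := by
          rw [mul_one_div, div_le_div_iff₀ (by positivity) (by norm_num)]
          linarith
  obtain ⟨k, hk1, hk2, hk3⟩ := exists_norm_offDiagSolve_blockMul_le hω Q (ε := r / 4)
    (by positivity)
  set Γ : BlockHS A →L[ℂ] BlockHS A := offDiagSolve hω k with hΓ
  set J : BlockHS A →L[ℂ] BlockHS A := diagPart k with hJ
  -- Neither outer factor is fixed here, so no decay in `k` is claimed; smallness comes from the
  -- radius of the ball.
  have hquad : ∀ X Y, ‖Γ (blockMul X (J (blockMul Q Y)))‖ ≤ β * ‖X‖ * ‖Y‖ := fun X Y => by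
    have h1 : ‖Γ (blockMul X (J (blockMul Q Y)))‖ ≤ g * ‖blockMul X (J (blockMul Q Y))‖ :=
      norm_offDiagSolve_le hω k _
    have h2 : ‖J (blockMul Q Y)‖ ≤ ‖blockMul Q Y‖ := norm_diagPart_le k _
    have h3 := norm_blockMul_le Q Y
    have h4 := norm_blockMul_le X (J (blockMul Q Y))
    calc _ ≤ g * (‖X‖ * (‖Q‖ * ‖Y‖)) := by
          refine h1.trans ?_
          gcongr
          refine h4.trans ?_
          gcongr
          exact h2.trans h3
      _ = β * ‖X‖ * ‖Y‖ := by rw [hβ]; ring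
  let Φ : BlockHS A → BlockHS A := fun W =>
    Γ Q + Γ (blockMul Q W) - Γ (blockMul W (J Q)) - Γ (blockMul W (J (blockMul Q W)))
  obtain ⟨W, hWr, hW⟩ := exists_fixedPoint_of_contraction_on_ball Φ hr0.le
    (fun W hW => by
      have h2 := hk2 W
      have h3 := hk3 W
      have h4 := hquad W W
      have h5 : ‖Φ W‖ ≤ ‖Γ Q‖ + ‖Γ (blockMul Q W)‖ + ‖Γ (blockMul W (J Q))‖ +
          ‖Γ (blockMul W (J (blockMul Q W)))‖ := by
        refine (norm_sub_le _ _).trans ?_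
        gcongr
        refine (norm_sub_le _ _).trans ?_
        gcongr
        exact norm_add_le _ _
      have h6 : β * ‖W‖ * ‖W‖ ≤ β * r * r := by gcongr
      have h7 : r / 4 * ‖W‖ ≤ r / 4 * r := by gcongr
      -- The total is at most `r/4 + r²/4 + r²/4 + β r² ≤ (1/4 + 1/8 + 1/8 + 1/8) r`.
      nlinarith)
    (fun W W' hW hW' => by
      have h2 := hk2 (W - W')
      have h3 := hk3 (W - W')
      have h4 := hquad W (W - W')
      have h5 := hquad (W - W') W'
      -- Polarization of the quadratic term gives four summands, each with Lipschitz constant `1 /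
      -- 8`.
      have e : Φ W - Φ W' = Γ (blockMul Q (W - W')) - Γ (blockMul (W - W') (J Q)) -
          Γ (blockMul W (J (blockMul Q (W - W')))) -
          Γ (blockMul (W - W') (J (blockMul Q W'))) := by
        simp only [Φ, map_sub, sub_apply]
        abel
      rw [e]
      have h6 := norm_sub_le (Γ (blockMul Q (W - W')) - Γ (blockMul (W - W') (J Q)) -
          Γ (blockMul W (J (blockMul Q (W - W'))))) (Γ (blockMul (W - W') (J (blockMul Q W'))))
      have h7 := norm_sub_le (Γ (blockMul Q (W - W')) - Γ (blockMul (W - W') (J Q)))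
          (Γ (blockMul W (J (blockMul Q (W - W')))))
      have h8 := norm_sub_le (Γ (blockMul Q (W - W'))) (Γ (blockMul (W - W') (J Q)))
      have h9 : β * ‖W‖ * ‖W - W'‖ ≤ 1 / 8 * ‖W - W'‖ := by
        gcongr
        exact le_trans (by gcongr) hrβ
      have h10 : β * ‖W - W'‖ * ‖W'‖ ≤ 1 / 8 * ‖W - W'‖ := by
        rw [mul_right_comm]
        gcongr
        exact le_trans (by gcongr) hrβ
      have h11 : r / 4 * ‖W - W'‖ ≤ 1 / 8 * ‖W - W'‖ :=
        mul_le_mul_of_nonneg_right (by linarith) (norm_nonneg _)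
      linarith)
  set N := J (Q + blockMul Q W) with hN
  have hN0 : ∀ j l, ¬ SameBlock k j l → N (j, l) = 0 := fun j l h =>
    diagPart_of_not_sameBlock h _
  have hWΓ : W = Γ (Q + blockMul Q W - blockMul W N) := by
    conv_lhs => rw [← hW]
    simp only [Φ, hN, map_add, map_sub]
    abel
  have hW0 : ∀ j l, SameBlock k j l → W (j, l) = 0 := fun j l h => by
    rw [hWΓ]; exact offDiagSolve_of_sameBlock hω h _
  -- For `j`, `l` in one block, an intermediate index `n` either lies in that block, where `W (j, n)
  -- = 0`, or outside it, where `N (n, l) = 0`. Hence the block-diagonal part of `Q + Q W - W N` is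
  -- exactly `N`, which turns the fixed-point equation into the commutator equation.
  have hWN : J (blockMul W N) = 0 := by
    ext ⟨j, l⟩
    by_cases h : SameBlock k j l
    · rw [hJ, diagPart_of_sameBlock h, blockMul_apply, lp.coeFn_zero, Pi.zero_apply]
      refine (tsum_congr fun n => ?_).trans tsum_zero
      by_cases hn : SameBlock k n l
      · rw [hW0 j n (h.trans hn.symm), zero_mul]
      · rw [hN0 n l hn, mul_zero]
    · rw [hJ, diagPart_of_not_sameBlock h]; rfl
  refine ⟨k, W, N, hWr.trans_lt (by linarith), hN0, fun j l => ?_⟩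
  have h1 := freq_sub_smul_offDiagSolve hω k (Q + blockMul Q W - blockMul W N) j l
  rw [← hΓ, ← hJ, ← hWΓ, map_sub, hWN, sub_zero, ← hN] at h1
  rw [h1, lp.coeFn_sub, lp.coeFn_add, Pi.sub_apply, Pi.add_apply]
  abel

end

/-! ### The first transform of a Hankel perturbation -/

section

variable {A : Type*} [NormedRing A] [NormedAlgebra ℂ A] [CompleteSpace A]

theorem summable_shift {v : ℤ → A} (hv : Summable fun n => ‖v n‖ ^ 2) (j : ℤ) :
    Summable fun n => ‖v (j + n)‖ ^ 2 :=
  hv.comp_injective (i := fun n => j + n) fun _ _ h => add_left_cancel h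

theorem tsum_shift (v : ℤ → A) (j : ℤ) : ∑' n, ‖v (n + j)‖ ^ 2 = ∑' n, ‖v n‖ ^ 2 :=
  (Equiv.addRight j).tsum_eq fun n => ‖v n‖ ^ 2

/-- The map `(j, l) ↦ (j + l, j - l)` is injective, so the squared norms are dominated by the
product of `∑ ‖v n‖²` and a multiple of `∑ 1/l²`. On the diagonal the entry is zero because `0⁻¹ =
0`. -/
theorem memℓp_commutator_solution {ω : ℝ} (hω : 0 < ω) {v : ℤ → A}
    (hv : Summable fun n => ‖v n‖ ^ 2) :
    Memℓp (fun p : ℤ × ℤ => (freq ω p.1 - freq ω p.2)⁻¹ • v (p.1 + p.2)) 2 := by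
  have h1 : Summable fun q : ℤ × ℤ => ‖v q.1‖ ^ 2 * ((q.2 : ℝ) ^ 2)⁻¹ :=
    hv.mul_of_nonneg summable_inv_int_sq (fun n => sq_nonneg ‖v n‖) fun l => by
      change 0 ≤ ((l : ℝ) ^ 2)⁻¹
      positivity
  have h2 := h1.comp_injective (i := fun p : ℤ × ℤ => (p.1 + p.2, p.1 - p.2)) fun p q h => by
    have ha := (Prod.mk.inj h).1
    have hb := (Prod.mk.inj h).2
    ext <;> omega
  refine memℓp_two_iff.2 ((h2.mul_left ((ω / (2 * Real.pi)) ^ 2)).congr fun p => ?_)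
  rw [norm_smul, norm_inv, norm_freq_sub hω]
  simp only [Function.comp]
  rw [mul_pow, mul_inv, mul_pow, inv_div, inv_pow, sq_abs]
  ring

/-- The diagonal of a Hankel matrix is the subsequence `v(2l)` of its symbol; the central square
adds finitely many entries. -/
theorem memℓp_diagPart_hankel {v : ℤ → A} (hv : Summable fun n => ‖v n‖ ^ 2) (k : ℕ)
    {D : ℤ × ℤ → A} (hD : ∀ j l, SameBlock k j l → D (j, l) = v (j + l))
    (hD' : ∀ j l, ¬ SameBlock k j l → D (j, l) = 0) : Memℓp D 2 := by
  classical
  let f : ℤ × ℤ → ℝ := fun p => if p.1 = p.2 then ‖v (p.1 + p.2)‖ ^ 2 else 0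
  let s : Finset (ℤ × ℤ) := Finset.Icc (-(k : ℤ)) k ×ˢ Finset.Icc (-(k : ℤ)) k
  let g : ℤ × ℤ → ℝ := fun p => if p ∈ s then ‖v (p.1 + p.2)‖ ^ 2 else 0
  have hf : Summable f := by
    have hi : Function.Injective fun l : ℤ => (l, l) := fun _ _ h => (Prod.mk.inj h).1
    refine (hi.summable_iff fun p hp => ?_).1 ?_
    · refine if_neg fun h => hp ⟨p.1, ?_⟩
      ext <;> simp [h]
    · refine (hv.comp_injective (i := fun n => n + n) fun a b (h : a + a = b + b) => by
        omega).congr fun n => ?_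
      simp [f]
  have hg : Summable g := summable_of_ne_finset_zero (s := s) fun p hp => if_neg hp
  refine memℓp_two_iff.2 ((hf.add hg).of_nonneg_of_le (fun _ => sq_nonneg _) ?_)
  rintro ⟨j, l⟩
  have hf0 : 0 ≤ f (j, l) := by simp only [f]; split_ifs <;> positivity
  have hg0 : 0 ≤ g (j, l) := by simp only [g]; split_ifs <;> positivity
  by_cases h : SameBlock k j l
  · rw [hD j l h]
    rcases h with h | ⟨h1, h2⟩
    · have : f (j, l) = ‖v (j + l)‖ ^ 2 := if_pos h
      linarith
    · have hm : (j, l) ∈ s := by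
        rw [abs_le] at h1 h2
        simp only [s, Finset.mem_product, Finset.mem_Icc]
        omega
      have : g (j, l) = ‖v (j + l)‖ ^ 2 := if_pos hm
      linarith
  · rw [hD' j l h, norm_zero]
    have : (0 : ℝ) ^ 2 = 0 := by norm_num
    linarith

/-- Each nonzero entry `Y q` contributes a single column, a shift of `v` multiplied by `Y q`, and
there are finitely many of them. -/
theorem memℓp_hankel_mul_of_finite {v : ℤ → A} (hv : Summable fun n => ‖v n‖ ^ 2)
    {Y : BlockHS A} {m : ℕ} (hY : ∀ j l, Y (j, l) ≠ 0 → |j| ≤ m ∧ |l| ≤ m) :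
    Memℓp (fun p : ℤ × ℤ => ∑' n, v (p.1 + n) * Y (n, p.2)) 2 := by
  classical
  let s : Finset ℤ := Finset.Icc (-(m : ℤ)) m
  have hs : ∀ j l, Y (j, l) ≠ 0 → j ∈ s ∧ l ∈ s := fun j l h => by
    have := hY j l h
    rw [abs_le, abs_le] at this
    simpa only [s, Finset.mem_Icc] using this
  let F : ℤ × ℤ → ℤ × ℤ → A := fun q p => if p.2 = q.2 then v (p.1 + q.1) * Y q else 0
  have hF : ∀ q ∈ s ×ˢ s, Memℓp (F q) 2 := fun q _ => by
    have hi : Function.Injective fun j : ℤ => (j, q.2) := fun _ _ h => (Prod.mk.inj h).1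
    refine memℓp_two_iff.2 ((hi.summable_iff fun p hp => ?_).1 ?_)
    · have : F q p = 0 := if_neg fun h => hp ⟨p.1, by ext <;> simp [h]⟩
      rw [this, norm_zero]
      norm_num
    · refine Summable.of_nonneg_of_le (fun _ => sq_nonneg _) (fun j => ?_)
        ((summable_shift hv q.1).mul_right (‖Y q‖ ^ 2))
      simp only [Function.comp, F, if_true]
      rw [← mul_pow, add_comm j]
      exact pow_le_pow_left₀ (norm_nonneg _) (norm_mul_le _ _) 2
  refine (congrArg (fun f => Memℓp f 2) (funext fun p => ?_)).mp (Memℓp.finsetSum _ hF)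
  rw [Finset.sum_product]
  have h1 : ∀ n ∈ s, ∑ l ∈ s, F (n, l) p = v (p.1 + n) * Y (n, p.2) := fun n _ => by
    by_cases hp : p.2 ∈ s
    · rw [Finset.sum_eq_single p.2]
      · exact if_pos rfl
      · exact fun l _ hl => if_neg (Ne.symm hl)
      · exact fun h => absurd hp h
    · have : Y (n, p.2) = 0 := by
        by_contra hn
        exact hp (hs _ _ hn).2
      rw [this, mul_zero]
      exact Finset.sum_eq_zero fun l hl => if_neg fun h : p.2 = l => hp (h ▸ hl)
  rw [Finset.sum_congr rfl h1]
  refine (tsum_eq_sum fun n hn => ?_).symm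
  have : Y (n, p.2) = 0 := by
    by_contra h
    exact hn (hs _ _ h).1
  rw [this, mul_zero]

theorem freq_sub_inv_eq (ω : ℝ) (n l : ℤ) :
    (freq ω n - freq ω l)⁻¹ = -(freq ω 1)⁻¹ * ((l - n : ℤ) : ℂ)⁻¹ := by
  have : freq ω n - freq ω l = -(freq ω 1) * ((l - n : ℤ) : ℂ) := by
    unfold freq; push_cast; ring
  rw [this, mul_inv, inv_neg]

/-- Identifies the product of the Hankel matrix with its commutator solution with the matrix in the
second hypothesis. The convention `0⁻¹ = 0` removes the term `n = l` from the full sum on the left.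
-/
theorem hankel_commutator_solution_eq (ω : ℝ) (v : ℤ → A) (j l : ℤ) :
    ∑' n, v (j + n) * ((freq ω n - freq ω l)⁻¹ • v (n + l)) =
      -(freq ω 1)⁻¹ • ∑' n : {n : ℤ // n ≠ l}, ((l - n : ℤ) : ℂ)⁻¹ • (v (j + n) * v (l + n)) := by
  have h1 : ∀ n, v (j + n) * ((freq ω n - freq ω l)⁻¹ • v (n + l)) =
      -(freq ω 1)⁻¹ • ((l - n : ℤ) : ℂ)⁻¹ • (v (j + n) * v (l + n)) := fun n => by
    rw [freq_sub_inv_eq, mul_smul_comm, mul_smul, add_comm n l]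
  have h2 := tsum_subtype_eq_of_support_subset (s := {n : ℤ | n ≠ l})
    (f := fun n : ℤ => ((l - n : ℤ) : ℂ)⁻¹ • (v (j + n) * v (l + n))) (by
      intro n hn h
      subst h
      simp at hn)
  rw [tsum_congr h1, tsum_const_smul'']
  congr 1
  exact h2.symm

/-- For a Hankel block matrix `v(j + l)` with square-summable symbol, for which the product with
its commutator solution is Hilbert--Schmidt, there is a small Hilbert--Schmidt `G` such that `I + G`
transforms the perturbation into a Hilbert--Schmidt matrix `Q`. -/
theorem exists_hankel_transform {ω : ℝ} (hω : 0 < ω) {v : ℤ → A}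
    (hv : Summable fun n => ‖v n‖ ^ 2)
    (hprod : Summable fun p : ℤ × ℤ =>
      ‖∑' n : {n : ℤ // n ≠ p.2}, ((p.2 - n : ℤ) : ℂ)⁻¹ • (v (p.1 + n) * v (p.2 + n))‖ ^ 2) :
    ∃ G Q : BlockHS A, ‖G‖ < 1 ∧
      (∀ j l, ‖(freq ω j - freq ω l) • G (j, l)‖ ≤ ‖v (j + l)‖) ∧
      ∀ j l, (freq ω j - freq ω l) • G (j, l) =
        v (j + l) + (∑' n, v (j + n) * G (n, l)) - Q (j, l) - blockMul G Q (j, l) := by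
  classical
  let G₀ : BlockHS A := ⟨_, memℓp_commutator_solution hω hv⟩
  have hG₀ : ∀ j l, G₀ (j, l) = (freq ω j - freq ω l)⁻¹ • v (j + l) := fun _ _ => rfl
  -- Removing a central square from `G₀` makes the norm less than one. This `k` is internal to the
  -- first transform and unrelated to the one in the final decomposition.
  obtain ⟨k, hk⟩ := exists_norm_sub_diagPart_le G₀ (ε := 1 / 2) (by norm_num)
  specialize hk k le_rfl
  set G := G₀ - diagPart k G₀ with hG
  have hGs : ∀ j l, SameBlock k j l → G (j, l) = 0 := fun j l h => by
    rw [hG, lp.coeFn_sub, Pi.sub_apply, diagPart_of_sameBlock h, sub_self]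
  have hGn : ∀ j l, ¬ SameBlock k j l → G (j, l) = G₀ (j, l) := fun j l h => by
    rw [hG, lp.coeFn_sub, Pi.sub_apply, diagPart_of_not_sameBlock h, sub_zero]
  have hvG₀ : Memℓp (fun p : ℤ × ℤ => ∑' n, v (p.1 + n) * G₀ (n, p.2)) 2 := by
    refine memℓp_two_iff.2 ((hprod.mul_left (‖-(freq ω 1)⁻¹‖ ^ 2)).congr fun p => ?_)
    rw [← mul_pow, ← norm_smul, ← hankel_commutator_solution_eq]
  -- `G₀` vanishes on the diagonal, so its block-diagonal part is a finite matrix, and passing from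
  -- `G₀` to `G` preserves the Hilbert--Schmidt property of the product with `v`.
  have hfin : ∀ j l, diagPart k G₀ (j, l) ≠ 0 → |j| ≤ k ∧ |l| ≤ k := fun j l h => by
    by_cases hb : SameBlock k j l
    · rcases hb with rfl | hb
      · refine absurd ?_ h
        rw [diagPart_of_sameBlock (Or.inl rfl), hG₀, sub_self, inv_zero, zero_smul]
      · exact hb
    · exact absurd (diagPart_of_not_sameBlock hb _) h
  have hvG : Memℓp (fun p : ℤ × ℤ => ∑' n, v (p.1 + n) * G (n, p.2)) 2 := by
    refine (congrArg (fun f => Memℓp f 2) (funext fun p => ?_)).mp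
      (hvG₀.sub (memℓp_hankel_mul_of_finite hv hfin))
    rw [Pi.sub_apply, ← (summable_row_mul (summable_shift hv p.1)
      (G₀.summable_col p.2)).tsum_sub (summable_row_mul (summable_shift hv p.1)
      ((diagPart k G₀).summable_col p.2))]
    refine tsum_congr fun n => ?_
    rw [hG, lp.coeFn_sub, Pi.sub_apply, mul_sub]
  let D : ℤ × ℤ → A := fun p => if SameBlock k p.1 p.2 then v (p.1 + p.2) else 0
  have hD : Memℓp D 2 := memℓp_diagPart_hankel hv k (fun j l h => if_pos h) fun j l h => if_neg h
  -- `Q` solves `(I + G) Q = D + V G`. Inverting left multiplication by `I + G` on the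
  -- Hilbert--Schmidt matrices keeps `Q` in that class.
  obtain ⟨e, he⟩ := exists_equiv_one_add (blockMul G)
    ((ContinuousLinearMap.opNorm_le_bound _ (norm_nonneg G) (norm_blockMul_le G)).trans_lt
      (hk.trans_lt (by norm_num)))
  obtain ⟨Q, hQ⟩ := e.surjective ((⟨_, hD⟩ : BlockHS A) + ⟨_, hvG⟩)
  have hQ' : Q + blockMul G Q = (⟨_, hD⟩ : BlockHS A) + ⟨_, hvG⟩ :=
    (congrArg (fun T : BlockHS A →L[ℂ] BlockHS A => T Q) he).symm.trans hQ
  have hQe : ∀ j l, Q (j, l) + blockMul G Q (j, l) =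
      (if SameBlock k j l then v (j + l) else 0) + ∑' n, v (j + n) * G (n, l) := fun j l =>
    congrArg (fun X : BlockHS A => X (j, l)) hQ'
  have hcomm : ∀ j l, (freq ω j - freq ω l) • G (j, l) =
      v (j + l) - if SameBlock k j l then v (j + l) else 0 := fun j l => by
    split_ifs with h
    · rw [hGs j l h, smul_zero, sub_self]
    · rw [hGn j l h, hG₀, smul_inv_smul₀ (freq_sub_ne_zero hω fun h' => h (Or.inl h')), sub_zero]
  refine ⟨G, Q, hk.trans_lt (by norm_num), fun j l => ?_, fun j l => ?_⟩
  · rw [hcomm]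
    split_ifs <;> simp
  · rw [hcomm, sub_sub _ (Q (j, l)), hQe]
    abel

end

/-! ### The Fourier transform `L²([0, ω], H) → ℓ²(ℤ, H)` -/

section

variable {H : Type*} [NormedAddCommGroup H] [InnerProductSpace ℂ H] [CompleteSpace H]

theorem exp_freq_mul_period {ω : ℝ} (hω : 0 < ω) (l : ℤ) : Complex.exp (freq ω l * ω) = 1 := by
  have h : freq ω l * ω = l * (2 * Real.pi * Complex.I) := by
    have : (ω : ℂ) ≠ 0 := by exact_mod_cast hω.ne'
    unfold freq
    field_simp
  rw [h, Complex.exp_int_mul_two_pi_mul_I]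

theorem integral_exp_freq_sub {ω : ℝ} (hω : 0 < ω) (m l : ℤ) :
    ∫ τ in Set.Icc 0 ω, Complex.exp (-(freq ω m * τ)) * Complex.exp (freq ω l * τ) =
      if m = l then (ω : ℂ) else 0 := by
  rw [integral_Icc_eq_integral_Ioc, ← intervalIntegral.integral_of_le hω.le]
  have h : ∀ τ : ℝ, Complex.exp (-(freq ω m * τ)) * Complex.exp (freq ω l * τ) =
      Complex.exp ((freq ω l - freq ω m) * τ) := fun τ => by
    rw [← Complex.exp_add]; congr 1; ring
  simp only [h]
  split_ifs with hml
  · subst hml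
    simp
  · rw [integral_exp_mul_complex (freq_sub_ne_zero hω (Ne.symm hml)), sub_mul, Complex.exp_sub,
      exp_freq_mul_period hω, exp_freq_mul_period hω]
    simp

/-- The embedding `h ↦ e^{i 2πℓs/ω} h` of `H` into `L²([0, ω], H)`. -/
noncomputable def expCLM (ω : ℝ) (H : Type*) [NormedAddCommGroup H] [InnerProductSpace ℂ H]
    [CompleteSpace H] (l : ℤ) : H →L[ℂ] L2 ω H :=
  toL2CLM ω (fun s : ℝ => Complex.exp (freq ω l * s) • (1 : H →L[ℂ] H)) (memLp_exp_smul ω l)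

theorem expCLM_coeFn (ω : ℝ) (l : ℤ) (h : H) :
    expCLM ω H l h =ᵐ[intervalMeasure ω] fun s : ℝ => Complex.exp (freq ω l * s) • h :=
  toL2CLM_coeFn ω _ (memLp_exp_smul ω l) h

theorem fourierProj_apply (ω : ℝ) (l : ℤ) (x : L2 ω H) :
    fourierProj ω H l x = expCLM ω H l (coeffCLM ω H l x) := rfl

theorem coeffCLM_expCLM {ω : ℝ} (hω : 0 < ω) (m l : ℤ) (h : H) :
    coeffCLM ω H m (expCLM ω H l h) = if m = l then h else 0 := by
  have h1 : coeffCLM ω H m (expCLM ω H l h) =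
      fourierInt ω m fun s : ℝ => Complex.exp (freq ω l * s) • h := by
    rw [coeffCLM_apply, fourierInt_eq, fourierInt_eq]
    refine integral_congr_ae ?_
    filter_upwards [expCLM_coeFn ω l h] with s hs
    rw [hs]
  rw [h1, fourierInt]
  simp only [smul_smul]
  rw [integral_smul_const, integral_exp_freq_sub hω]
  split_ifs
  · rw [Complex.coe_smul, smul_smul, inv_mul_cancel₀ hω.ne', one_smul]
  · simp

/-- The coefficient map is the adjoint of the embedding. Orthogonality and completeness of the
exponential subspaces and self-adjointness of the `P_ℓ` are all read off from this. -/
theorem inner_expCLM (ω : ℝ) (l : ℤ) (h : H) (y : L2 ω H) :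
    inner ℂ (expCLM ω H l h) y = inner ℂ h (coeffCLM ω H l y) := by
  rw [MeasureTheory.L2.inner_def, coeffCLM_apply, fourierInt_eq,
    ← integral_inner (integrable_exp_smul ω l (Lp.memLp y))]
  refine integral_congr_ae ?_
  filter_upwards [expCLM_coeFn ω l h] with s hs
  rw [hs, inner_smul_left, inner_smul_right, ← Complex.exp_conj]
  congr 2
  simp [freq, map_ofNat]

theorem norm_expCLM {ω : ℝ} (hω : 0 < ω) (l : ℤ) (h : H) : ‖expCLM ω H l h‖ = ‖h‖ := by
  have h1 := inner_expCLM ω l h (expCLM ω H l h)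
  rw [coeffCLM_expCLM hω, if_pos rfl, inner_self_eq_norm_sq_to_K, inner_self_eq_norm_sq_to_K] at h1
  have h2 : ‖expCLM ω H l h‖ ^ 2 = ‖h‖ ^ 2 := by exact_mod_cast h1
  exact (pow_left_inj₀ (norm_nonneg _) (norm_nonneg _) two_ne_zero).1 h2

/-- The embedding `h ↦ e^{i 2πℓs/ω} h` as an isometry. -/
noncomputable def expIsometry {ω : ℝ} (hω : 0 < ω) (H : Type*) [NormedAddCommGroup H]
    [InnerProductSpace ℂ H] [CompleteSpace H] (l : ℤ) : H →ₗᵢ[ℂ] L2 ω H :=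
  { (expCLM ω H l).toLinearMap with norm_map' := norm_expCLM hω l }

theorem expIsometry_apply {ω : ℝ} (hω : 0 < ω) (l : ℤ) (h : H) :
    expIsometry hω H l h = expCLM ω H l h := rfl

theorem orthogonalFamily_expIsometry {ω : ℝ} (hω : 0 < ω) :
    OrthogonalFamily ℂ (fun _ : ℤ => H) (expIsometry hω H) := fun i j hij v w => by
  rw [expIsometry_apply, expIsometry_apply, inner_expCLM, coeffCLM_expCLM hω, if_neg hij,
    inner_zero_right]

theorem memLp_restrict_Ioc {ω : ℝ} (hω : 0 < ω) {E : Type*} [NormedAddCommGroup E] {f : ℝ → E}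
    (hf : MemLp f 2 (intervalMeasure ω)) : MemLp f 2 (volume.restrict (Set.Ioc 0 ω)) := by
  have h : MemLp f 2 (volume.restrict (Set.Icc 0 ω)) := by
    have h1 := hf.smul_measure (c := ENNReal.ofReal ω) ENNReal.ofReal_ne_top
    unfold intervalMeasure at h1
    rwa [smul_smul, ← ENNReal.ofReal_mul hω.le, mul_inv_cancel₀ hω.ne', ENNReal.ofReal_one,
      one_smul] at h1
  exact h.mono_measure (Measure.restrict_mono Set.Ioc_subset_Icc_self le_rfl)

/-- Completeness of the exponentials in the scalar case. -/
theorem ae_eq_zero_of_fourierInt_eq_zero {ω : ℝ} (hω : 0 < ω) {f : ℝ → ℂ}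
    (hf : MemLp f 2 (intervalMeasure ω)) (h : ∀ l, fourierInt ω l f = 0) :
    f =ᵐ[intervalMeasure ω] 0 := by
  have hf' := memLp_restrict_Ioc hω hf
  have hc : ∀ l, fourierCoeffOn hω f l = 0 := fun l => by
    have h1 := h l
    rw [fourierInt, integral_Icc_eq_integral_Ioc, ← intervalIntegral.integral_of_le hω.le,
      smul_eq_zero] at h1
    rw [fourierCoeffOn_eq_integral]
    refine smul_eq_zero_of_right _ ?_
    refine Eq.trans (intervalIntegral.integral_congr fun τ _ => ?_)
      (h1.resolve_left (inv_ne_zero hω.ne'))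
    rw [fourier_coe_apply]
    congr 2
    simp only [freq, sub_zero]
    push_cast
    ring
  have hs := hasSum_sq_fourierCoeffOn hω hf'
  simp only [hc, norm_zero] at hs
  have h0 : (ω - 0)⁻¹ • ∫ x in (0 : ℝ)..ω, ‖f x‖ ^ 2 = 0 := by
    refine hs.unique ?_
    convert hasSum_zero using 2
    norm_num
  rw [smul_eq_zero, intervalIntegral.integral_of_le hω.le] at h0
  have h2 := h0.resolve_left (by rw [sub_zero]; exact inv_ne_zero hω.ne')
  rw [integral_eq_zero_iff_of_nonneg (fun _ => sq_nonneg _)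
    (by simpa using hf'.integrable_norm_pow (p := 2) (by norm_num))] at h2
  refine (ae_intervalMeasure_iff hω).2 ?_
  rw [← restrict_Ioc_eq_restrict_Icc]
  filter_upwards [h2] with s hs
  simpa using hs

/-- Reduction to the scalar case by pairing with a fixed vector `v`. The exceptional null set
depends on `v` and `H` may be nonseparable, so the conclusion `y = 0` is drawn from the vanishing of
all set integrals. -/
theorem eq_zero_of_coeffCLM_eq_zero {ω : ℝ} (hω : 0 < ω) {y : L2 ω H}
    (h : ∀ l, coeffCLM ω H l y = 0) : y = 0 := by
  have hy : MemLp y 2 (intervalMeasure ω) := Lp.memLp y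
  have hyi : Integrable y (intervalMeasure ω) := hy.integrable (by norm_num)
  have hin : ∀ v : H, (fun s => inner ℂ v (y s)) =ᵐ[intervalMeasure ω] 0 := fun v => by
    refine ae_eq_zero_of_fourierInt_eq_zero hω (hy.const_inner v) fun l => ?_
    have h1 := congrArg (fun u => inner ℂ v u) (h l)
    simp only [inner_zero_right] at h1
    rw [coeffCLM_apply, fourierInt_eq,
      ← integral_inner (integrable_exp_smul ω l hy)] at h1
    rw [fourierInt_eq, ← h1]
    refine integral_congr_ae (Filter.Eventually.of_forall fun s => ?_)
    simp only [inner_smul_right, smul_eq_mul]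
  have h0 : y =ᵐ[intervalMeasure ω] 0 := by
    refine hyi.ae_eq_zero_of_forall_setIntegral_eq_zero fun s _ _ => ?_
    refine ext_inner_left ℂ fun v => ?_
    rw [← integral_inner hyi.integrableOn, inner_zero_right]
    exact integral_eq_zero_of_ae (ae_restrict_of_ae (hin v))
  exact (Lp.eq_zero_iff_ae_eq_zero).2 h0

theorem isHilbertSum_expIsometry {ω : ℝ} (hω : 0 < ω) :
    IsHilbertSum ℂ (fun _ : ℤ => H) (expIsometry hω H) := by
  refine IsHilbertSum.mk (orthogonalFamily_expIsometry hω) (le_of_eq ?_)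
  rw [eq_comm, Submodule.topologicalClosure_eq_top_iff, eq_bot_iff]
  intro y hy
  rw [Submodule.mem_bot]
  refine eq_zero_of_coeffCLM_eq_zero hω fun l => ?_
  refine ext_inner_left ℂ fun v => ?_
  rw [← inner_expCLM, inner_zero_right]
  exact hy _ (Submodule.mem_iSup_of_mem l ⟨v, rfl⟩)

/-- The Fourier transform `x ↦ (x̂(ℓ))_ℓ` as an isometric isomorphism. -/
noncomputable def fourierEquiv {ω : ℝ} (hω : 0 < ω) (H : Type*) [NormedAddCommGroup H]
    [InnerProductSpace ℂ H] [CompleteSpace H] : L2 ω H ≃ₗᵢ[ℂ] lp (fun _ : ℤ => H) 2 :=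
  (isHilbertSum_expIsometry hω).linearIsometryEquiv

theorem hasSum_fourierEquiv_symm {ω : ℝ} (hω : 0 < ω) (w : lp (fun _ : ℤ => H) 2) :
    HasSum (fun l => expCLM ω H l (w l)) ((fourierEquiv hω H).symm w) :=
  (isHilbertSum_expIsometry hω).hasSum_linearIsometryEquiv_symm w

theorem coeffCLM_fourierEquiv_symm {ω : ℝ} (hω : 0 < ω) (w : lp (fun _ : ℤ => H) 2) (l : ℤ) :
    coeffCLM ω H l ((fourierEquiv hω H).symm w) = w l := by
  refine ((hasSum_fourierEquiv_symm hω w).mapL (coeffCLM ω H l)).unique ?_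
  simp only [coeffCLM_expCLM hω]
  convert hasSum_ite_eq l (w l) using 2 with m
  by_cases h : m = l
  · subst h; simp
  · simp [h, Ne.symm h]

theorem fourierEquiv_apply {ω : ℝ} (hω : 0 < ω) (x : L2 ω H) (l : ℤ) :
    fourierEquiv hω H x l = coeffCLM ω H l x := by
  conv_rhs => rw [← (fourierEquiv hω H).symm_apply_apply x]
  exact (coeffCLM_fourierEquiv_symm hω _ l).symm

theorem eq_of_coeffCLM_eq {ω : ℝ} (hω : 0 < ω) {x y : L2 ω H}
    (h : ∀ l, coeffCLM ω H l x = coeffCLM ω H l y) : x = y := by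
  apply (fourierEquiv hω H).injective
  ext l
  rw [fourierEquiv_apply, fourierEquiv_apply, h]

theorem hasSum_expCLM_coeffCLM {ω : ℝ} (hω : 0 < ω) (x : L2 ω H) :
    HasSum (fun l => expCLM ω H l (coeffCLM ω H l x)) x := by
  have := hasSum_fourierEquiv_symm hω (fourierEquiv hω H x)
  simpa only [fourierEquiv_apply, LinearIsometryEquiv.symm_apply_apply] using this

theorem isResolutionOfIdentity_fourierProj {ω : ℝ} (hω : 0 < ω) :
    IsResolutionOfIdentity (fourierProj ω H) where
  selfAdjoint i := by
    rw [ContinuousLinearMap.isSelfAdjoint_iff_isSymmetric]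
    intro x y
    change inner ℂ (expCLM ω H i (coeffCLM ω H i x)) y =
      inner ℂ x (expCLM ω H i (coeffCLM ω H i y))
    rw [inner_expCLM, ← inner_conj_symm x, inner_expCLM, inner_conj_symm]
  mul i j := by
    ext1 x
    change fourierProj ω H i (fourierProj ω H j x) = _
    rw [fourierProj_apply, fourierProj_apply, coeffCLM_expCLM hω]
    split_ifs with h
    · subst h; rfl
    · simp
  hasSum x := hasSum_expCLM_coeffCLM hω x
  hasSum_norm_sq x := by
    have h := (lp.summable_norm_sq (fourierEquiv hω H x)).hasSum
    rw [← lp.norm_sq_eq_tsum, LinearIsometryEquiv.norm_map] at h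
    refine h.congr_fun fun l => ?_
    rw [fourierProj_apply, norm_expCLM hω, fourierEquiv_apply]
  eq_zero x hx := by
    refine eq_zero_of_coeffCLM_eq_zero hω fun l => ?_
    rw [← norm_eq_zero, ← norm_expCLM hω l, ← fourierProj_apply, hx, norm_zero]

end

/-! ### The domain of `L₀` in terms of Fourier coefficients -/

section

variable {H : Type*} [NormedAddCommGroup H] [InnerProductSpace ℂ H] [CompleteSpace H]

theorem exists_integral_norm_le (ω : ℝ) (H : Type*) [NormedAddCommGroup H] : ∃ C : ℝ, 0 ≤ C ∧
    ∀ g : L2 ω H, ∫ s, ‖g s‖ ∂(intervalMeasure ω) ≤ C * ‖g‖ := by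
  refine ⟨_, ENNReal.toReal_nonneg (a := intervalMeasure ω Set.univ ^
    (1 / (1 : ENNReal).toReal - 1 / (2 : ENNReal).toReal)), fun g => ?_⟩
  have hg := Lp.memLp g
  rw [integral_norm_eq_lintegral_enorm hg.1, ← eLpNorm_one_eq_lintegral_enorm, Lp.norm_def,
    mul_comm, ← ENNReal.toReal_mul]
  refine ENNReal.toReal_mono ?_ (eLpNorm_le_eLpNorm_mul_rpow_measure_univ (by norm_num) hg.1)
  refine ENNReal.mul_ne_top hg.2.ne (ENNReal.rpow_ne_top_of_nonneg ?_ (measure_ne_top _ _))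
  norm_num

theorem integral_intervalMeasure {ω : ℝ} (hω : 0 < ω) {E : Type*} [NormedAddCommGroup E]
    [NormedSpace ℝ E] (f : ℝ → E) :
    ∫ s, f s ∂(intervalMeasure ω) = ω⁻¹ • ∫ s in Set.Icc 0 ω, f s := by
  unfold intervalMeasure
  rw [integral_smul_measure, ENNReal.toReal_ofReal (inv_nonneg.2 hω.le)]

theorem norm_primitive_le {ω : ℝ} (hω : 0 < ω) (g : L2 ω H) {s : ℝ} (hs : s ∈ Set.Icc 0 ω) :
    ‖∫ τ in (0 : ℝ)..s, g τ‖ ≤ ω * ∫ τ, ‖g τ‖ ∂(intervalMeasure ω) := by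
  rw [integral_intervalMeasure hω, smul_eq_mul, mul_inv_cancel_left₀ hω.ne']
  refine (intervalIntegral.norm_integral_le_integral_norm hs.1).trans ?_
  rw [intervalIntegral.integral_of_le hs.1]
  exact setIntegral_mono_set (L2.integrableOn hω g).norm
    (Filter.Eventually.of_forall fun _ => norm_nonneg _)
    (Filter.Eventually.of_forall
      (Set.Ioc_subset_Icc_self.trans (Set.Icc_subset_Icc_right hs.2)))

theorem ae_mem_Icc {ω : ℝ} (hω : 0 < ω) : ∀ᵐ s ∂(intervalMeasure ω), s ∈ Set.Icc 0 ω :=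
  (ae_intervalMeasure_iff hω).2 (ae_restrict_mem measurableSet_Icc)

theorem memLp_primitive {ω : ℝ} (hω : 0 < ω) (g : L2 ω H) :
    MemLp (fun s => ∫ τ in (0 : ℝ)..s, g τ) 2 (intervalMeasure ω) := by
  refine MemLp.of_bound ?_ (ω * ∫ τ, ‖g τ‖ ∂(intervalMeasure ω)) ?_
  · have h : ContinuousOn (fun s => ∫ τ in (0 : ℝ)..s, g τ) (Set.Icc 0 ω) := by
      have := intervalIntegral.continuousOn_primitive_interval (μ := volume) (f := g)
        (a := 0) (b := ω) (by rw [Set.uIcc_of_le hω.le]; exact L2.integrableOn hω g)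
      rwa [Set.uIcc_of_le hω.le] at this
    have h2 := h.aestronglyMeasurable (μ := volume) measurableSet_Icc
    unfold intervalMeasure
    exact h2.mono_ac Measure.smul_absolutelyContinuous
  · filter_upwards [ae_mem_Icc hω] with s hs
    exact norm_primitive_le hω g hs

theorem primitive_congr {ω : ℝ} (hω : 0 < ω) {f g : ℝ → H} (h : f =ᵐ[intervalMeasure ω] g) {s : ℝ}
    (hs : s ∈ Set.Icc 0 ω) : ∫ τ in (0 : ℝ)..s, f τ = ∫ τ in (0 : ℝ)..s, g τ := by
  have hae := (ae_intervalMeasure_iff hω).1 h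
  rw [ae_restrict_iff' measurableSet_Icc] at hae
  refine intervalIntegral.integral_congr_ae ?_
  filter_upwards [hae] with t ht htm
  rw [Set.uIoc_of_le hs.1] at htm
  exact ht ⟨htm.1.le, htm.2.trans hs.2⟩

/-- The primitive `(K g)(s) = ∫₀^s g` as a bounded operator in `L²([0, ω], H)`. -/
noncomputable def primitiveCLM {ω : ℝ} (hω : 0 < ω) (H : Type*) [NormedAddCommGroup H]
    [InnerProductSpace ℂ H] [CompleteSpace H] : L2 ω H →L[ℂ] L2 ω H :=
  LinearMap.mkContinuousOfExistsBound
    { toFun := fun g => (memLp_primitive hω g).toLp _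
      map_add' := fun g₁ g₂ => by
        rw [← MemLp.toLp_add]
        refine MemLp.toLp_congr _ _ ?_
        filter_upwards [ae_mem_Icc hω] with s hs
        rw [primitive_congr hω (Lp.coeFn_add g₁ g₂) hs, Pi.add_apply]
        exact intervalIntegral.integral_add (L2.intervalIntegrable hω g₁ hs)
          (L2.intervalIntegrable hω g₂ hs)
      map_smul' := fun c g => by
        rw [RingHom.id_apply, ← MemLp.toLp_const_smul]
        refine MemLp.toLp_congr _ _ ?_
        filter_upwards [ae_mem_Icc hω] with s hs
        rw [primitive_congr hω (Lp.coeFn_smul c g) hs, Pi.smul_apply]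
        exact intervalIntegral.integral_smul c _ }
    (by
      obtain ⟨C, hC, hle⟩ := exists_integral_norm_le ω H
      refine ⟨(measureUnivNNReal (intervalMeasure ω) : ℝ) ^ (2 : ENNReal).toReal⁻¹ * (ω * C),
        fun g => ?_⟩
      rw [mul_assoc]
      refine Lp.norm_le_of_ae_bound (by positivity) ?_
      filter_upwards [(memLp_primitive hω g).coeFn_toLp, ae_mem_Icc hω] with s hs hsm
      rw [mul_assoc]
      change ‖(memLp_primitive hω g).toLp _ s‖ ≤ _
      rw [hs]
      refine (norm_primitive_le hω g hsm).trans ?_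
      gcongr
      exact hle g)

theorem primitiveCLM_coeFn {ω : ℝ} (hω : 0 < ω) (g : L2 ω H) :
    primitiveCLM hω H g =ᵐ[intervalMeasure ω] fun s => ∫ τ in (0 : ℝ)..s, g τ :=
  (memLp_primitive hω g).coeFn_toLp

theorem expCLM_zero_coeFn (ω : ℝ) (c : H) :
    expCLM ω H 0 c =ᵐ[intervalMeasure ω] fun _ => c := by
  filter_upwards [expCLM_coeFn ω 0 c] with s hs
  rw [hs]
  simp [freq]

theorem integral_eq_coeffCLM_zero {ω : ℝ} (hω : 0 < ω) (g : L2 ω H) :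
    ∫ τ in (0 : ℝ)..ω, g τ = ω • coeffCLM ω H 0 g := by
  rw [coeffCLM_apply, fourierInt, smul_smul, mul_inv_cancel₀ hω.ne', one_smul,
    integral_Icc_eq_integral_Ioc, intervalIntegral.integral_of_le hω.le]
  simp [freq]

/-- Periodicity of the primitive is vanishing of the mean of `g`. In this form the relation involves
only bounded operators on `L²`, whence its closedness. -/
theorem isPeriodicDeriv_iff {ω : ℝ} (hω : 0 < ω) (y g : L2 ω H) :
    IsPeriodicDeriv ω y g ↔
      coeffCLM ω H 0 g = 0 ∧ ∃ c, y = expCLM ω H 0 c + primitiveCLM hω H g := by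
  constructor
  · rintro ⟨f, hy, hf, hp⟩
    constructor
    · have h1 := hf ω ⟨hω.le, le_rfl⟩
      rw [← hp, left_eq_add, integral_eq_coeffCLM_zero hω, smul_eq_zero] at h1
      exact h1.resolve_left hω.ne'
    · refine ⟨f 0, Lp.ext ?_⟩
      filter_upwards [hy, Lp.coeFn_add (expCLM ω H 0 (f 0)) (primitiveCLM hω H g),
        expCLM_zero_coeFn ω (f 0), primitiveCLM_coeFn hω g, ae_mem_Icc hω] with s h1 h2 h3 h4 h5
      rw [h1, h2, Pi.add_apply, h3, h4, hf s h5]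
  · rintro ⟨h0, c, rfl⟩
    refine ⟨fun s => c + ∫ τ in (0 : ℝ)..s, g τ, ?_, fun s _ => by simp, ?_⟩
    · filter_upwards [Lp.coeFn_add (expCLM ω H 0 c) (primitiveCLM hω H g),
        expCLM_zero_coeFn ω c, primitiveCLM_coeFn hω g] with s h2 h3 h4
      rw [h2, Pi.add_apply, h3, h4]
    · simp [integral_eq_coeffCLM_zero hω, h0]

theorem isClosed_isPeriodicDeriv {ω : ℝ} (hω : 0 < ω) :
    IsClosed {p : L2 ω H × L2 ω H | IsPeriodicDeriv ω p.1 p.2} := by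
  -- The constant is eliminated: it must be the zeroth coefficient of `y` minus the primitive of
  -- `g`.
  have h : {p : L2 ω H × L2 ω H | IsPeriodicDeriv ω p.1 p.2} =
      {p | coeffCLM ω H 0 p.2 = 0} ∩ {p | p.1 =
        expCLM ω H 0 (coeffCLM ω H 0 (p.1 - primitiveCLM hω H p.2)) + primitiveCLM hω H p.2} := by
    ext ⟨y, g⟩
    simp only [Set.mem_ofPred_eq, Set.mem_inter_iff, isPeriodicDeriv_iff hω]
    refine and_congr_right fun _ => ⟨?_, fun h => ⟨_, h⟩⟩
    rintro ⟨c, rfl⟩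
    rw [add_sub_cancel_right, coeffCLM_expCLM hω, if_pos rfl]
  rw [h]
  refine (isClosed_eq (by fun_prop) (by fun_prop)).inter (isClosed_eq (by fun_prop) (by fun_prop))

theorem isPeriodicDeriv_expCLM {ω : ℝ} (hω : 0 < ω) (l : ℤ) (h : H) :
    IsPeriodicDeriv ω (expCLM ω H l h) (freq ω l • expCLM ω H l h) := by
  refine ⟨fun s => Complex.exp (freq ω l * s) • h, expCLM_coeFn ω l h, fun s hs => ?_, ?_⟩
  · have h1 : (freq ω l • expCLM ω H l h : L2 ω H) =ᵐ[intervalMeasure ω]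
        fun s : ℝ => (freq ω l * Complex.exp (freq ω l * s)) • h := by
      filter_upwards [Lp.coeFn_smul (freq ω l) (expCLM ω H l h), expCLM_coeFn ω l h] with s h2 h3
      rw [h2, Pi.smul_apply, h3, smul_smul]
    have hd : ∀ t ∈ Set.uIcc 0 s, HasDerivAt (fun s : ℝ => Complex.exp (freq ω l * s) • h)
        ((freq ω l * Complex.exp (freq ω l * t)) • h) t := fun t _ => by
      have h2 : HasDerivAt (fun s : ℝ => freq ω l * (s : ℂ)) (freq ω l) t := by
        simpa using (Complex.ofRealCLM.hasDerivAt (x := t)).const_mul (freq ω l)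
      have h3 := h2.cexp.smul_const h
      rwa [mul_comm] at h3
    rw [primitive_congr hω h1 hs, intervalIntegral.integral_eq_sub_of_hasDerivAt hd
      (Continuous.intervalIntegrable (by fun_prop) _ _)]
    abel
  · simp [exp_freq_mul_period hω]

theorem IsPeriodicDeriv.sum {ω : ℝ} {ι : Type*} (s : Finset ι) {y g : ι → L2 ω H}
    (h : ∀ i, IsPeriodicDeriv ω (y i) (g i)) :
    IsPeriodicDeriv ω (∑ i ∈ s, y i) (∑ i ∈ s, g i) := by
  classical
  induction s using Finset.induction_on with
  | empty => simpa using IsPeriodicDeriv.zero ω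
  | insert i s hi ih =>
    rw [Finset.sum_insert hi, Finset.sum_insert hi]
    exact (h i).add ih

/-- The partial Fourier sums of `(y, g)` satisfy the relation by linearity, and the relation is
closed. -/
theorem isPeriodicDeriv_of_coeff {ω : ℝ} (hω : 0 < ω) {y g : L2 ω H}
    (h : ∀ l, coeffCLM ω H l g = freq ω l • coeffCLM ω H l y) : IsPeriodicDeriv ω y g := by
  have hy := hasSum_expCLM_coeffCLM hω y
  have hg := hasSum_expCLM_coeffCLM hω g
  refine (isClosed_isPeriodicDeriv hω).mem_of_tendsto (hy.prodMk_nhds hg)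
    (Filter.Eventually.of_forall fun s => ?_)
  refine IsPeriodicDeriv.sum s fun l => ?_
  rw [h, map_smul]
  exact isPeriodicDeriv_expCLM hω l _

theorem norm_freq_inv_le {ω : ℝ} (hω : 0 < ω) (l : ℤ) :
    ‖(freq ω l)⁻¹‖ ≤ ω / (2 * Real.pi) := by
  by_cases h : l = 0
  · subst h
    simp only [freq, Int.cast_zero, mul_zero, zero_div, inv_zero, norm_zero]
    positivity
  · have := norm_freq_sub_inv_le_of_ne hω h
    simpa [freq] using this

/-- No integration by parts is needed: the vector with coefficients `ĝ(l) / λ_l` also has derivative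
`g`, and two such vectors differ by a constant, which affects only the coefficient at `0`. There
both sides vanish, as `g` has mean zero and `λ_0 = 0`. -/
theorem IsPeriodicDeriv.coeff {ω : ℝ} (hω : 0 < ω) {y g : L2 ω H} (h : IsPeriodicDeriv ω y g)
    (l : ℤ) : coeffCLM ω H l g = freq ω l • coeffCLM ω H l y := by
  have hm : Memℓp (fun l => (freq ω l)⁻¹ • coeffCLM ω H l g) 2 := by
    refine memℓp_two_iff.2 (((lp.summable_norm_sq (fourierEquiv hω H g)).mul_left
      ((ω / (2 * Real.pi)) ^ 2)).of_nonneg_of_le (fun _ => sq_nonneg _) fun l => ?_)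
    rw [norm_smul, mul_pow, fourierEquiv_apply]
    gcongr
    exact norm_freq_inv_le hω l
  obtain ⟨h0, c, hc⟩ := (isPeriodicDeriv_iff hω y g).1 h
  have h2 : IsPeriodicDeriv ω ((fourierEquiv hω H).symm ⟨_, hm⟩) g := by
    refine isPeriodicDeriv_of_coeff hω fun l => ?_
    rw [coeffCLM_fourierEquiv_symm]
    change _ = freq ω l • (freq ω l)⁻¹ • coeffCLM ω H l g
    by_cases hl : l = 0
    · subst hl
      rw [h0]; simp
    · have : freq ω l ≠ 0 := by
        simpa [freq] using freq_sub_ne_zero hω hl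
      rw [smul_inv_smul₀ this]
  obtain ⟨-, c', hc'⟩ := (isPeriodicDeriv_iff hω _ g).1 h2
  by_cases hl : l = 0
  · subst hl
    rw [h0]; simp [freq]
  · have hne : freq ω l ≠ 0 := by
      simpa [freq] using freq_sub_ne_zero hω hl
    have h3 := congrArg (coeffCLM ω H l) hc
    have h4 := congrArg (coeffCLM ω H l) hc'
    rw [map_add, coeffCLM_expCLM hω, if_neg hl, zero_add] at h3 h4
    rw [h3, ← h4, coeffCLM_fourierEquiv_symm]
    exact (smul_inv_smul₀ hne _).symm

theorem mem_domain_opL0_iff {ω : ℝ} (hω : 0 < ω) (y : L2 ω H) :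
    y ∈ (opL0 ω H).domain ↔ Memℓp (fun l => freq ω l • coeffCLM ω H l y) 2 := by
  constructor
  · rintro ⟨g, hg⟩
    have := lp.memℓp (fourierEquiv hω H g)
    refine (congrArg (fun f => Memℓp f 2) (funext fun l => ?_)).mp this
    rw [fourierEquiv_apply, hg.coeff hω]
  · intro h
    refine ⟨(fourierEquiv hω H).symm ⟨_, h⟩, isPeriodicDeriv_of_coeff hω fun l => ?_⟩
    rw [coeffCLM_fourierEquiv_symm]

theorem coeffCLM_opL0 {ω : ℝ} (hω : 0 < ω) (y : (opL0 ω H).domain) (l : ℤ) :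
    coeffCLM ω H l (opL0 ω H y) = freq ω l • coeffCLM ω H l (y : L2 ω H) :=
  ((opL0_apply_eq_iff y _).1 rfl).coeff hω l

theorem mem_graph_opL0_iff {ω : ℝ} (y g : L2 ω H) :
    (y, g) ∈ (opL0 ω H).graph ↔ IsPeriodicDeriv ω y g := by
  rw [LinearPMap.mem_graph_iff]
  constructor
  · rintro ⟨z, hz, hg⟩
    simp only at hz hg
    rw [← hz]
    exact (opL0_apply_eq_iff z g).1 hg
  · exact fun h => ⟨⟨y, g, h⟩, rfl, (opL0_apply_eq_iff _ g).2 h⟩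

theorem isClosed_opL0 {ω : ℝ} (hω : 0 < ω) : (opL0 ω H).IsClosed := by
  have h := isClosed_isPeriodicDeriv (H := H) hω
  refine (congrArg _root_.IsClosed ?_).mp h
  ext ⟨y, g⟩
  exact (mem_graph_opL0_iff y g).symm

theorem expCLM_mem_domain {ω : ℝ} (hω : 0 < ω) (l : ℤ) (h : H) :
    expCLM ω H l h ∈ (opL0 ω H).domain := ⟨_, isPeriodicDeriv_expCLM hω l h⟩

/-- Cauchy--Schwarz with the square-summable sequences `(λ_l - 1)⁻¹` and `(λ_l - 1) ŷ(l)`. This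
absolute convergence is what puts `D(L₀)` inside `D(V)`. -/
theorem summable_norm_coeffCLM {ω : ℝ} (hω : 0 < ω) {y : L2 ω H} (hy : y ∈ (opL0 ω H).domain) :
    Summable fun l => ‖coeffCLM ω H l y‖ := by
  rw [mem_domain_opL0_iff hω] at hy
  have h1 : Memℓp (fun l => (freq ω l - (1 : ℝ)) • fourierEquiv hω H y l) 2 := by
    refine (memℓp_freq_smul_iff (μ := 1) (fourierEquiv hω H y)).1 ?_
    simpa only [fourierEquiv_apply] using hy
  refine summable_norm_of_le_mul (summable_norm_freq_sub_real_inv_sq hω le_rfl)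
    (memℓp_two_iff.1 h1) fun l => ?_
  rw [← norm_smul, inv_smul_smul₀ (freq_sub_real_ne_zero ω l one_pos), fourierEquiv_apply]

/-! ### The perturbation `V` in terms of Fourier coefficients -/

theorem ae_reflect {ω : ℝ} {p : ℝ → Prop} (h : ∀ᵐ s ∂(intervalMeasure ω), p s) :
    ∀ᵐ s ∂(intervalMeasure ω), p (ω - s) :=
  (measurePreserving_reflect ω).quasiMeasurePreserving.ae h

theorem opV_coeFn {ω : ℝ} {𝒱 : ℝ → H →L[ℂ] H} (y : (opV ω 𝒱).domain) :
    opV ω 𝒱 y =ᵐ[intervalMeasure ω] fun s => 𝒱 s ((y : L2 ω H) (ω - s)) :=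
  MemLp.coeFn_toLp y.2

theorem mem_graph_opV {ω : ℝ} {𝒱 : ℝ → H →L[ℂ] H} {y z : L2 ω H}
    (h : z =ᵐ[intervalMeasure ω] fun s => 𝒱 s (y (ω - s))) : (y, z) ∈ (opV ω 𝒱).graph := by
  have hy : y ∈ (opV ω 𝒱).domain := (Lp.memLp z).ae_eq h
  rw [LinearPMap.mem_graph_iff]
  exact ⟨⟨y, hy⟩, rfl, Lp.ext ((opV_coeFn _).trans h.symm)⟩

/-- Along a common subsequence both components converge almost everywhere, and each `𝒱 s` is
continuous. No bound uniform in `s` enters. -/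
theorem isClosed_opV (ω : ℝ) (𝒱 : ℝ → H →L[ℂ] H) : (opV ω 𝒱).IsClosed := by
  refine IsSeqClosed.isClosed fun u p hu hp => ?_
  obtain ⟨y, z⟩ := p
  have hy : Filter.Tendsto (fun n => (u n).1) Filter.atTop (nhds y) :=
    (continuous_fst.tendsto _).comp hp
  have hz : Filter.Tendsto (fun n => (u n).2) Filter.atTop (nhds z) :=
    (continuous_snd.tendsto _).comp hp
  obtain ⟨ns, hns, h1⟩ := (tendstoInMeasure_of_tendsto_Lp hy).exists_seq_tendsto_ae
  obtain ⟨ms, hms, h2⟩ := (tendstoInMeasure_of_tendsto_Lp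
    (hz.comp hns.tendsto_atTop)).exists_seq_tendsto_ae
  have hall : ∀ᵐ s ∂(intervalMeasure ω), ∀ n, (u n).2 s = 𝒱 s ((u n).1 (ω - s)) :=
    ae_all_iff.2 fun n => by
      obtain ⟨w, hw1, hw2⟩ := (LinearPMap.mem_graph_iff _).1 (hu n)
      rw [← hw1, ← hw2]
      exact opV_coeFn w
  refine mem_graph_opV ?_
  filter_upwards [ae_reflect h1, h2, hall] with s h1 h2 h3
  refine tendsto_nhds_unique h2 ?_
  simp only [Function.comp_apply, h3]
  exact ((𝒱 s).continuous.tendsto _).comp (h1.comp hms.tendsto_atTop)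

end

section

variable {H : Type*} [NormedAddCommGroup H] [InnerProductSpace ℂ H] [CompleteSpace H]

theorem memLp_exp_neg_smul {ω : ℝ} {f : ℝ → H} (l : ℤ) (hf : MemLp f 2 (intervalMeasure ω)) :
    MemLp (fun s : ℝ => Complex.exp (-(freq ω l * s)) • f s) 2 (intervalMeasure ω) :=
  MemLp.of_le hf (integrable_exp_smul ω l hf).aestronglyMeasurable
    (Filter.Eventually.of_forall fun s => by rw [norm_smul, norm_exp_neg_freq_mul, one_mul])

/-- Since `e^{λ_l ω} = 1`, the reflected exponential is `e^{-λ_l s}`, which moves the `j`-th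
coefficient of `𝒱(·) h` to the `(j + l)`-th: the Hankel structure. The norm bound is uniform in `l`.
-/
theorem exists_opV_expCLM {ω : ℝ} (hω : 0 < ω) (𝒱 : ℝ → H →L[ℂ] H)
    (h𝒱 : ∀ x : H, MemLp (fun s => 𝒱 s x) 2 (intervalMeasure ω)) (l : ℤ) (h : H) :
    ∃ z : L2 ω H, (expCLM ω H l h, z) ∈ (opV ω 𝒱).graph ∧ ‖z‖ ≤ ‖toL2CLM ω 𝒱 h𝒱‖ * ‖h‖ ∧
      ∀ j, coeffCLM ω H j z = potentialCoeff ω 𝒱 h𝒱 (j + l) h := by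
  have hz := (memLp_exp_neg_smul l (h𝒱 h)).coeFn_toLp
  refine ⟨(memLp_exp_neg_smul l (h𝒱 h)).toLp _, mem_graph_opV ?_, ?_, fun j => ?_⟩
  · filter_upwards [hz, ae_reflect (expCLM_coeFn ω l h)] with s h1 h2
    rw [h1, h2, map_smul]
    congr 1
    rw [Complex.ofReal_sub, mul_sub, Complex.exp_sub, exp_freq_mul_period hω, Complex.exp_neg,
      one_div]
  · refine le_trans ?_ ((toL2CLM ω 𝒱 h𝒱).le_opNorm h)
    refine Lp.norm_le_norm_of_ae_le ?_
    filter_upwards [hz, toL2CLM_coeFn ω 𝒱 h𝒱 h] with s h1 h2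
    rw [h1, h2, norm_smul, norm_exp_neg_freq_mul, one_mul]
  · rw [potentialCoeff_apply, coeffCLM_apply, fourierInt_eq, fourierInt_eq]
    refine integral_congr_ae ?_
    filter_upwards [hz] with s h1
    rw [h1, smul_smul, ← Complex.exp_add]
    congr 2
    unfold freq
    push_cast
    ring

/-- `D(L₀) ⊆ D(V)`, and `V` acts on Fourier coefficients by the Hankel block matrix of `𝒱̂`. -/
theorem opV_of_mem_domain_opL0 {ω : ℝ} (hω : 0 < ω) (𝒱 : ℝ → H →L[ℂ] H)
    (h𝒱 : ∀ x : H, MemLp (fun s => 𝒱 s x) 2 (intervalMeasure ω)) {y : L2 ω H}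
    (hy : y ∈ (opL0 ω H).domain) : ∃ hy' : y ∈ (opV ω 𝒱).domain, ∀ j,
      coeffCLM ω H j (opV ω 𝒱 ⟨y, hy'⟩) =
        ∑' l, potentialCoeff ω 𝒱 h𝒱 (j + l) (coeffCLM ω H l y) := by
  choose z hz hzn hzc using fun l => exists_opV_expCLM hω 𝒱 h𝒱 l (coeffCLM ω H l y)
  have hsum : Summable z :=
    Summable.of_norm_bounded ((summable_norm_coeffCLM hω hy).mul_left _) hzn
  -- The images of the Fourier terms of `y` are absolutely summable, so closedness of `V` carries
  -- the partial sums to the limit.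
  have hmem : (y, ∑' l, z l) ∈ (opV ω 𝒱).graph := by
    refine (isClosed_opV ω 𝒱).mem_of_tendsto
      ((hasSum_expCLM_coeffCLM hω y).prodMk_nhds hsum.hasSum)
      (Filter.Eventually.of_forall fun s => ?_)
    have h := Submodule.sum_mem (opV ω 𝒱).graph (t := s) fun l _ => hz l
    rwa [show ∑ l ∈ s, (expCLM ω H l (coeffCLM ω H l y), z l) = (_, _) from
      Prod.ext Prod.fst_sum Prod.snd_sum] at h
  obtain ⟨w, hw1, hw2⟩ := (LinearPMap.mem_graph_iff _).1 hmem
  simp only at hw1 hw2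
  subst hw1
  refine ⟨w.2, fun j => ?_⟩
  rw [hw2, (coeffCLM ω H j).map_tsum hsum]
  exact tsum_congr fun l => hzc l j

/-! ### Hilbert--Schmidt operators in `L²([0, ω], H)` from block matrices -/

/-- The operator in `L²([0, ω], H)` of a Hilbert--Schmidt block matrix. -/
noncomputable def blockL2 {ω : ℝ} (hω : 0 < ω) (X : BlockHS (H →L[ℂ] H)) :
    L2 ω H →L[ℂ] L2 ω H :=
  ((fourierEquiv hω H).symm.toContinuousLinearEquiv : lp (fun _ : ℤ => H) 2 →L[ℂ] L2 ω H) ∘L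
    blockOp X ∘L
      ((fourierEquiv hω H).toContinuousLinearEquiv : L2 ω H →L[ℂ] lp (fun _ : ℤ => H) 2)

theorem fourierEquiv_blockL2 {ω : ℝ} (hω : 0 < ω) (X : BlockHS (H →L[ℂ] H)) (x : L2 ω H) :
    fourierEquiv hω H (blockL2 hω X x) = blockOp X (fourierEquiv hω H x) :=
  (fourierEquiv hω H).apply_symm_apply _

theorem coeffCLM_blockL2 {ω : ℝ} (hω : 0 < ω) (X : BlockHS (H →L[ℂ] H)) (x : L2 ω H) (j : ℤ) :
    coeffCLM ω H j (blockL2 hω X x) = ∑' l, X (j, l) (coeffCLM ω H l x) := by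
  rw [← fourierEquiv_apply hω, fourierEquiv_blockL2, blockOp_apply]
  simp only [fourierEquiv_apply]

theorem norm_blockL2_le {ω : ℝ} (hω : 0 < ω) (X : BlockHS (H →L[ℂ] H)) :
    ‖blockL2 hω X‖ ≤ ‖X‖ := by
  refine ContinuousLinearMap.opNorm_le_bound _ (norm_nonneg X) fun x => ?_
  rw [← (fourierEquiv hω H).norm_map (blockL2 hω X x), fourierEquiv_blockL2,
    ← (fourierEquiv hω H).norm_map x]
  exact (blockOp X).le_of_opNorm_le (norm_blockOp_le X) _

theorem blockL2_add {ω : ℝ} (hω : 0 < ω) (X Y : BlockHS (H →L[ℂ] H)) :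
    blockL2 hω (X + Y) = blockL2 hω X + blockL2 hω Y := by
  ext1 x
  apply (fourierEquiv hω H).injective
  rw [add_apply, map_add, fourierEquiv_blockL2, fourierEquiv_blockL2, fourierEquiv_blockL2,
    map_add, add_apply]

theorem blockL2_blockMul {ω : ℝ} (hω : 0 < ω) (X Y : BlockHS (H →L[ℂ] H)) :
    blockL2 hω (blockMul X Y) = blockL2 hω X * blockL2 hω Y := by
  ext1 x
  apply (fourierEquiv hω H).injective
  change _ = fourierEquiv hω H (blockL2 hω X (blockL2 hω Y x))
  rw [fourierEquiv_blockL2, fourierEquiv_blockL2, fourierEquiv_blockL2, blockOp_blockMul]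
  rfl

theorem norm_coeffCLM_le {ω : ℝ} (hω : 0 < ω) (l : ℤ) (x : L2 ω H) :
    ‖coeffCLM ω H l x‖ ≤ ‖x‖ := by
  rw [← fourierEquiv_apply hω, ← (fourierEquiv hω H).norm_map x]
  exact lp.norm_apply_le_norm (by norm_num) _ _

theorem isHilbertSchmidtWrt_blockL2 {ω : ℝ} (hω : 0 < ω) (X : BlockHS (H →L[ℂ] H)) :
    IsHilbertSchmidtWrt (fourierProj ω H) (blockL2 hω X) := by
  refine (lp.summable_norm_sq X).of_nonneg_of_le (fun _ => sq_nonneg _) ?_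
  rintro ⟨j, l⟩
  refine pow_le_pow_left₀ (norm_nonneg _) ?_ 2
  refine ContinuousLinearMap.opNorm_le_bound _ (norm_nonneg _) fun x => ?_
  change ‖expCLM ω H j (coeffCLM ω H j (blockL2 hω X (expCLM ω H l (coeffCLM ω H l x))))‖ ≤ _
  rw [norm_expCLM hω, coeffCLM_blockL2]
  have h : ∀ n, n ≠ l → X (j, n) (coeffCLM ω H n (expCLM ω H l (coeffCLM ω H l x))) = 0 :=
    fun n hn => by rw [coeffCLM_expCLM hω, if_neg hn, map_zero]
  rw [tsum_eq_single l h, coeffCLM_expCLM hω, if_pos rfl]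
  refine (ContinuousLinearMap.le_opNorm _ _).trans ?_
  gcongr
  exact norm_coeffCLM_le hω l x

/-! ### Similarity of perturbations of `L₀` -/

/-- `A` has the domain of `L₀` and acts on Fourier coefficients as `L₀` minus the block
matrix `M`. -/
structure IsPerturbation (ω : ℝ) (A : L2 ω H →ₗ.[ℂ] L2 ω H) (M : ℤ → ℤ → H →L[ℂ] H) : Prop where
  domain_eq : A.domain = (opL0 ω H).domain
  coeff_apply : ∀ (y : A.domain) (j : ℤ), coeffCLM ω H j (A y) =
    freq ω j • coeffCLM ω H j (y : L2 ω H) - ∑' l, M j l (coeffCLM ω H l (y : L2 ω H))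

theorem isPerturbation_opL {ω : ℝ} (hω : 0 < ω) (𝒱 : ℝ → H →L[ℂ] H)
    (h𝒱 : ∀ x : H, MemLp (fun s => 𝒱 s x) 2 (intervalMeasure ω)) :
    IsPerturbation ω (opL ω 𝒱) fun j l => potentialCoeff ω 𝒱 h𝒱 (j + l) where
  domain_eq := inf_eq_left.2 fun _ hy => (opV_of_mem_domain_opL0 hω 𝒱 h𝒱 hy).1
  coeff_apply y j := by
    obtain ⟨hy, h⟩ := opV_of_mem_domain_opL0 hω 𝒱 h𝒱 y.2.1
    change coeffCLM ω H j (opL0 ω H ⟨y, y.2.1⟩ - opV ω 𝒱 ⟨y, hy⟩) = _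
    rw [map_sub, coeffCLM_opL0 hω, ← h]

theorem isPerturbation_sub_blockL2 {ω : ℝ} (hω : 0 < ω) (X : BlockHS (H →L[ℂ] H)) :
    IsPerturbation ω (opL0 ω H - boundedPMap (blockL2 hω X)) fun j l => X (j, l) where
  domain_eq := inf_eq_left.2 fun _ _ => Submodule.mem_top
  coeff_apply y j := by
    rw [LinearPMap.sub_apply, map_sub, coeffCLM_opL0 hω, ← coeffCLM_blockL2 hω]
    rfl

/-- If `L₀ W - W L₀ = M + M W - N - W N` for a small Hilbert--Schmidt matrix `W`, then `I + W`
is a similarity transform of `L₀ - M` into `L₀ - N`. -/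
theorem exists_similarity {ω : ℝ} (hω : 0 < ω) {A₁ A₂ : L2 ω H →ₗ.[ℂ] L2 ω H}
    {M : ℤ → ℤ → H →L[ℂ] H} (W N : BlockHS (H →L[ℂ] H)) (hA₁ : IsPerturbation ω A₁ M)
    (hA₂ : IsPerturbation ω A₂ fun j l => N (j, l)) (hW : ‖W‖ < 1)
    (hM : ∀ j, Summable fun l => ‖M j l‖ ^ 2) {K : ℝ}
    (hc : ∀ l, Summable fun j => ‖(freq ω j - freq ω l) • W (j, l)‖ ^ 2)
    (hK : ∀ l, ∑' j, ‖(freq ω j - freq ω l) • W (j, l)‖ ^ 2 ≤ K)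
    (heq : ∀ j l, (freq ω j - freq ω l) • W (j, l) =
      M j l + (∑' n, M j n * W (n, l)) - N (j, l) - blockMul W N (j, l)) :
    ∃ U : L2 ω H ≃L[ℂ] L2 ω H, (U : L2 ω H →L[ℂ] L2 ω H) = 1 + blockL2 hω W ∧
      IsSimilarityTransform A₁ A₂ U := by
  obtain ⟨U, hU⟩ := exists_equiv_one_add (blockL2 hω W) ((norm_blockL2_le hω W).trans_lt hW)
  have hUx : ∀ x, U x = x + blockL2 hω W x := fun x =>
    congrArg (fun T : L2 ω H →L[ℂ] L2 ω H => T x) hU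
  have hdom : ∀ x, U x ∈ (opL0 ω H).domain ↔ x ∈ (opL0 ω H).domain := fun x => by
    have h := memℓp_freq_smul_add_blockOp_iff hω W hW hc hK (fourierEquiv hω H x)
    rw [← fourierEquiv_blockL2, ← map_add, ← hUx] at h
    simp only [fourierEquiv_apply] at h
    rwa [mem_domain_opL0_iff hω, mem_domain_opL0_iff hω]
  refine ⟨U, hU, ?_, fun x hx => ?_⟩
  · rw [hA₁.domain_eq, hA₂.domain_eq]
    ext z
    constructor
    · rintro ⟨x, hx, rfl⟩
      exact (hdom x).2 hx
    · intro hz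
      obtain ⟨x, rfl⟩ := U.surjective z
      exact ⟨x, (hdom x).1 hz, rfl⟩
  · set f : lp (fun _ : ℤ => H) 2 := fourierEquiv hω H x with hf
    set a : lp (fun _ : ℤ => H) 2 := fourierEquiv hω H (A₂ x) with ha
    have hfl : ∀ l, coeffCLM ω H l (x : L2 ω H) = f l := fun l => (fourierEquiv_apply hω _ l).symm
    have hal : ∀ l, a l = freq ω l • f l - blockOp N f l := fun l => by
      rw [ha, fourierEquiv_apply, hA₂.coeff_apply]
      simp only [hfl]
      rfl
    have hUl : ∀ l, coeffCLM ω H l (U x) = f l + blockOp W f l := fun l => by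
      rw [← fourierEquiv_apply hω, hUx, map_add, fourierEquiv_blockL2]
      rfl
    refine eq_of_coeffCLM_eq hω fun j => ?_
    have hr : coeffCLM ω H j (U (A₂ x)) = a j + blockOp W a j := by
      rw [← fourierEquiv_apply hω, hUx, map_add, fourierEquiv_blockL2]
      rfl
    rw [hr, hA₁.coeff_apply]
    simp only [hUl, map_add]
    have sMf := summable_row_apply (hM j) (lp.summable_norm_sq f)
    have sMW := summable_row_apply (hM j) (lp.summable_norm_sq (blockOp W f))
    rw [sMf.tsum_add sMW, tsum_row_blockOp (hM j), hal j]
    have sWa := W.summable_apply a j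
    have sWNf := W.summable_apply (blockOp N f) j
    have sWf := W.summable_apply f j
    have sNf := N.summable_apply f j
    have sWN := (blockMul W N).summable_apply f j
    have hWNf : ∑' l, W (j, l) (blockOp N f l) = ∑' l, blockMul W N (j, l) (f l) :=
      tsum_row_blockOp (W.summable_row j) N f
    -- The series `∑ λ_l W (j, l) (f l)` is obtained as the sum of the series for `W a` and `W N f`,
    -- both summable because `a = A₂ x` and `N f` are in `ℓ²`. After that the commutator equation
    -- applies term by term.
    have key : ∑' l, (∑' n, M j n * W (n, l)) (f l) =
        freq ω j • (∑' l, W (j, l) (f l)) -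
          ((∑' l, W (j, l) (a l)) + ∑' l, W (j, l) (blockOp N f l)) -
          (∑' l, M j l (f l)) + (∑' l, N (j, l) (f l)) +
          ∑' l, blockMul W N (j, l) (f l) := by
      refine (HasSum.tsum_eq ?_)
      convert ((((sWf.hasSum.const_smul (freq ω j)).sub (sWa.hasSum.add sWNf.hasSum)).sub
        sMf.hasSum).add sNf.hasSum).add sWN.hasSum using 1
      ext l
      have h1 := congrArg (fun T : H →L[ℂ] H => T (f l)) (heq j l)
      simp only [smul_apply, add_apply, sub_apply] at h1
      rw [hal l, map_sub, map_smul, sub_add_cancel, ← sub_smul, h1]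
      abel
    rw [key, hWNf, smul_add]
    rw [blockOp_apply W f j, blockOp_apply N f j, blockOp_apply W a j]
    abel

theorem IsSimilarityTransform.comp {E : Type*} [NormedAddCommGroup E] [InnerProductSpace ℂ E]
    [CompleteSpace E] {A₁ A₂ A₃ : E →ₗ.[ℂ] E} {U₁ U₂ : E ≃L[ℂ] E}
    (h₁ : IsSimilarityTransform A₁ A₂ U₁) (h₂ : IsSimilarityTransform A₂ A₃ U₂) :
    IsSimilarityTransform A₁ A₃ (U₂.trans U₁) where
  map_domain := by
    rw [← h₁.map_domain, ← h₂.map_domain, ← Submodule.map_comp]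
    rfl
  intertwine x hx := by
    have hm : U₂ x ∈ A₂.domain := by
      rw [← h₂.map_domain]
      exact ⟨x, x.2, rfl⟩
    exact (h₁.intertwine ⟨U₂ x, hm⟩ hx).trans (congrArg U₁ (h₂.intertwine x hm))

end

/-! ### Orthogonal direct sums -/

section

variable {E : Type*} [NormedAddCommGroup E] [InnerProductSpace ℂ E] [CompleteSpace E]

theorem IsResolutionOfIdentity.mul_self {ι : Type*} {P : ι → E →L[ℂ] E}
    (hP : IsResolutionOfIdentity P) (i : ι) (x : E) : P i (P i x) = P i x := by
  classical
  have h := hP.mul i i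
  rw [if_pos rfl] at h
  exact congrArg (fun T : E →L[ℂ] E => T x) h

theorem IsResolutionOfIdentity.mul_of_ne {ι : Type*} {P : ι → E →L[ℂ] E}
    (hP : IsResolutionOfIdentity P) {i j : ι} (hij : i ≠ j) (x : E) : P i (P j x) = 0 := by
  classical
  have h := hP.mul i j
  rw [if_neg hij] at h
  exact congrArg (fun T : E →L[ℂ] E => T x) h

theorem IsResolutionOfIdentity.apply_of_mem_range {ι : Type*} {P : ι → E →L[ℂ] E}
    (hP : IsResolutionOfIdentity P) {i : ι} {x : E} (hx : x ∈ (P i).range) : P i x = x := by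
  obtain ⟨y, rfl⟩ := hx
  exact hP.mul_self i y

theorem IsResolutionOfIdentity.apply_of_mem_range_of_ne {ι : Type*} {P : ι → E →L[ℂ] E}
    (hP : IsResolutionOfIdentity P) {i j : ι} (hij : i ≠ j) {x : E} (hx : x ∈ (P j).range) :
    P i x = 0 := by
  obtain ⟨y, rfl⟩ := hx
  exact hP.mul_of_ne hij y

theorem IsResolutionOfIdentity.orthogonalFamily {ι : Type*} {P : ι → E →L[ℂ] E}
    (hP : IsResolutionOfIdentity P) :
    OrthogonalFamily ℂ (fun i => (P i).range) fun i => ((P i).range).subtypeₗᵢ :=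
  fun i j hij v w => by
    have h := (ContinuousLinearMap.isSelfAdjoint_iff_isSymmetric.1 (hP.selfAdjoint i)) v w
    change inner ℂ (P i v) (w : E) = inner ℂ (v : E) (P i w) at h
    rw [hP.apply_of_mem_range v.2, hP.apply_of_mem_range_of_ne hij w.2, inner_zero_right] at h
    exact h

/-- Parseval's identity follows by pairing `x = ∑ P_i x` with `x`, as `⟪x, P_i x⟫ = ‖P_i x‖²` for a
self-adjoint idempotent. -/
theorem isResolutionOfIdentity_of_hasSum {ι : Type*} {P : ι → E →L[ℂ] E}
    (hs : ∀ i, IsSelfAdjoint (P i)) (hm : ∀ i x, P i (P i x) = P i x)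
    (hn : ∀ i j x, i ≠ j → P i (P j x) = 0) (hP : ∀ x, HasSum (fun i => P i x) x) :
    IsResolutionOfIdentity P where
  selfAdjoint := hs
  mul i j := by
    ext1 x
    change P i (P j x) = _
    split_ifs with h
    · subst h; exact hm i x
    · exact hn i j x h
  hasSum := hP
  hasSum_norm_sq x := by
    have h1 := ((hP x).mapL (innerSL ℂ x)).mapL Complex.reCLM
    have h2 : ∀ y : E, Complex.reCLM (innerSL ℂ y y) = ‖y‖ ^ 2 := fun y => by
      simp [← Complex.ofReal_pow]
    rw [h2] at h1
    refine h1.congr_fun fun i => ?_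
    rw [← h2, innerSL_apply_apply, innerSL_apply_apply]
    have h3 := (ContinuousLinearMap.isSelfAdjoint_iff_isSymmetric.1 (hs i)) x (P i x)
    change inner ℂ (P i x) (P i x) = inner ℂ x (P i (P i x)) at h3
    rw [h3, hm]
  eq_zero x hx := by
    have h := hP x
    simp only [hx] at h
    exact h.unique hasSum_zero

/-- A closed operator that is reduced by every projection of a resolution of the identity, with
bounded parts, is the orthogonal direct sum of its parts. -/
theorem isOrthogonalDirectSum_of_reduces {ι : Type*} {P : ι → E →L[ℂ] E} {A : E →ₗ.[ℂ] E}
    {B : ∀ i, (P i).range →L[ℂ] (P i).range} (hP : IsResolutionOfIdentity P) (hA : A.IsClosed)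
    (hr : ∀ i, (P i).range ≤ A.domain)
    (hc : ∀ (i) (x : A.domain), P i (A x) = B i ((P i).rangeRestrict x)) :
    IsOrthogonalDirectSum P A B := by
  have hpart : ∀ (i) (x : (P i).range) (hx : (x : E) ∈ A.domain), A ⟨x, hx⟩ = B i x := by
    intro i x hx
    have hxi : (P i).rangeRestrict (x : E) = x := Subtype.ext (hP.apply_of_mem_range x.2)
    have h1 : P i (A ⟨x, hx⟩) = B i x := by rw [hc, hxi]
    refine (hP.hasSum (A ⟨x, hx⟩)).unique ?_
    rw [← h1]
    refine hasSum_single i fun j hj => ?_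
    have hxj : (P j).rangeRestrict (x : E) = 0 :=
      Subtype.ext (hP.apply_of_mem_range_of_ne hj x.2)
    rw [hc, hxj, map_zero]
    rfl
  have hsum : ∀ x : A.domain, HasSum (fun i => (B i ((P i).rangeRestrict x) : E)) (A x) :=
    fun x => (hP.hasSum (A x)).congr_fun fun i => (hc i x).symm
  refine ⟨hP, hA, fun x => ⟨fun hx => ?_, fun hx => ?_⟩, hr, hpart, hsum⟩
  · refine (hP.hasSum_norm_sq (A ⟨x, hx⟩)).summable.congr fun i => ?_
    rw [hc]
    rfl
  -- Square summability of the orthogonal parts makes `∑ B_i P_i x` converge. The finite partial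
  -- sums of `(P_i x, B_i P_i x)` lie in the graph of `A`, so closedness puts `x` in the domain.
  · obtain ⟨z, hz⟩ := (hP.orthogonalFamily.summable_iff_norm_sq_summable
      fun i => B i ((P i).rangeRestrict x)).2 hx
    have hmem : (x, z) ∈ A.graph := by
      refine hA.mem_of_tendsto ((hP.hasSum x).prodMk_nhds hz)
        (Filter.Eventually.of_forall fun s => ?_)
      have h := Submodule.sum_mem A.graph (t := s)
        (f := fun i => (P i x, (B i ((P i).rangeRestrict x) : E))) fun i _ => by
          rw [LinearPMap.mem_graph_iff]
          exact ⟨⟨P i x, hr i ⟨x, rfl⟩⟩, rfl, hpart i ((P i).rangeRestrict x) _⟩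
      rwa [show ∑ i ∈ s, (P i x, (B i ((P i).rangeRestrict x) : E)) = (_, _) from
        Prod.ext Prod.fst_sum Prod.snd_sum] at h
    obtain ⟨w, hw, -⟩ := (LinearPMap.mem_graph_iff _).1 hmem
    simp only at hw
    rw [← hw]
    exact w.2

theorem boundedPMap_apply (X : E →L[ℂ] E) (x : (boundedPMap X).domain) :
    boundedPMap X x = X x := rfl

theorem isClosed_sub_boundedPMap {A : E →ₗ.[ℂ] E} (hA : A.IsClosed) (X : E →L[ℂ] E) :
    (A - boundedPMap X).IsClosed := by
  have h : IsClosed ((fun p : E × E => (p.1, p.2 + X p.1)) ⁻¹' (A.graph : Set (E × E))) :=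
    hA.preimage (by fun_prop)
  refine (congrArg _root_.IsClosed ?_).mp h
  ext ⟨x, y⟩
  simp only [Set.mem_preimage, SetLike.mem_coe, LinearPMap.mem_graph_iff]
  constructor
  · rintro ⟨w, rfl, hw⟩
    refine ⟨⟨w, w.2, Submodule.mem_top⟩, rfl, ?_⟩
    rw [LinearPMap.sub_apply, boundedPMap_apply, hw, add_sub_cancel_right]
  · rintro ⟨w, rfl, hw⟩
    refine ⟨⟨w, w.2.1⟩, rfl, ?_⟩
    rw [LinearPMap.sub_apply, boundedPMap_apply] at hw
    rw [← hw, sub_add_cancel]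

theorem isClosed_boundedPMap (X : E →L[ℂ] E) : (boundedPMap X).IsClosed := by
  have h : IsClosed {p : E × E | X p.1 = p.2} := isClosed_eq (by fun_prop) (by fun_prop)
  refine (congrArg _root_.IsClosed ?_).mp h
  ext ⟨x, y⟩
  simp only [Set.mem_ofPred_eq, SetLike.mem_coe, LinearPMap.mem_graph_iff]
  exact ⟨fun h => ⟨⟨x, Submodule.mem_top⟩, rfl, h⟩, fun ⟨w, hw, h⟩ => hw ▸ h⟩

theorem IsSimilarityTransform.apply_mem_domain_iff {A₁ A₂ : E →ₗ.[ℂ] E} {U : E ≃L[ℂ] E}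
    (h : IsSimilarityTransform A₁ A₂ U) (x : E) : U x ∈ A₁.domain ↔ x ∈ A₂.domain := by
  rw [← h.map_domain]
  constructor
  · rintro ⟨y, hy, hxy⟩
    rwa [← U.injective hxy]
  · exact fun hx => ⟨x, hx, rfl⟩

theorem IsSimilarityTransform.conjPMap_eq {A₁ A₂ : E →ₗ.[ℂ] E} {U : E ≃L[ℂ] E}
    (h : IsSimilarityTransform A₁ A₂ U) : conjPMap U A₁ = A₂ := by
  refine LinearPMap.ext ?_ fun x hx hx' => ?_
  · ext x
    exact h.apply_mem_domain_iff x
  · change U.symm (A₁ ⟨U x, hx⟩) = _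
    rw [h.intertwine ⟨x, hx'⟩ hx, U.symm_apply_apply]

theorem IsSimilarityTransform.isClosed {A₁ A₂ : E →ₗ.[ℂ] E} {U : E ≃L[ℂ] E}
    (h : IsSimilarityTransform A₁ A₂ U) (hA : A₂.IsClosed) : A₁.IsClosed := by
  have hp : IsClosed ((fun p : E × E => (U.symm p.1, U.symm p.2)) ⁻¹'
      (A₂.graph : Set (E × E))) := hA.preimage (by fun_prop)
  refine (congrArg _root_.IsClosed ?_).mp hp
  ext ⟨x, y⟩
  obtain ⟨x, rfl⟩ := U.surjective x
  simp only [Set.mem_preimage, SetLike.mem_coe, LinearPMap.mem_graph_iff, U.symm_apply_apply]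
  constructor
  · rintro ⟨w, rfl, hw⟩
    have hm := (h.apply_mem_domain_iff (w : E)).2 w.2
    exact ⟨⟨U w, hm⟩, rfl, by rw [h.intertwine w hm, hw, U.apply_symm_apply]⟩
  · rintro ⟨⟨w, hw⟩, rfl, rfl⟩
    have hm := (h.apply_mem_domain_iff x).1 hw
    exact ⟨⟨x, hm⟩, rfl, by rw [h.intertwine ⟨x, hm⟩ hw, U.symm_apply_apply]⟩

/-! ### Coarsening -/

/-- The indices `ℓ` that are merged into a block of the coarser family. -/
noncomputable def blockIndices (k : ℕ) : Option {ℓ : ℤ // (k : ℤ) < |ℓ|} → Finset ℤ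
  | none => Finset.Icc (-(k : ℤ)) k
  | some ℓ => {(ℓ : ℤ)}

theorem coarsen_eq_sum (P : ℤ → E →L[ℂ] E) (k : ℕ) (i : Option {ℓ : ℤ // (k : ℤ) < |ℓ|}) :
    coarsen P k i = ∑ ℓ ∈ blockIndices k i, P ℓ := by
  cases i with
  | none => rfl
  | some ℓ => exact (Finset.sum_singleton _ _).symm

theorem disjoint_blockIndices {k : ℕ} {i j : Option {ℓ : ℤ // (k : ℤ) < |ℓ|}} (hij : i ≠ j) :
    Disjoint (blockIndices k i) (blockIndices k j) := by
  rw [Finset.disjoint_left]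
  intro m hi hj
  rcases i with _ | ⟨i, hi'⟩ <;> rcases j with _ | ⟨j, hj'⟩ <;>
    simp only [blockIndices, Finset.mem_Icc, Finset.mem_singleton] at hi hj
  · exact hij rfl
  · subst hj
    exact absurd (abs_le.2 hi) (not_le.2 hj')
  · subst hi
    exact absurd (abs_le.2 hj) (not_le.2 hi')
  · subst hi
    subst hj
    exact hij rfl

theorem SameBlock.mem_blockIndices_iff {k : ℕ} {j l : ℤ} (h : SameBlock k j l)
    (i : Option {ℓ : ℤ // (k : ℤ) < |ℓ|}) : j ∈ blockIndices k i ↔ l ∈ blockIndices k i := by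
  rcases h with rfl | ⟨h1, h2⟩
  · rfl
  rcases i with _ | ⟨i, hi⟩ <;> simp only [blockIndices, Finset.mem_Icc, Finset.mem_singleton]
  · exact iff_of_true (abs_le.1 h1) (abs_le.1 h2)
  · refine iff_of_false ?_ ?_ <;> rintro rfl
    · exact absurd h1 (not_le.2 hi)
    · exact absurd h2 (not_le.2 hi)

theorem IsResolutionOfIdentity.apply_sum {P : ℤ → E →L[ℂ] E} (hP : IsResolutionOfIdentity P)
    (s : Finset ℤ) (m : ℤ) (x : E) : P m ((∑ l ∈ s, P l) x) = if m ∈ s then P m x else 0 := by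
  rw [sum_apply, map_sum]
  split_ifs with h
  · rw [Finset.sum_eq_single_of_mem m h fun l _ hl => hP.mul_of_ne hl.symm x, hP.mul_self]
  · exact Finset.sum_eq_zero fun l hl =>
      hP.mul_of_ne (fun e : m = l => h (e ▸ hl)) x

/-- The finite central sum is subtracted, the rest is a sum over the subtype `|l| > k`, and the
central sum returns as the value at `none`. -/
theorem hasSum_coarsen {P : ℤ → E →L[ℂ] E} (k : ℕ) {x : E} (h : HasSum (fun l => P l x) x) :
    HasSum (fun i => coarsen P k i x) x := by
  classical
  set s : Finset ℤ := Finset.Icc (-(k : ℤ)) k with hs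
  have h1 : HasSum (fun l => if l ∈ s then P l x else 0) (∑ l ∈ s, P l x) := by
    have : HasSum (fun l => if l ∈ s then P l x else 0)
        (∑ l ∈ s, if l ∈ s then P l x else 0) :=
      hasSum_sum_of_ne_finset_zero fun l hl => if_neg hl
    rwa [Finset.sum_congr rfl fun l hl => if_pos hl] at this
  have h2 : HasSum (fun l : {l : ℤ // (k : ℤ) < |l|} => P l x) (x - ∑ l ∈ s, P l x) := by
    refine (hasSum_subtype_iff_indicator (s := {l : ℤ | (k : ℤ) < |l|})
      (f := fun l => P l x)).2 ((h.sub h1).congr_fun fun l => ?_)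
    have hl : l ∈ s ↔ ¬ (k : ℤ) < |l| := by rw [hs, Finset.mem_Icc, ← abs_le, not_lt]
    by_cases hk : (k : ℤ) < |l|
    · simp [Set.indicator, hl, hk]
    · simp [Set.indicator, hl, hk]
  have h3 : HasSum (fun i : Option {l : ℤ // (k : ℤ) < |l|} => i.elim 0 fun l => P l x)
      (x - ∑ l ∈ s, P l x) := by
    refine ((Option.some_injective _).hasSum_iff fun i hi => ?_).1 h2
    cases i with
    | none => rfl
    | some l => exact absurd ⟨l, rfl⟩ hi
  have h4 := h3.add (hasSum_ite_eq (none : Option {l : ℤ // (k : ℤ) < |l|}) (∑ l ∈ s, P l x))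
  rw [sub_add_cancel] at h4
  refine h4.congr_fun fun i => ?_
  cases i with
  | none => simp [coarsen, hs]
  | some l => simp [coarsen]

theorem IsResolutionOfIdentity.coarsen {P : ℤ → E →L[ℂ] E} (hP : IsResolutionOfIdentity P)
    (k : ℕ) : IsResolutionOfIdentity (coarsen P k) := by
  refine isResolutionOfIdentity_of_hasSum (fun i => ?_) (fun i x => ?_) (fun i j x hij => ?_)
    fun x => hasSum_coarsen k (hP.hasSum x)
  · rw [coarsen_eq_sum]
    exact isSelfAdjoint_sum _ fun l _ => hP.selfAdjoint l
  · rw [coarsen_eq_sum, sum_apply, sum_apply]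
    refine Finset.sum_congr rfl fun l hl => ?_
    rw [← sum_apply, hP.apply_sum, if_pos hl]
  · rw [coarsen_eq_sum, coarsen_eq_sum, sum_apply]
    refine Finset.sum_eq_zero fun l hl => ?_
    rw [hP.apply_sum, if_neg (Finset.disjoint_left.1 (disjoint_blockIndices hij) hl)]

end

/-! ### Reduction of `L₀` and of block-diagonal operators by the coarser family -/

section

variable {H : Type*} [NormedAddCommGroup H] [InnerProductSpace ℂ H] [CompleteSpace H]

theorem coeffCLM_fourierProj {ω : ℝ} (hω : 0 < ω) (m l : ℤ) (x : L2 ω H) :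
    coeffCLM ω H m (fourierProj ω H l x) = if m = l then coeffCLM ω H m x else 0 := by
  rw [fourierProj_apply, coeffCLM_expCLM hω]
  split_ifs with h
  · rw [h]
  · rfl

theorem coeffCLM_coarsen {ω : ℝ} (hω : 0 < ω) {k : ℕ} (i : Option {ℓ : ℤ // (k : ℤ) < |ℓ|})
    (m : ℤ) (x : L2 ω H) : coeffCLM ω H m (coarsen (fourierProj ω H) k i x) =
      if m ∈ blockIndices k i then coeffCLM ω H m x else 0 := by
  rw [coarsen_eq_sum, sum_apply, map_sum]
  simp only [coeffCLM_fourierProj hω]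
  exact Finset.sum_ite_eq _ _ _

/-- The restriction of `L₀` to a block, as a bounded operator in `L²([0, ω], H)`. -/
noncomputable def blockL0 (ω : ℝ) (H : Type*) [NormedAddCommGroup H] [InnerProductSpace ℂ H]
    [CompleteSpace H] (k : ℕ) (i : Option {ℓ : ℤ // (k : ℤ) < |ℓ|}) : L2 ω H →L[ℂ] L2 ω H :=
  ∑ l ∈ blockIndices k i, freq ω l • fourierProj ω H l

theorem coeffCLM_blockL0 {ω : ℝ} (hω : 0 < ω) {k : ℕ} (i : Option {ℓ : ℤ // (k : ℤ) < |ℓ|})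
    (m : ℤ) (x : L2 ω H) : coeffCLM ω H m (blockL0 ω H k i x) =
      if m ∈ blockIndices k i then freq ω m • coeffCLM ω H m x else 0 := by
  rw [blockL0, sum_apply, map_sum]
  simp only [smul_apply, map_smul, coeffCLM_fourierProj hω, smul_ite, smul_zero]
  exact Finset.sum_ite_eq _ _ _

theorem mem_range_coarsen_iff {ω : ℝ} (hω : 0 < ω) {k : ℕ}
    (i : Option {ℓ : ℤ // (k : ℤ) < |ℓ|}) (x : L2 ω H) :
    x ∈ (coarsen (fourierProj ω H) k i).range ↔
      ∀ m, m ∉ blockIndices k i → coeffCLM ω H m x = 0 := by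
  constructor
  · rintro ⟨y, rfl⟩ m hm
    exact (coeffCLM_coarsen hω i m y).trans (if_neg hm)
  · refine fun h => ⟨x, eq_of_coeffCLM_eq hω fun m => (coeffCLM_coarsen hω i m x).trans ?_⟩
    split_ifs with hm
    · rfl
    · exact (h m hm).symm

theorem blockL0_mem_range {ω : ℝ} (hω : 0 < ω) {k : ℕ} (i : Option {ℓ : ℤ // (k : ℤ) < |ℓ|})
    (x : L2 ω H) : blockL0 ω H k i x ∈ (coarsen (fourierProj ω H) k i).range :=
  (mem_range_coarsen_iff hω i _).2 fun m hm => (coeffCLM_blockL0 hω i m x).trans (if_neg hm)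

theorem fourierProj_mem_domain {ω : ℝ} (hω : 0 < ω) (l : ℤ) (x : L2 ω H) :
    fourierProj ω H l x ∈ (opL0 ω H).domain :=
  expCLM_mem_domain hω l _

theorem range_coarsen_le_domain {ω : ℝ} (hω : 0 < ω) {k : ℕ}
    (i : Option {ℓ : ℤ // (k : ℤ) < |ℓ|}) :
    (coarsen (fourierProj ω H) k i).range ≤ (opL0 ω H).domain := by
  rintro _ ⟨x, rfl⟩
  change coarsen (fourierProj ω H) k i x ∈ _
  rw [coarsen_eq_sum, sum_apply]
  exact Submodule.sum_mem _ fun l _ => fourierProj_mem_domain hω l x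

theorem coarsen_opL0 {ω : ℝ} (hω : 0 < ω) {k : ℕ} (i : Option {ℓ : ℤ // (k : ℤ) < |ℓ|})
    (x : (opL0 ω H).domain) : coarsen (fourierProj ω H) k i (opL0 ω H x) =
      blockL0 ω H k i (coarsen (fourierProj ω H) k i x) := by
  refine eq_of_coeffCLM_eq hω fun m => ?_
  rw [coeffCLM_coarsen hω, coeffCLM_blockL0 hω, coeffCLM_coarsen hω, coeffCLM_opL0 hω]
  split_ifs <;> rfl

/-- A nonzero entry `N (m, l)` has both indices in the same block, so cutting off rows or columns by
a block has the same effect. Invariance of the blocks under `V₀` follows. -/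
theorem coarsen_blockL2 {ω : ℝ} (hω : 0 < ω) {k : ℕ} {N : BlockHS (H →L[ℂ] H)}
    (hN : ∀ j l, ¬ SameBlock k j l → N (j, l) = 0) (i : Option {ℓ : ℤ // (k : ℤ) < |ℓ|})
    (x : L2 ω H) : coarsen (fourierProj ω H) k i (blockL2 hω N x) =
      blockL2 hω N (coarsen (fourierProj ω H) k i x) := by
  refine eq_of_coeffCLM_eq hω fun m => ?_
  rw [coeffCLM_coarsen hω, coeffCLM_blockL2, coeffCLM_blockL2]
  simp only [coeffCLM_coarsen hω]
  split_ifs with hm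
  · refine tsum_congr fun l => ?_
    by_cases h : SameBlock k m l
    · rw [if_pos ((h.mem_blockIndices_iff i).1 hm)]
    · rw [hN m l h]; rfl
  · refine (tsum_zero.symm.trans (tsum_congr fun l => ?_))
    by_cases h : SameBlock k m l
    · rw [if_neg fun h' => hm ((h.mem_blockIndices_iff i).2 h'), map_zero]
    · rw [hN m l h]; rfl

/-- The operator `L₀` is the orthogonal direct sum of the `λ_ℓ I_ℓ`. -/
theorem isOrthogonalDirectSum_opL0 {ω : ℝ} (hω : 0 < ω) :
    IsOrthogonalDirectSum (fourierProj ω H) (opL0 ω H)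
      (fun ℓ => freq ω ℓ • ContinuousLinearMap.id ℂ (fourierProj ω H ℓ).range) := by
  refine isOrthogonalDirectSum_of_reduces (isResolutionOfIdentity_fourierProj hω)
    (isClosed_opL0 hω) (fun i => ?_) fun i x => ?_
  · rintro _ ⟨x, rfl⟩
    exact fourierProj_mem_domain hω i x
  · change _ = freq ω i • fourierProj ω H i x
    rw [fourierProj_apply, fourierProj_apply, coeffCLM_opL0 hω, map_smul]

/-! ### Composition of the two transforms, and the main theorem. -/

theorem exists_similarity_to_blockDiagonal {ω : ℝ} (hω : 0 < ω) (𝒱 : ℝ → H →L[ℂ] H)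
    (h𝒱 : ∀ x : H, MemLp (fun s => 𝒱 s x) 2 (intervalMeasure ω))
    (hsq : Summable fun n : ℤ => ‖potentialCoeff ω 𝒱 h𝒱 n‖ ^ 2)
    (hprod : Summable fun p : ℤ × ℤ =>
      ‖∑' n : {n : ℤ // n ≠ p.2}, ((p.2 - n : ℤ) : ℂ)⁻¹ •
        (potentialCoeff ω 𝒱 h𝒱 (p.1 + n) * potentialCoeff ω 𝒱 h𝒱 (p.2 + n))‖ ^ 2) :
    ∃ (k : ℕ) (U : L2 ω H ≃L[ℂ] L2 ω H) (W N : BlockHS (H →L[ℂ] H)),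
      (U : L2 ω H →L[ℂ] L2 ω H) = 1 + blockL2 hω W ∧
      (∀ j l, ¬ SameBlock k j l → N (j, l) = 0) ∧
      IsSimilarityTransform (opL ω 𝒱) (opL0 ω H - boundedPMap (blockL2 hω N)) U := by
  obtain ⟨G, Q, hG, hGv, hGQ⟩ := exists_hankel_transform hω hsq hprod
  have hcol : ∀ l, Summable fun j => ‖potentialCoeff ω 𝒱 h𝒱 (j + l)‖ ^ 2 := fun l =>
    (summable_shift hsq l).congr fun j => by rw [add_comm]
  have hle : ∀ j l, ‖(freq ω j - freq ω l) • G (j, l)‖ ^ 2 ≤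
      ‖potentialCoeff ω 𝒱 h𝒱 (j + l)‖ ^ 2 := fun j l =>
    pow_le_pow_left₀ (norm_nonneg _) (hGv j l) 2
  have hc : ∀ l, Summable fun j => ‖(freq ω j - freq ω l) • G (j, l)‖ ^ 2 := fun l =>
    (hcol l).of_nonneg_of_le (fun _ => sq_nonneg _) fun j => hle j l
  -- Columns of `[L₀, G]` are dominated by Hankel columns, which are shifts of `v`; hence the
  -- uniform bound `∑ ‖v n‖²`.
  obtain ⟨U₁, hU₁, hS₁⟩ := exists_similarity hω G Q (isPerturbation_opL hω 𝒱 h𝒱)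
    (isPerturbation_sub_blockL2 hω Q) hG (summable_shift hsq) hc
    (fun l => ((hc l).tsum_le_tsum (fun j => hle j l) (hcol l)).trans_eq
      (tsum_shift (potentialCoeff ω 𝒱 h𝒱) l)) hGQ
  obtain ⟨k, W, N, hW, hN, hWN⟩ := exists_block_diagonalization hω Q
  -- In the second transform `[L₀, W] = C` is itself Hilbert--Schmidt, so `‖C‖²` bounds all its
  -- columns.
  let C : BlockHS (H →L[ℂ] H) := Q + blockMul Q W - N - blockMul W N
  have hC : ∀ j l, (freq ω j - freq ω l) • W (j, l) = C (j, l) := hWN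
  obtain ⟨U₂, hU₂, hS₂⟩ := exists_similarity hω W N (isPerturbation_sub_blockL2 hω Q)
    (isPerturbation_sub_blockL2 hω N) hW Q.summable_row (K := ‖C‖ ^ 2)
    (fun l => by simpa only [hC] using C.summable_col l)
    (fun l => by simpa only [hC] using C.tsum_col_le l) hWN
  -- The composite is `(I + G)(I + W)`, with `I + W` acting first.
  refine ⟨k, U₂.trans U₁, G + W + blockMul G W, N, ?_, hN, hS₁.comp hS₂⟩
  rw [blockL2_add, blockL2_add, blockL2_blockMul]
  change (U₁ : L2 ω H →L[ℂ] L2 ω H) * (U₂ : L2 ω H →L[ℂ] L2 ω H) = _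
  rw [hU₁, hU₂]
  noncomm_ring

end

theorem theorem2p5 {H : Type*} [NormedAddCommGroup H] [InnerProductSpace ℂ H] [CompleteSpace H]
    (ω : ℝ) (hω : 0 < ω) (𝒱 : ℝ → H →L[ℂ] H)
    (h𝒱 : ∀ x : H, MemLp (fun s => 𝒱 s x) 2 (intervalMeasure ω))
    (hsq : Summable fun n : ℤ => ‖potentialCoeff ω 𝒱 h𝒱 n‖ ^ 2)
    (hprod : Summable fun p : ℤ × ℤ =>
      ‖∑' n : {n : ℤ // n ≠ p.2}, ((p.2 - n : ℤ) : ℂ)⁻¹ •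
        (potentialCoeff ω 𝒱 h𝒱 (p.1 + n) * potentialCoeff ω 𝒱 h𝒱 (p.2 + n))‖ ^ 2) :
    -- `D(L₀) ⊆ D(V)`, so that `D(L) = D(L₀)`
    (opL0 ω H).domain ≤ (opV ω 𝒱).domain ∧ (opL ω 𝒱).domain = (opL0 ω H).domain ∧
    -- the `P_ℓ` form the resolution of the identity that belongs to `L₀`
    IsOrthogonalDirectSum (fourierProj ω H) (opL0 ω H)
      (fun ℓ => freq ω ℓ • ContinuousLinearMap.id ℂ (fourierProj ω H ℓ).range) ∧
    ∃ (k : ℕ) (U : L2 ω H ≃L[ℂ] L2 ω H) (W V₀ : L2 ω H →L[ℂ] L2 ω H),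
      (U : L2 ω H →L[ℂ] L2 ω H) = 1 + W ∧
      IsHilbertSchmidtWrt (fourierProj ω H) W ∧
      IsHilbertSchmidtWrt (fourierProj ω H) V₀ ∧
      -- `L U = U (L₀ - V₀)`
      IsSimilarityTransform (opL ω 𝒱) (opL0 ω H - boundedPMap V₀) U ∧
      -- `H_(k)` and `H_ℓ`, `|ℓ| > k`, are invariant for `V₀`
      ∃ hinv : ∀ i, ∀ x ∈ (coarsen (fourierProj ω H) k i).range,
          V₀ x ∈ (coarsen (fourierProj ω H) k i).range,
        -- `V₀ = V_{0(k)} ⊕ ⨁_{|ℓ| > k} V_{0,ℓ}`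
        IsOrthogonalDirectSum (coarsen (fourierProj ω H) k) (boundedPMap V₀)
          (fun i => V₀.restrict (hinv i)) ∧
        -- `L₀ = (L₀)_(k) ⊕ ⨁_{|ℓ| > k} λ_ℓ I_ℓ`
        ∃ Λ : ∀ i, (coarsen (fourierProj ω H) k i).range →L[ℂ]
            (coarsen (fourierProj ω H) k i).range,
          IsOrthogonalDirectSum (coarsen (fourierProj ω H) k) (opL0 ω H) Λ ∧
          (∀ ℓ : {ℓ : ℤ // (k : ℤ) < |ℓ|},
            Λ (some ℓ) = freq ω ℓ • ContinuousLinearMap.id ℂ _) ∧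
          -- `L = U (L₀ - (V_{0(k)} ⊕ ⨁_{|ℓ| > k} V_{0,ℓ})) U⁻¹`
          IsUOrthogonalDirectSum U (coarsen (fourierProj ω H) k) (opL ω 𝒱)
            (fun i => transportPart U (Λ i - V₀.restrict (hinv i))) := by
  refine ⟨fun _ hy => (opV_of_mem_domain_opL0 hω 𝒱 h𝒱 hy).1,
    (isPerturbation_opL hω 𝒱 h𝒱).domain_eq, isOrthogonalDirectSum_opL0 hω, ?_⟩
  obtain ⟨k, U, W, N, hU, hN, hS⟩ := exists_similarity_to_blockDiagonal hω 𝒱 h𝒱 hsq hprod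
  have hres := (isResolutionOfIdentity_fourierProj (H := H) hω).coarsen k
  have hinv : ∀ i, ∀ x ∈ (coarsen (fourierProj ω H) k i).range,
      blockL2 hω N x ∈ (coarsen (fourierProj ω H) k i).range := by
    rintro i _ ⟨x, rfl⟩
    exact ⟨blockL2 hω N x, coarsen_blockL2 hω hN i x⟩
  have hcl := isClosed_sub_boundedPMap (isClosed_opL0 (H := H) hω) (blockL2 hω N)
  refine ⟨k, U, blockL2 hω W, blockL2 hω N, hU, isHilbertSchmidtWrt_blockL2 hω W,
    isHilbertSchmidtWrt_blockL2 hω N, hS, hinv, ?_,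
    fun i => (blockL0 ω H k i).restrict fun x _ => blockL0_mem_range hω i x, ?_, fun ℓ => ?_,
    hS.isClosed hcl, _, ?_, fun _ => rfl⟩
  · exact isOrthogonalDirectSum_of_reduces hres (isClosed_boundedPMap _) (fun _ => le_top)
      fun i x => coarsen_blockL2 hω hN i x
  · exact isOrthogonalDirectSum_of_reduces hres (isClosed_opL0 hω)
      (range_coarsen_le_domain hω) fun i x => coarsen_opL0 hω i x
  · ext1 x
    refine Subtype.ext (eq_of_coeffCLM_eq hω fun m => ?_)
    refine (coeffCLM_blockL0 hω (some ℓ) m (x : L2 ω H)).trans ?_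
    change _ = coeffCLM ω H m (freq ω ℓ • (x : L2 ω H))
    rw [map_smul]
    split_ifs with hm
    · rw [Finset.mem_singleton.1 hm]
    · rw [(mem_range_coarsen_iff hω (some ℓ) (x : L2 ω H)).1 x.2 m hm, smul_zero]
  -- `U⁻¹ L U` equals `L₀ - V₀` with equality of domains, so it remains to see that `L₀ - V₀` is
  -- reduced by the coarser family.
  · rw [hS.conjPMap_eq]
    refine isOrthogonalDirectSum_of_reduces hres hcl
      (fun i x hx => ⟨range_coarsen_le_domain hω i hx, Submodule.mem_top⟩) fun i x => ?_
    rw [LinearPMap.sub_apply, map_sub, coarsen_opL0 hω, boundedPMap_apply,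
      coarsen_blockL2 hω hN]
    rfl
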